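/- **Setting.** Let $M$ be a compact Hausdorff space with a lamination $\mathcal F$ of class $C^r$, $1\le r\le\infty$, of leaf dimension $d\ge 1$. It is given by a finite foliated atlas $\varphi_i:U_i\to P_i\times T_i$ ($P_i\subset\mathbb R^d$ an open disc centred at $0$, $T_i$ locally compact, separable, metrizable) with changes of charts $(x,y)\mapsto(\varphi_{ij}^y(x),\gamma_{ij}(y))$, where $\gamma_{ij}$ is a homeomorphism between open subsets of $T_i$ and $T_j$, and $\varphi_{ij}^y$ is $C^r$ and depends continuously on $y$ in the $C^r$ topology. A plaque is a set $\varphi_i^{-1}(P_i\times\{y\})$, with centre $\varphi_i^{-1}(0,y)$, and a point $y\in T_i$ is identified with this centre. Let $g$ be a leafwise Riemannian metric, tangentially of class $C^{r-1}$ with derivatives continuous on $M$; $\mathrm{vol}$ is its volume along the leaves. Let $\mathcal R$ be the orbit equivalence relation on $T=\bigsqcup_i T_i$ of the holonomy pseudogroup generated by the $\gamma_{ij}$, and let $\delta:\mathcal R\to\mathbb R_+^*$ be a continuous cocycle: $\delta(x,y)\delta(y,z)=\delta(x,z)$, and $y\mapsto\delta(y,\gamma(y))$ is continuous for every $\gamma$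 in the pseudogroup. Fix a continuous, tangentially $C^r$ partition of unity $(\rho_k)$ subordinate to $(U_k)$. The modular form $\eta$ of $\delta$ is the leafwise $1$-form given on $U_i$ by $\sum_k c_{ki}\,d_{\mathcal F}\rho_k$, where $c_{ki}(p)=\log\delta(y_k(p),y_i(p))$ and $y_i(p)$ is the $T_i$-coordinate of $p$. On a leaf $L_y$ without holonomy through $y\in T$, let $h>0$ be such that $\log h$ is a primitive of $\eta$, and put $$\mathrm{vol}_\eta(V)=\int_V \tfrac{h}{h(y)}\,d\mathrm{vol},\qquad \mathrm{area}_\eta(S)=\int_S \tfrac{h}{h(y)}\,d\mathrm{area},$$ where $\mathrm{area}$ is the Riemannian $(d-1)$-volume (the $(d-1)$-dimensional Hausdorff measure of the leafwise distance). An *$\eta$-averaging sequence* is a sequence of non-empty compact domains $V_n$ (compact sets which are the closures of their interiors, in the leaf topology) in leaves without holonomy $L_{y_n}$, with $\mathrm{area}_\eta(\partial V_n)/\mathrm{vol}_\eta(V_n)\to 0$. A finite Borel measure $\mu$ on $M$ is *tangentially smooth* if on each $U_i$ it disintegrates as $\int \lambda_i^y\,d\nu_i(y)$, where $\nu_i$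 is a locally finite measure on $T_i$ and, for $\nu_i$-almost every $y$, $\lambda_i^y$ has a density $h_i(\cdot,y)$ of class $C^{r-1}$ with respect to $\mathrm{vol}$ on the plaque of $y$. It *has modular form $\eta$* if such densities can be chosen so that, for $\nu_i$-almost every $y$, $h_i(\cdot,y)>0$ and $d_{\mathcal F}\log h_i=\eta$ on the plaque of $y$. If $r\ge 3$, let $\Delta_{\mathcal F}$ be the leafwise Laplace operator of $g$; a function on a leaf is *harmonic* if $\Delta_{\mathcal F}$ annihilates it, and $\mu$ is *harmonic* if $\int\Delta_{\mathcal F}f\,d\mu=0$ for every continuous $f:M\to\mathbb R$ that is tangentially $C^{r-1}$, with tangential derivatives up to that order continuous on $M$. **Theorem.** Assume that $\mathcal F$ admits a $C^r$ foliated atlas (not necessarily the one above) whose plaques have bounded modified volume: the integrals over the plaques $P$ of $H\,d\mathrm{vol}$, where $\log H$ is a primitive of $\eta$ on $P$ and $H=1$ at the centre of $P$, are bounded. Let $(V_n)$ be an $\eta$-averaging sequence. Then the probability measures $$\mu_n(f)=\frac{1}{\mathrm{vol}_\eta(V_n)}\int_{V_n} f\,\frac{h}{h(y_n)}\,d\mathrm{vol}$$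 have a subsequence that converges weakly to a probability measure on $M$, and every such subsequential limit $\mu$ has the following properties. i) $\mu$ is tangentially smooth, its support is contained in the limit set $\{p\in M : p=\lim_k p_{n_k}\text{ for some } n_1<n_2<\cdots \text{ and } p_{n_k}\in V_{n_k}\}$, and its modular form is $\eta$. ii) If moreover $r\ge 3$ and $\eta$ has, along the leaves $L_{y_n}$, a primitive $\log h$ such that $h$ is harmonic, then $\mu$ is a harmonic measure. -/

import Mathlib

open Set Filter Topology MeasureTheory
open scoped ENNReal

noncomputable section

namespace Lamination

/-- The model space `ℝ^d` of the leaves. -/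
abbrev Model (d : ℕ) : Type := EuclideanSpace ℝ (Fin d)

/-- The standard basis vectors of `ℝ^d`. -/
def stdVec {d : ℕ} (a : Fin d) : Model d := EuclideanSpace.single a (1 : ℝ)

/-- `f(x, y)` is of class `C^n` in the tangential variable `x` on the open set `W`, and depends
continuously on the transverse variable `y` in the `C^n` topology: all tangential derivatives of
order at most `n` are jointly continuous. -/
def TangentiallyContDiffOn {d : ℕ} {Y F : Type*} [TopologicalSpace Y] [NormedAddCommGroup F]
    [NormedSpace ℝ F] (n : ℕ∞) (f : Model d × Y → F) (W : Set (Model d × Y)) : Prop :=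
  (∀ y : Y, ContDiffOn ℝ n (fun x => f (x, y)) {x | (x, y) ∈ W}) ∧
    ∀ k : ℕ, (k : ℕ∞) ≤ n →
      ContinuousOn (fun z : Model d × Y => iteratedFDeriv ℝ k (fun x => f (x, z.2)) z.1) W

/-- A foliated atlas of class `C^r`, of leaf dimension `d`, on `M`, with local transversals `T i`.
The chart `i` identifies the open set `U i` (its source) with the product of an open disc centred
at the origin and `T i`; the changes of charts are `(x, y) ↦ (φ_{ij}^y(x), γ_{ij}(y))`, where
`γ_{ij} = hol i j` is a homeomorphism between open subsets of `T i` and `T j` (its domain being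
the projection to `T i` of `U i ∩ U j`). -/
structure FoliatedAtlas (M : Type*) [TopologicalSpace M] (d : ℕ) (r : ℕ∞) {ι : Type*}
    (T : ι → Type*) [∀ i, TopologicalSpace (T i)] where
  chart : ∀ i, OpenPartialHomeomorph M (Model d × T i)
  radius : ι → ℝ
  radius_pos : ∀ i, 0 < radius i
  target_eq : ∀ i, (chart i).target = Metric.ball 0 (radius i) ×ˢ univ
  cover : ∀ p, ∃ i, p ∈ (chart i).source
  hol : ∀ i j, OpenPartialHomeomorph (T i) (T j)
  hol_source : ∀ i j, (hol i j).source =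
    (fun p => (chart i p).2) '' ((chart i).source ∩ (chart j).source)
  hol_apply : ∀ i j p, p ∈ (chart i).source → p ∈ (chart j).source →
    hol i j (chart i p).2 = (chart j p).2
  smooth : ∀ i j, TangentiallyContDiffOn r (fun z => (chart j ((chart i).symm z)).1)
    ((chart i).target ∩ (chart i).symm ⁻¹' (chart j).source)

namespace FoliatedAtlas

variable {M : Type*} [TopologicalSpace M] {d : ℕ} {r : ℕ∞} {ι : Type*} {T : ι → Type*}
  [∀ i, TopologicalSpace (T i)]

/-! ### Leaves, holonomy and the transverse equivalence relation -/

/-- The parametrization of the plaque through the point `s` of the total transversal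
`⊔ T i`; only its values on the disc of radius `radius s.1` are meaningful. -/
def plaqueMap (𝒜 : FoliatedAtlas M d r T) (s : Σ i, T i) (x : Model d) : M :=
  (𝒜.chart s.1).symm (x, s.2)

/-- The disc that parametrizes the plaques of the chart `i`. -/
def disc (𝒜 : FoliatedAtlas M d r T) (i : ι) : Set (Model d) := Metric.ball 0 (𝒜.radius i)

/-- The plaque through the point `s` of the total transversal. -/
def plaque (𝒜 : FoliatedAtlas M d r T) (s : Σ i, T i) : Set M :=
  𝒜.plaqueMap s '' 𝒜.disc s.1

/-- The point of `M` that corresponds to a point `s` of the total transversal. -/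
def base (𝒜 : FoliatedAtlas M d r T) (s : Σ i, T i) : M := 𝒜.plaqueMap s 0

/-- The compositions of the maps `γ_{ij}`. As `γ_{ji}` is the inverse of `γ_{ij}`, every
element of the holonomy pseudogroup agrees near each point of its domain with one of these. -/
inductive IsHolonomy (𝒜 : FoliatedAtlas M d r T) :
    ∀ {i j : ι}, OpenPartialHomeomorph (T i) (T j) → Prop
  | refl (i : ι) : IsHolonomy 𝒜 (OpenPartialHomeomorph.refl (T i))
  | step {i j : ι} (k : ι) (γ : OpenPartialHomeomorph (T i) (T j)) :
      IsHolonomy 𝒜 γ → IsHolonomy 𝒜 (γ.trans (𝒜.hol j k))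

/-- The equivalence relation `ℛ` on the total transversal: the orbit equivalence relation of the
holonomy pseudogroup. -/
def Rel (𝒜 : FoliatedAtlas M d r T) (s t : Σ i, T i) : Prop :=
  ∃ γ : OpenPartialHomeomorph (T s.1) (T t.1), 𝒜.IsHolonomy γ ∧ s.2 ∈ γ.source ∧ γ s.2 = t.2

/-- The leaf through the point `t` of the total transversal. -/
def leaf (𝒜 : FoliatedAtlas M d r T) (t : Σ i, T i) : Set M :=
  {p | ∃ i, p ∈ (𝒜.chart i).source ∧ 𝒜.Rel t ⟨i, (𝒜.chart i p).2⟩}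

/-- The leaf through `t` has no holonomy: at each point of its trace on the total transversal,
each element of the holonomy pseudogroup which fixes the point has the germ of the identity. -/
def NoHolonomy (𝒜 : FoliatedAtlas M d r T) (t : Σ i, T i) : Prop :=
  ∀ s : Σ i, T i, 𝒜.Rel t s → ∀ γ : OpenPartialHomeomorph (T s.1) (T s.1),
    𝒜.IsHolonomy γ → s.2 ∈ γ.source → γ s.2 = s.2 → ∀ᶠ y in 𝓝 s.2, γ y = y

/-- The leaf topology on `M`: a set is open if and only if its trace on each plaque is open in
that plaque (each leaf is open, and carries its manifold topology). -/
@[reducible] def leafTopology (𝒜 : FoliatedAtlas M d r T) : TopologicalSpace M :=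
  ⨆ s : Σ i, T i, TopologicalSpace.coinduced
    (fun x : 𝒜.disc s.1 => 𝒜.plaqueMap s x) inferInstance

/-- `V` is a compact domain in the leaf through `t`: a non-empty compact subset of the leaf
which is the closure of its interior, everything with respect to the leaf topology. -/
def IsCompactDomain (𝒜 : FoliatedAtlas M d r T) (t : Σ i, T i) (V : Set M) : Prop :=
  V ⊆ 𝒜.leaf t ∧ V.Nonempty ∧ @IsCompact M 𝒜.leafTopology V ∧
    @closure M 𝒜.leafTopology (@interior M 𝒜.leafTopology V) = V

/-- The boundary of `V` in the leaf topology. -/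
def leafBoundary (𝒜 : FoliatedAtlas M d r T) (V : Set M) : Set M :=
  @frontier M 𝒜.leafTopology V

/-- The function `f` on `M` is continuous and tangentially of class `C^n`. -/
def TangentiallyContDiff (𝒜 : FoliatedAtlas M d r T) (n : ℕ∞) (f : M → ℝ) : Prop :=
  ∀ i, TangentiallyContDiffOn n (fun z => f ((𝒜.chart i).symm z)) (𝒜.chart i).target

/-- Two foliated atlases of class `C^r` on `M` define the same lamination of class `C^r`. -/
def Compatible {ι' : Type*} {T' : ι' → Type*} [∀ i, TopologicalSpace (T' i)]
    (𝒜 : FoliatedAtlas M d r T) (ℬ : FoliatedAtlas M d r T') : Prop :=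
  ∀ i j, ∀ p ∈ (𝒜.chart i).source ∩ (ℬ.chart j).source,
    ∃ W : Set M, IsOpen W ∧ p ∈ W ∧ W ⊆ (𝒜.chart i).source ∩ (ℬ.chart j).source ∧
      (∀ q₁ ∈ W, ∀ q₂ ∈ W,
        (𝒜.chart i q₁).2 = (𝒜.chart i q₂).2 ↔ (ℬ.chart j q₁).2 = (ℬ.chart j q₂).2) ∧
      TangentiallyContDiffOn r (fun z => (ℬ.chart j ((𝒜.chart i).symm z)).1)
        ((𝒜.chart i).target ∩ (𝒜.chart i).symm ⁻¹' W) ∧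
      TangentiallyContDiffOn r (fun z => (𝒜.chart i ((ℬ.chart j).symm z)).1)
        ((ℬ.chart j).target ∩ (ℬ.chart j).symm ⁻¹' W)

/-! ### Cocycles and their modular forms -/

/-- A continuous cocycle `δ : ℛ → ℝ₊*`, where `ℛ` has the topology that comes from the étale
groupoid of germs of the holonomy pseudogroup. The values of `δ` outside `ℛ` play no role. -/
structure IsContinuousCocycle (𝒜 : FoliatedAtlas M d r T) (δ : (Σ i, T i) → (Σ i, T i) → ℝ) :
    Prop where
  pos : ∀ s t, 𝒜.Rel s t → 0 < δ s t
  mul : ∀ s t u, 𝒜.Rel s t → 𝒜.Rel t u → δ s t * δ t u = δ s u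
  continuousOn : ∀ (i j : ι) (γ : OpenPartialHomeomorph (T i) (T j)), 𝒜.IsHolonomy γ →
    ContinuousOn (fun y => δ ⟨i, y⟩ ⟨j, γ y⟩) γ.source

/-- A (not necessarily compatible) family of `1`-forms along the plaques of the charts. -/
abbrev LocalForms (_𝒜 : FoliatedAtlas M d r T) : Type _ :=
  ∀ i, Model d × T i → (Model d →L[ℝ] ℝ)

/-- The function `c_{ki} = log δ(y, γ_{ki}(y))` on `U i ∩ U k`, where `y` is the `T k`-coordinate. -/
def logCocycle (𝒜 : FoliatedAtlas M d r T) (δ : (Σ i, T i) → (Σ i, T i) → ℝ) (k i : ι) (p : M) :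
    ℝ :=
  Real.log (δ ⟨k, (𝒜.chart k p).2⟩ ⟨i, (𝒜.chart i p).2⟩)

/-- The modular form `η` of the cocycle `δ`, constructed with the partition of unity `ρ`: on `U i`
it is `∑ k, c_{ki} d_ℱ ρ_k` (where `c_{ki}` is not defined, `d_ℱ ρ_k` vanishes). -/
def modularForm [Fintype ι] (𝒜 : FoliatedAtlas M d r T) (ρ : PartitionOfUnity ι M)
    (δ : (Σ i, T i) → (Σ i, T i) → ℝ) : 𝒜.LocalForms :=
  fun i z => ∑ k, 𝒜.logCocycle δ k i ((𝒜.chart i).symm z) •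
    fderiv ℝ (fun x => ρ k ((𝒜.chart i).symm (x, z.2))) z.1

/-- `h` is positive on `S`, and `log h` is a primitive of `η` along the leaves there
(`S` is meant to be open in the leaf topology). -/
def IsPrimitiveOn (𝒜 : FoliatedAtlas M d r T) (η : 𝒜.LocalForms) (h : M → ℝ) (S : Set M) : Prop :=
  (∀ p ∈ S, 0 < h p) ∧
    ∀ s : Σ i, T i, ∀ x ∈ 𝒜.disc s.1, 𝒜.plaqueMap s x ∈ S →
      HasFDerivAt (fun x' => Real.log (h (𝒜.plaqueMap s x'))) (η s.1 (x, s.2)) x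

end FoliatedAtlas

/-! ### Leafwise Riemannian metrics -/

/-- A leafwise Riemannian metric, given in the charts by its symmetric positive definite bilinear
forms, tangentially of class `C^{r-1}` (the class that is invariant under `C^r` changes of
charts). -/
structure LeafwiseMetric {M : Type*} [TopologicalSpace M] {d : ℕ} {r : ℕ∞} {ι : Type*}
    {T : ι → Type*} [∀ i, TopologicalSpace (T i)] (𝒜 : FoliatedAtlas M d r T) where
  form : ∀ i, Model d × T i → (Model d →L[ℝ] Model d →L[ℝ] ℝ)
  symm : ∀ i, ∀ z ∈ (𝒜.chart i).target, ∀ v w, form i z v w = form i z w v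
  pos : ∀ i, ∀ z ∈ (𝒜.chart i).target, ∀ v, v ≠ 0 → 0 < form i z v v
  smooth : ∀ i, TangentiallyContDiffOn (r - 1) (form i) (𝒜.chart i).target
  compat : ∀ i j, ∀ p ∈ (𝒜.chart i).source ∩ (𝒜.chart j).source, ∀ v w,
    form j (𝒜.chart j p)
      (fderiv ℝ (fun x => (𝒜.chart j ((𝒜.chart i).symm (x, (𝒜.chart i p).2))).1)
        (𝒜.chart i p).1 v)
      (fderiv ℝ (fun x => (𝒜.chart j ((𝒜.chart i).symm (x, (𝒜.chart i p).2))).1)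
        (𝒜.chart i p).1 w) = form i (𝒜.chart i p) v w

/-- The diameter of a set for a `[0, ∞]`-valued distance function. -/
def ediamOf {X : Type*} (e : X → X → ℝ≥0∞) (S : Set X) : ℝ≥0∞ := ⨆ x ∈ S, ⨆ y ∈ S, e x y

/-- The `s`-dimensional Hausdorff outer measure of a distance function `e`: the supremum over
`ε > 0` of the infimum of `∑ (diam S_n)^s` over the countable covers by sets `S_n` of diameter at
most `ε` (empty sets counting for `0`). -/
def hausdorffOuter {X : Type*} (e : X → X → ℝ≥0∞) (s : ℝ) : OuterMeasure X :=
  ⨆ (ε : ℝ≥0∞) (_ : 0 < ε),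
    OuterMeasure.boundedBy fun S => ⨅ _ : ediamOf e S ≤ ε, ediamOf e S ^ s

namespace LeafwiseMetric

variable {M : Type*} [TopologicalSpace M] {d : ℕ} {r : ℕ∞} {ι : Type*} {T : ι → Type*}
  [∀ i, TopologicalSpace (T i)] {𝒜 : FoliatedAtlas M d r T}

/-- The Gram matrix of the metric in the coordinates of the chart `i`. -/
def gram (g : LeafwiseMetric 𝒜) (i : ι) (z : Model d × T i) : Matrix (Fin d) (Fin d) ℝ :=
  Matrix.of fun a b => g.form i z (stdVec a) (stdVec b)

/-- The density of the Riemannian volume in the coordinates of the chart `i`. -/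
def volDensity (g : LeafwiseMetric 𝒜) (i : ι) (z : Model d × T i) : ℝ :=
  Real.sqrt (g.gram i z).det

/-- The Riemannian volume of the leaf through `t`, as a measure on `M` carried by that leaf. It is
glued from the volumes of the plaques of this leaf by means of the partition of unity `ρ`, on which
it does not depend. -/
def leafVolume [MeasurableSpace M] (g : LeafwiseMetric 𝒜) (ρ : PartitionOfUnity ι M)
    (t : Σ i, T i) : Measure M :=
  Measure.sum fun s : {s : Σ i, T i // 𝒜.Rel t s} =>
    ((volume.restrict (𝒜.disc s.1.1)).withDensity fun x =>
      ENNReal.ofReal (ρ s.1.1 (𝒜.plaqueMap s.1 x) * g.volDensity s.1.1 (x, s.1.2))).map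
      (𝒜.plaqueMap s.1)

/-- The Riemannian length of the `C^1` path `c : [0, 1] → ℝ^d` in the plaque through `s`. -/
def pathLength (g : LeafwiseMetric 𝒜) (s : Σ i, T i) (c : ℝ → Model d) : ℝ≥0∞ :=
  ∫⁻ u in Icc (0 : ℝ) 1, ENNReal.ofReal (Real.sqrt (g.form s.1 (c u, s.2) (deriv c u) (deriv c u)))

/-- The infimum of the lengths of the `C^1` paths from `p` to `q` that stay in some plaque. -/
def plaqueEDist (g : LeafwiseMetric 𝒜) (p q : M) : ℝ≥0∞ :=
  ⨅ (s : Σ i, T i) (c : ℝ → Model d) (_ : ContDiff ℝ 1 c ∧ (∀ u ∈ Icc (0 : ℝ) 1, c u ∈ 𝒜.disc s.1) ∧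
    𝒜.plaqueMap s (c 0) = p ∧ 𝒜.plaqueMap s (c 1) = q), g.pathLength s c

/-- The Riemannian distance along the leaves: the infimum of the lengths of the piecewise `C^1`
leafwise paths from `p` to `q`, each cut into finitely many pieces that stay in a plaque. It is `∞`
if `p` and `q` lie in different leaves. -/
def leafEDist (g : LeafwiseMetric 𝒜) (p q : M) : ℝ≥0∞ :=
  ⨅ (n : ℕ) (z : ℕ → M) (_ : z 0 = p ∧ z n = q),
    ∑ k ∈ Finset.range n, g.plaqueEDist (z k) (z (k + 1))

/-- `∫_S w` with respect to the Riemannian `(d-1)`-volume along the leaves, which is the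
`(d-1)`-dimensional Hausdorff measure of the leafwise distance, with the usual normalization
by the volume of the Euclidean ball of diameter one. -/
def areaIntegral (g : LeafwiseMetric 𝒜) (S : Set M) (w : M → ℝ≥0∞) : ℝ≥0∞ :=
  volume (Metric.ball (0 : EuclideanSpace ℝ (Fin (d - 1))) (1 / 2)) *
    @lintegral M (hausdorffOuter g.leafEDist ((d - 1 : ℕ) : ℝ)).caratheodory
      (@OuterMeasure.toMeasure M (hausdorffOuter g.leafEDist ((d - 1 : ℕ) : ℝ)).caratheodory
        (hausdorffOuter g.leafEDist ((d - 1 : ℕ) : ℝ)) le_rfl) (S.indicator w)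

/-- The Laplace operator of the metric on the plaque through `s`, in coordinates:
`(det G)^{-1/2} ∑_{a,b} ∂_a ((det G)^{1/2} G^{ab} ∂_b u)`. -/
def plaqueLaplacian (g : LeafwiseMetric 𝒜) (s : Σ i, T i) (u : Model d → ℝ) (x : Model d) : ℝ :=
  (g.volDensity s.1 (x, s.2))⁻¹ * ∑ a, fderiv ℝ (fun x' => g.volDensity s.1 (x', s.2) *
    ∑ b, (g.gram s.1 (x', s.2))⁻¹ a b * fderiv ℝ u x' (stdVec b)) x (stdVec a)

/-- The Laplace operator `Δ_ℱ f` along the leaves, at `p` computed in some chart around `p`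
(it does not depend on the chart). -/
def laplacian (g : LeafwiseMetric 𝒜) (f : M → ℝ) (p : M) : ℝ :=
  let i := (𝒜.cover p).choose
  g.plaqueLaplacian ⟨i, (𝒜.chart i p).2⟩ (fun x => f (𝒜.plaqueMap ⟨i, (𝒜.chart i p).2⟩ x))
    (𝒜.chart i p).1

/-! ### Averaging sequences -/

/-- The normalized density `h / h(y)` on the leaf through `y`, as a weight. -/
def weight (𝒜 : FoliatedAtlas M d r T) (h : M → ℝ) (y : Σ i, T i) (p : M) : ℝ≥0∞ :=
  ENNReal.ofReal (h p / h (𝒜.base y))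

/-- The modified volume `vol_η(V)`, for a subset `V` of the leaf through `y`. -/
def modifiedVolume [MeasurableSpace M] (g : LeafwiseMetric 𝒜) (ρ : PartitionOfUnity ι M)
    (h : M → ℝ) (y : Σ i, T i) (V : Set M) : ℝ≥0∞ :=
  ∫⁻ p in V, weight 𝒜 h y p ∂(g.leafVolume ρ y)

/-- The modified area `area_η(S)`, for a subset `S` of the leaf through `y`. -/
def modifiedArea (g : LeafwiseMetric 𝒜) (h : M → ℝ) (y : Σ i, T i) (S : Set M) : ℝ≥0∞ :=
  g.areaIntegral S (weight 𝒜 h y)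

/-- `V n`, a compact domain in the leaf without holonomy through `y n`, is an `η`-averaging
sequence; `log h` is a primitive of `η` along these leaves. -/
structure IsAveragingSequence [MeasurableSpace M] (g : LeafwiseMetric 𝒜)
    (ρ : PartitionOfUnity ι M) (η : 𝒜.LocalForms) (h : M → ℝ) (y : ℕ → Σ i, T i)
    (V : ℕ → Set M) : Prop where
  noHolonomy : ∀ n, 𝒜.NoHolonomy (y n)
  primitive : ∀ n, 𝒜.IsPrimitiveOn η h (𝒜.leaf (y n))
  domain : ∀ n, 𝒜.IsCompactDomain (y n) (V n)
  tendsto : Tendsto (fun n => g.modifiedArea h (y n) (𝒜.leafBoundary (V n)) /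
    g.modifiedVolume ρ h (y n) (V n)) atTop (𝓝 0)

/-- The plaques of the foliated atlas `ℬ` have bounded modified volume: the integrals over them of
`H` are bounded, where `log H` is a primitive of `η` on the plaque and `H = 1` at its centre. -/
def HasBoundedPlaques [MeasurableSpace M] (g : LeafwiseMetric 𝒜) (ρ : PartitionOfUnity ι M)
    (η : 𝒜.LocalForms) {ι' : Type*} {T' : ι' → Type*} [∀ i, TopologicalSpace (T' i)]
    (ℬ : FoliatedAtlas M d r T') : Prop :=
  ∃ C : ℝ, ∀ (s : Σ i, T' i) (t : Σ i, T i), ℬ.base s ∈ 𝒜.leaf t →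
    ∀ H : M → ℝ, 𝒜.IsPrimitiveOn η H (ℬ.plaque s) → H (ℬ.base s) = 1 →
      ∫⁻ p in ℬ.plaque s, ENNReal.ofReal (H p) ∂(g.leafVolume ρ t) ≤ ENNReal.ofReal C

/-- The probability measure `f ↦ vol_η(V)⁻¹ ∫_V f (h / h(y)) dvol`. -/
def averagingMeasure [MeasurableSpace M] (g : LeafwiseMetric 𝒜) (ρ : PartitionOfUnity ι M)
    (h : M → ℝ) (y : Σ i, T i) (V : Set M) : Measure M :=
  (g.modifiedVolume ρ h y V)⁻¹ • ((g.leafVolume ρ y).restrict V).withDensity (weight 𝒜 h y)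

/-- `μ` is a probability measure which is the weak limit of a subsequence of the averaging measures
of the sequence `V n`. -/
def IsAveragingLimit [MeasurableSpace M] (g : LeafwiseMetric 𝒜) (ρ : PartitionOfUnity ι M)
    (h : M → ℝ) (y : ℕ → Σ i, T i) (V : ℕ → Set M) (μ : Measure M) : Prop :=
  IsProbabilityMeasure μ ∧ ∃ φ : ℕ → ℕ, StrictMono φ ∧ ∀ f : C(M, ℝ),
    Tendsto (fun n => ∫ p, f p ∂(g.averagingMeasure ρ h (y (φ n)) (V (φ n)))) atTop
      (𝓝 (∫ p, f p ∂μ))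

/-! ### Tangentially smooth and harmonic measures -/

section Measures

variable [MeasurableSpace M] [∀ i, MeasurableSpace (T i)]

/-- On the chart `i`, the measure `μ` disintegrates as `∫ λ^y dν(y)`, where `λ^y` is the measure
with density `k(·, y)` with respect to the Riemannian volume on the plaque through `y`. -/
structure IsLocalDecomposition (g : LeafwiseMetric 𝒜) (μ : Measure M) (i : ι) (ν : Measure (T i))
    (k : Model d × T i → ℝ) : Prop where
  locallyFinite : IsLocallyFiniteMeasure ν
  measurable : Measurable k
  nonneg : ∀ z, 0 ≤ k z
  apply_eq : ∀ B : Set M, MeasurableSet B → B ⊆ (𝒜.chart i).source →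
    μ B = ∫⁻ y, (∫⁻ x in 𝒜.disc i ∩ 𝒜.plaqueMap ⟨i, y⟩ ⁻¹' B,
      ENNReal.ofReal (k (x, y) * g.volDensity i (x, y)) ∂volume) ∂ν

/-- `μ` is tangentially smooth: on each chart, the conditional measures on almost all plaques have
densities of class `C^{r-1}` with respect to the Riemannian volume. -/
def IsTangentiallySmooth (g : LeafwiseMetric 𝒜) (μ : Measure M) : Prop :=
  ∀ i, ∃ (ν : Measure (T i)) (k : Model d × T i → ℝ), g.IsLocalDecomposition μ i ν k ∧
    ∀ᵐ y ∂ν, ContDiffOn ℝ (r - 1 : ℕ∞) (fun x => k (x, y)) (𝒜.disc i)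

/-- The tangentially smooth measure `μ` has the modular form `η`: its local densities `k`, of class
`C^{r-1}` on the plaques, are positive and satisfy `d_ℱ log k = η` on almost all plaques. -/
def HasModularForm (g : LeafwiseMetric 𝒜) (μ : Measure M) (η : 𝒜.LocalForms) : Prop :=
  ∀ i, ∃ (ν : Measure (T i)) (k : Model d × T i → ℝ), g.IsLocalDecomposition μ i ν k ∧
    ∀ᵐ y ∂ν, ContDiffOn ℝ (r - 1 : ℕ∞) (fun x => k (x, y)) (𝒜.disc i) ∧
      ∀ x ∈ 𝒜.disc i, 0 < k (x, y) ∧ HasFDerivAt (fun x' => Real.log (k (x', y))) (η i (x, y)) x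

end Measures

/-- `μ` is a harmonic measure: `∫ Δ_ℱ f dμ = 0` for every continuous, tangentially `C^{r-1}`
function `f` on `M`. -/
def IsHarmonicMeasure [MeasurableSpace M] (g : LeafwiseMetric 𝒜) (μ : Measure M) : Prop :=
  ∀ f : M → ℝ, 𝒜.TangentiallyContDiff (r - 1) f → ∫ p, g.laplacian f p ∂μ = 0

/-- The limit set of a sequence of subsets of `M`. -/
def limitSet (V : ℕ → Set M) : Set M :=
  {p | ∃ (φ : ℕ → ℕ) (q : ℕ → M), StrictMono φ ∧ (∀ k, q k ∈ V (φ k)) ∧ Tendsto q atTop (𝓝 p)}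

end LeafwiseMetric

end Lamination

end

open Set Filter Topology MeasureTheory
open scoped ENNReal NNReal

noncomputable section

namespace Lamination

namespace FoliatedAtlas

variable {M : Type*} [TopologicalSpace M] {d : ℕ} {r : ℕ∞} {ι : Type*} {T : ι → Type*}
  [∀ i, TopologicalSpace (T i)]

/-! ### Plaques, leaves and the orbit relation of the holonomy pseudogroup -/

section Basic

variable (𝒜 : FoliatedAtlas M d r T)

/-! Weak limits exist because `M` is compact and metrizable and the averaging measures are
probability measures, the modified volume of a compact domain being positive and finite. A tent
function around a point that the domains eventually avoid has integral zero in the limit, so the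
support of a limit lies in the limit set.

The structure of a limit μ comes from one exchange. In the chart `i`, H(x, y) = exp ∑ₖ log
δ(γ_{ik}(y), y) ρₖ (`primitive`) is an explicit positive function with d log H = η on every plaque,
and on each plaque of a leaf `h` is a constant multiple of it. Hence the weighted volume in the
chart is a weighted sum, over the plaques of the leaf, of integrals of D = H · (Riemannian density)
over the trace A of V. Take f ≥ 0 supported in the chart over Q × K, with Q a closed ball and K
compact. Put I_f(y) = ∫ f D dx, and replace f by its spread κ(x) I_f(y) / D(x, y), where κ is a
fixed function supported in Q. If Q is contained in A or disjoint from it, the integral of the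
spread over the plaque is (∫κ) times that of f. If A cuts Q, the two differ by at most a constant
times vol(Q ∩ A) vol(Q \ A), which a relative isoperimetric inequality
(`exists_volume_mul_volume_le`) bounds by the Hausdorff measure of the part of ∂V in the plaque.
Summed over the plaques, the error is at most a constant times area_η(∂V) (`exists_comparison`),
negligible against vol_η(V). In the limit ∫ spread dμ = (∫κ) ∫ f dμ (`lintegral_spread`). The left
side depends on f through I_f only, so in the chart μ has density H along the plaques, and its
transverse measure is the image of (κ/D) μ / ∫κ. This gives tangential smoothness and the modular
form.

The isoperimetric inequality needs no regularity of ∂V. The product vol(A) vol(B) is the integral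
over v of the volume of the points x of A with x + v in B. The segment from such an x to x + v
crosses ∂V, so x lies in a tube swept by ∂V. A tube over a set of diameter ε has volume O(ε^{d-1}),
so the volume of tubes is dominated by the (d-1)-dimensional Hausdorff measure
(`exists_volume_tube_le`). Cut-off coordinate functions, which are Lipschitz for the leafwise
distance, relate that distance to the Euclidean one.

For harmonicity, the same exchange shows that functions with equal plaque integrals have equal
μ-integrals. By Green's formula Δ(ρᵢ f) and ρᵢ f ΔH / H have equal plaque integrals. The second
function vanishes on the limit set, since ΔH is continuous and vanishes at the points of the V n in
the chart. Summing over i gives ∫ Δf dμ = 0. -/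

lemma isOpen_disc (i : ι) : IsOpen (𝒜.disc i) := Metric.isOpen_ball

lemma convex_disc (i : ι) : Convex ℝ (𝒜.disc i) := convex_ball 0 _

lemma zero_mem_disc (i : ι) : (0 : Model d) ∈ 𝒜.disc i :=
  Metric.mem_ball_self (𝒜.radius_pos i)

lemma mem_target {i : ι} {z : Model d × T i} : z ∈ (𝒜.chart i).target ↔ z.1 ∈ 𝒜.disc i := by
  simp [𝒜.target_eq, disc]

lemma plaqueMap_mem_source {s : Σ i, T i} {x : Model d} (hx : x ∈ 𝒜.disc s.1) :
    𝒜.plaqueMap s x ∈ (𝒜.chart s.1).source :=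
  (𝒜.chart s.1).map_target (𝒜.mem_target.2 hx)

lemma chart_plaqueMap {s : Σ i, T i} {x : Model d} (hx : x ∈ 𝒜.disc s.1) :
    𝒜.chart s.1 (𝒜.plaqueMap s x) = (x, s.2) :=
  (𝒜.chart s.1).right_inv (𝒜.mem_target.2 hx)

lemma chart_fst_mem_disc {i : ι} {p : M} (hp : p ∈ (𝒜.chart i).source) :
    (𝒜.chart i p).1 ∈ 𝒜.disc i :=
  𝒜.mem_target.1 ((𝒜.chart i).map_source hp)

lemma plaqueMap_chart {i : ι} {p : M} (hp : p ∈ (𝒜.chart i).source) :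
    𝒜.plaqueMap ⟨i, (𝒜.chart i p).2⟩ (𝒜.chart i p).1 = p :=
  (𝒜.chart i).left_inv hp

lemma continuousOn_plaqueMap (s : Σ i, T i) : ContinuousOn (𝒜.plaqueMap s) (𝒜.disc s.1) :=
  (𝒜.chart s.1).continuousOn_symm.comp (f := fun x : Model d => (x, s.2)) (by fun_prop)
    fun _ hx => 𝒜.mem_target.2 hx

lemma hol_mem_source {i j : ι} {p : M} (hi : p ∈ (𝒜.chart i).source)
    (hj : p ∈ (𝒜.chart j).source) : (𝒜.chart i p).2 ∈ (𝒜.hol i j).source := by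
  rw [𝒜.hol_source]; exact ⟨p, ⟨hi, hj⟩, rfl⟩

/-- A plaque meets at most one plaque of another chart. -/
lemma snd_eq_of_snd_eq {i j : ι} {p q : M} (hpi : p ∈ (𝒜.chart i).source)
    (hpj : p ∈ (𝒜.chart j).source) (hqi : q ∈ (𝒜.chart i).source)
    (hqj : q ∈ (𝒜.chart j).source) (h : (𝒜.chart i p).2 = (𝒜.chart i q).2) :
    (𝒜.chart j p).2 = (𝒜.chart j q).2 := by
  rw [← 𝒜.hol_apply i j p hpi hpj, ← 𝒜.hol_apply i j q hqi hqj, h]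

/-- The points of the total transversal represent two intersecting plaques. -/
def Meets (s t : Σ i, T i) : Prop :=
  ∃ p, p ∈ (𝒜.chart s.1).source ∧ p ∈ (𝒜.chart t.1).source ∧
    (𝒜.chart s.1 p).2 = s.2 ∧ (𝒜.chart t.1 p).2 = t.2

lemma Meets.symm {𝒜 : FoliatedAtlas M d r T} {s t : Σ i, T i} (h : 𝒜.Meets s t) :
    𝒜.Meets t s := by
  obtain ⟨p, h1, h2, h3, h4⟩ := h
  exact ⟨p, h2, h1, h4, h3⟩

lemma meets_iff {s t : Σ i, T i} : 𝒜.Meets s t ↔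
    s.2 ∈ (𝒜.hol s.1 t.1).source ∧ 𝒜.hol s.1 t.1 s.2 = t.2 := by
  constructor
  · rintro ⟨p, h1, h2, h3, h4⟩
    rw [← h3, ← h4]
    exact ⟨𝒜.hol_mem_source h1 h2, 𝒜.hol_apply _ _ _ h1 h2⟩
  · rintro ⟨h1, h2⟩
    rw [𝒜.hol_source] at h1
    obtain ⟨p, ⟨hp1, hp2⟩, hp⟩ := h1
    refine ⟨p, hp1, hp2, hp, ?_⟩
    rw [← h2, ← hp, 𝒜.hol_apply _ _ _ hp1 hp2]

variable {𝒜} in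
lemma IsHolonomy.reflTransGen {i j : ι} {γ : OpenPartialHomeomorph (T i) (T j)}
    (hγ : 𝒜.IsHolonomy γ) : ∀ y ∈ γ.source,
      Relation.ReflTransGen 𝒜.Meets ⟨i, y⟩ ⟨j, γ y⟩ := by
  induction hγ with
  | refl => exact fun y _ => Relation.ReflTransGen.refl
  | step k γ hγ ih =>
    intro y hy
    rw [OpenPartialHomeomorph.trans_source] at hy
    exact (ih y hy.1).tail ((𝒜.meets_iff).2 ⟨hy.2, rfl⟩)

/-- Replaces composites of holonomy maps by chains of successively intersecting plaques; the
relation between such plaques is visibly symmetric and suits induction. -/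
lemma rel_iff_reflTransGen {s t : Σ i, T i} :
    𝒜.Rel s t ↔ Relation.ReflTransGen 𝒜.Meets s t := by
  constructor
  · rintro ⟨γ, hγ, hs, ht⟩
    have := hγ.reflTransGen s.2 hs
    rwa [ht] at this
  · intro h
    induction h with
    | refl => exact ⟨OpenPartialHomeomorph.refl _, IsHolonomy.refl _, trivial, rfl⟩
    | @tail b c _ hm ih =>
      obtain ⟨γ, hγ, hs, ht⟩ := ih
      obtain ⟨h1, h2⟩ := (𝒜.meets_iff).1 hm
      refine ⟨γ.trans (𝒜.hol b.1 c.1), IsHolonomy.step _ _ hγ, ?_, ?_⟩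
      · rw [OpenPartialHomeomorph.trans_source]
        exact ⟨hs, by rw [mem_preimage, ht]; exact h1⟩
      · rw [OpenPartialHomeomorph.coe_trans, Function.comp_apply, ht, h2]

lemma Rel.refl (s : Σ i, T i) : 𝒜.Rel s s :=
  (𝒜.rel_iff_reflTransGen).2 Relation.ReflTransGen.refl

variable {𝒜} in
lemma Rel.trans {s t u : Σ i, T i} (h : 𝒜.Rel s t) (h' : 𝒜.Rel t u) : 𝒜.Rel s u :=
  (𝒜.rel_iff_reflTransGen).2
    (((𝒜.rel_iff_reflTransGen).1 h).trans ((𝒜.rel_iff_reflTransGen).1 h'))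

variable {𝒜} in
lemma Meets.rel {s t : Σ i, T i} (h : 𝒜.Meets s t) : 𝒜.Rel s t :=
  (𝒜.rel_iff_reflTransGen).2 (Relation.ReflTransGen.single h)

lemma rel_of_mem {i j : ι} {p : M} (hi : p ∈ (𝒜.chart i).source)
    (hj : p ∈ (𝒜.chart j).source) :
    𝒜.Rel ⟨i, (𝒜.chart i p).2⟩ ⟨j, (𝒜.chart j p).2⟩ :=
  Meets.rel ⟨p, hi, hj, rfl, rfl⟩

variable {𝒜} in
lemma rel_of_mem_leaf {t : Σ i, T i} {p : M} (hp : p ∈ 𝒜.leaf t) {i : ι}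
    (hi : p ∈ (𝒜.chart i).source) : 𝒜.Rel t ⟨i, (𝒜.chart i p).2⟩ := by
  obtain ⟨j, hj, h⟩ := hp
  exact h.trans (𝒜.rel_of_mem hj hi)

lemma plaqueMap_mem_leaf {s t : Σ i, T i} (h : 𝒜.Rel t s) {x : Model d}
    (hx : x ∈ 𝒜.disc s.1) : 𝒜.plaqueMap s x ∈ 𝒜.leaf t := by
  refine ⟨s.1, 𝒜.plaqueMap_mem_source hx, ?_⟩
  rw [𝒜.chart_plaqueMap hx]
  exact h

lemma base_mem_leaf (t : Σ i, T i) : 𝒜.base t ∈ 𝒜.leaf t :=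
  𝒜.plaqueMap_mem_leaf (Rel.refl 𝒜 t) (𝒜.zero_mem_disc _)

/-- A plaque meets at most one plaque of each chart, so the plaques reached by chains of a given
length form a countable set. -/
lemma countable_setOf_rel [Countable ι] (t : Σ i, T i) : {s | 𝒜.Rel t s}.Countable := by
  let S : ℕ → Set (Σ i, T i) := fun n => Nat.rec {t}
    (fun _ A => ⋃ s ∈ A, range fun k => (⟨k, 𝒜.hol s.1 k s.2⟩ : Σ i, T i)) n
  have hS : ∀ n, (S n).Countable := by
    intro n
    induction n with
    | zero => exact countable_singleton t
    | succ n ih => exact ih.biUnion fun s _ => countable_range _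
  refine (countable_iUnion hS).mono ?_
  intro s hs
  have hs := (𝒜.rel_iff_reflTransGen).1 hs
  induction hs with
  | refl => exact mem_iUnion.2 ⟨0, rfl⟩
  | @tail b c hb hm ih =>
    obtain ⟨n, hn⟩ := mem_iUnion.1 (ih ((𝒜.rel_iff_reflTransGen).2 hb))
    refine mem_iUnion.2 ⟨n + 1, mem_biUnion hn ⟨c.1, ?_⟩⟩
    exact Sigma.ext rfl (heq_of_eq ((𝒜.meets_iff).1 hm).2)

/-! ### The changes of charts along a plaque -/

/-- The part of the disc of the chart `i` that parametrizes the intersection of the plaque through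
`y` with the domain of the chart `j`. -/
def overlap (i j : ι) (y : T i) : Set (Model d) :=
  {x | x ∈ 𝒜.disc i ∧ 𝒜.plaqueMap ⟨i, y⟩ x ∈ (𝒜.chart j).source}

/-- The change of charts along the plaque through `y`. -/
def transition (i j : ι) (y : T i) (x : Model d) : Model d :=
  (𝒜.chart j (𝒜.plaqueMap ⟨i, y⟩ x)).1

lemma isOpen_overlap (i j : ι) (y : T i) : IsOpen (𝒜.overlap i j y) :=
  (𝒜.continuousOn_plaqueMap ⟨i, y⟩).isOpen_inter_preimage (𝒜.isOpen_disc i)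
    (𝒜.chart j).open_source

variable {i j : ι} {y : T i} {x : Model d}

lemma chart_snd_of_mem_overlap (hx : x ∈ 𝒜.overlap i j y) :
    (𝒜.chart j (𝒜.plaqueMap ⟨i, y⟩ x)).2 = 𝒜.hol i j y := by
  rw [← 𝒜.hol_apply i j _ (𝒜.plaqueMap_mem_source (s := ⟨i, y⟩) hx.1) hx.2,
    𝒜.chart_plaqueMap (s := ⟨i, y⟩) hx.1]

lemma mem_hol_source_of_mem_overlap (hx : x ∈ 𝒜.overlap i j y) : y ∈ (𝒜.hol i j).source := by
  have := 𝒜.hol_mem_source (𝒜.plaqueMap_mem_source (s := ⟨i, y⟩) hx.1) hx.2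
  rwa [𝒜.chart_plaqueMap (s := ⟨i, y⟩) hx.1] at this

lemma chart_plaqueMap_of_mem_overlap (hx : x ∈ 𝒜.overlap i j y) :
    𝒜.chart j (𝒜.plaqueMap ⟨i, y⟩ x) = (𝒜.transition i j y x, 𝒜.hol i j y) :=
  Prod.ext rfl (𝒜.chart_snd_of_mem_overlap hx)

lemma plaqueMap_transition (hx : x ∈ 𝒜.overlap i j y) :
    𝒜.plaqueMap ⟨j, 𝒜.hol i j y⟩ (𝒜.transition i j y x) = 𝒜.plaqueMap ⟨i, y⟩ x := by
  rw [plaqueMap, ← 𝒜.chart_plaqueMap_of_mem_overlap hx, (𝒜.chart j).left_inv hx.2]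

lemma hol_hol (h : y ∈ (𝒜.hol i j).source) : 𝒜.hol j i (𝒜.hol i j y) = y := by
  have := Meets.symm ((𝒜.meets_iff (s := ⟨i, y⟩) (t := ⟨j, 𝒜.hol i j y⟩)).2 ⟨h, rfl⟩)
  exact ((𝒜.meets_iff).1 this).2

lemma hol_mem_hol_source (h : y ∈ (𝒜.hol i j).source) :
    𝒜.hol i j y ∈ (𝒜.hol j i).source := by
  have := Meets.symm ((𝒜.meets_iff (s := ⟨i, y⟩) (t := ⟨j, 𝒜.hol i j y⟩)).2 ⟨h, rfl⟩)
  exact ((𝒜.meets_iff).1 this).1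

lemma transition_mem_overlap (hx : x ∈ 𝒜.overlap i j y) :
    𝒜.transition i j y x ∈ 𝒜.overlap j i (𝒜.hol i j y) :=
  ⟨𝒜.chart_fst_mem_disc hx.2, by
    rw [𝒜.plaqueMap_transition hx]; exact 𝒜.plaqueMap_mem_source (s := ⟨i, y⟩) hx.1⟩

lemma transition_transition (hx : x ∈ 𝒜.overlap i j y) :
    𝒜.transition j i (𝒜.hol i j y) (𝒜.transition i j y x) = x := by
  rw [transition, 𝒜.plaqueMap_transition hx, 𝒜.chart_plaqueMap (s := ⟨i, y⟩) hx.1]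

lemma injOn_transition (i j : ι) (y : T i) : InjOn (𝒜.transition i j y) (𝒜.overlap i j y) := by
  intro x hx x' hx' h
  rw [← 𝒜.transition_transition hx, h, 𝒜.transition_transition hx']

lemma image_transition (h : y ∈ (𝒜.hol i j).source) :
    𝒜.transition i j y '' 𝒜.overlap i j y = 𝒜.overlap j i (𝒜.hol i j y) := by
  apply Subset.antisymm
  · rintro _ ⟨x, hx, rfl⟩
    exact 𝒜.transition_mem_overlap hx
  · intro x hx
    have := 𝒜.transition_mem_overlap hx
    have h2 := 𝒜.transition_transition hx
    rw [𝒜.hol_hol h] at this h2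
    exact ⟨_, this, h2⟩

lemma continuousOn_transition (i j : ι) (y : T i) :
    ContinuousOn (𝒜.transition i j y) (𝒜.overlap i j y) :=
  continuous_fst.comp_continuousOn ((𝒜.chart j).continuousOn.comp
    ((𝒜.continuousOn_plaqueMap ⟨i, y⟩).mono fun _ h => h.1) fun _ h => h.2)

lemma contDiffOn_transition (i j : ι) (y : T i) :
    ContDiffOn ℝ r (𝒜.transition i j y) (𝒜.overlap i j y) := by
  refine ((𝒜.smooth i j).1 y).mono ?_
  rintro x hx
  exact ⟨𝒜.mem_target.2 hx.1, hx.2⟩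

lemma differentiableAt_transition (hr : 1 ≤ r) (hx : x ∈ 𝒜.overlap i j y) :
    DifferentiableAt ℝ (𝒜.transition i j y) x :=
  ((𝒜.contDiffOn_transition i j y).differentiableOn (by
    have : r ≠ 0 := by rintro rfl; simp at hr
    exact_mod_cast this)).differentiableAt ((𝒜.isOpen_overlap i j y).mem_nhds hx)

end Basic

/-! ### The leaf topology -/

section LeafTopology

variable (𝒜 : FoliatedAtlas M d r T)

lemma leafTopology_le : 𝒜.leafTopology ≤ ‹TopologicalSpace M› := by
  refine iSup_le fun s => ?_
  rw [← continuous_iff_coinduced_le]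
  exact continuousOn_iff_continuous_domRestrict.1 (𝒜.continuousOn_plaqueMap s)

lemma isOpen_leafTopology_iff {O : Set M} : IsOpen[𝒜.leafTopology] O ↔
    ∀ s : Σ i, T i, IsOpen {x | x ∈ 𝒜.disc s.1 ∧ 𝒜.plaqueMap s x ∈ O} := by
  rw [isOpen_iSup_iff]
  refine forall_congr' fun s => ?_
  rw [isOpen_coinduced]
  rw [(𝒜.isOpen_disc s.1).isOpenEmbedding_subtypeVal.isOpen_iff_image_isOpen]
  have : {x | x ∈ 𝒜.disc s.1 ∧ 𝒜.plaqueMap s x ∈ O} =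
      Subtype.val '' ((fun x : 𝒜.disc s.1 => 𝒜.plaqueMap s x) ⁻¹' O) := by
    ext x; simp [and_comm]
  rw [this]

lemma continuousOn_plaqueMap_leafTopology (s : Σ i, T i) :
    @ContinuousOn _ _ _ 𝒜.leafTopology (𝒜.plaqueMap s) (𝒜.disc s.1) := by
  rw [@continuousOn_iff_continuous_domRestrict _ _ _ 𝒜.leafTopology, continuous_iff_coinduced_le]
  exact le_iSup (fun s : Σ i, T i => TopologicalSpace.coinduced
    (fun x : 𝒜.disc s.1 => 𝒜.plaqueMap s x) inferInstance) s

/-- The trace on another plaque is either empty or the preimage of `O` under a continuous change of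
charts. Thus discs are open leaf neighbourhoods, although the leaf topology is defined as a supremum
of coinduced topologies. -/
lemma isOpen_leafTopology_image (s : Σ i, T i) {O : Set (Model d)} (hO : IsOpen O)
    (hOd : O ⊆ 𝒜.disc s.1) : IsOpen[𝒜.leafTopology] (𝒜.plaqueMap s '' O) := by
  rw [isOpen_leafTopology_iff]
  intro t
  by_cases hh : t.2 ∈ (𝒜.hol t.1 s.1).source ∧ 𝒜.hol t.1 s.1 t.2 = s.2
  · have : {x | x ∈ 𝒜.disc t.1 ∧ 𝒜.plaqueMap t x ∈ 𝒜.plaqueMap s '' O} =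
        𝒜.overlap t.1 s.1 t.2 ∩ 𝒜.transition t.1 s.1 t.2 ⁻¹' O := by
      ext x
      constructor
      · rintro ⟨hx, x', hx', he⟩
        have hxo : x ∈ 𝒜.overlap t.1 s.1 t.2 :=
          ⟨hx, by rw [← he]; exact 𝒜.plaqueMap_mem_source (hOd hx')⟩
        refine ⟨hxo, ?_⟩
        rw [mem_preimage, transition, ← he, 𝒜.chart_plaqueMap (hOd hx')]
        exact hx'
      · rintro ⟨hx, hx'⟩
        refine ⟨hx.1, _, hx', ?_⟩
        have := 𝒜.plaqueMap_transition hx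
        rw [hh.2] at this
        exact this
    rw [this]
    exact (𝒜.continuousOn_transition _ _ _).isOpen_inter_preimage (𝒜.isOpen_overlap _ _ _) hO
  · convert isOpen_empty using 1
    refine eq_empty_of_forall_notMem ?_
    rintro x ⟨hx, x', hx', he⟩
    apply hh
    rw [← 𝒜.meets_iff]
    refine ⟨𝒜.plaqueMap t x, 𝒜.plaqueMap_mem_source hx, ?_, ?_, ?_⟩
    · rw [← he]; exact 𝒜.plaqueMap_mem_source (hOd hx')
    · rw [𝒜.chart_plaqueMap hx]
    · rw [← he, 𝒜.chart_plaqueMap (hOd hx')]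

lemma isClosed_leafTopology_of_isClosed {A : Set M} (hA : IsClosed A) :
    IsClosed[𝒜.leafTopology] A :=
  hA.mono 𝒜.leafTopology_le

lemma isCompact_of_isCompact_leafTopology {A : Set M} (hA : @IsCompact M 𝒜.leafTopology A) :
    IsCompact A := by
  have : @Continuous M M 𝒜.leafTopology _ id := continuous_id_iff_le.2 𝒜.leafTopology_le
  have h := @IsCompact.image M M 𝒜.leafTopology _ A id hA this
  rwa [image_id] at h

end LeafTopology

/-! ### Second countability and metrizability of the ambient space -/

section Countability

lemma secondCountableTopology_transversal {X : Type*} [TopologicalSpace X]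
    [TopologicalSpace.SeparableSpace X] [TopologicalSpace.MetrizableSpace X] :
    SecondCountableTopology X := by
  let _ := TopologicalSpace.metrizableSpaceMetric X
  exact UniformSpace.secondCountable_of_separable X

variable [Countable ι]
  [∀ i, TopologicalSpace.SeparableSpace (T i)] [∀ i, TopologicalSpace.MetrizableSpace (T i)]

lemma secondCountableTopology (𝒜 : FoliatedAtlas M d r T) : SecondCountableTopology M := by
  have : ∀ i, SecondCountableTopology (𝒜.chart i).source := by
    intro i
    have := secondCountableTopology_transversal (X := T i)
    exact (𝒜.chart i).secondCountableTopology_source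
  exact TopologicalSpace.secondCountableTopology_of_countable_cover
    (fun i => (𝒜.chart i).open_source) (iUnion_eq_univ_iff.2 𝒜.cover)

lemma metrizableSpace (𝒜 : FoliatedAtlas M d r T) [CompactSpace M] [T2Space M] :
    TopologicalSpace.MetrizableSpace M := by
  have := 𝒜.secondCountableTopology
  exact TopologicalSpace.metrizableSpace_of_t3_secondCountable M

end Countability

end FoliatedAtlas

/-! ### Tangentially differentiable functions -/

section TangentiallyContDiffOn

variable {d : ℕ} {Y F : Type*} [TopologicalSpace Y] [NormedAddCommGroup F] [NormedSpace ℝ F]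
  {n : ℕ∞} {f : Model d × Y → F} {W : Set (Model d × Y)}

lemma isOpen_slice (hW : IsOpen W) (y : Y) : IsOpen {x | (x, y) ∈ W} :=
  hW.preimage (Continuous.prodMk_left y)

lemma TangentiallyContDiffOn.contDiffAt (hf : TangentiallyContDiffOn n f W) (hW : IsOpen W)
    {z : Model d × Y} (hz : z ∈ W) : ContDiffAt ℝ n (fun x => f (x, z.2)) z.1 :=
  (hf.1 z.2).contDiffAt ((isOpen_slice hW z.2).mem_nhds hz)

lemma TangentiallyContDiffOn.continuousOn (hf : TangentiallyContDiffOn n f W) :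
    ContinuousOn f W := by
  have h := hf.2 0 (by simp)
  have h2 := (continuousMultilinearCurryFin0 ℝ (Model d) F).continuous.comp_continuousOn h
  refine h2.congr fun z _ => ?_
  simp

lemma TangentiallyContDiffOn.sum {κ : Type*} [Fintype κ] {f : κ → Model d × Y → F}
    (hW : IsOpen W) (hf : ∀ k, TangentiallyContDiffOn n (f k) W) :
    TangentiallyContDiffOn n (fun z => ∑ k, f k z) W := by
  refine ⟨fun y => ContDiffOn.sum fun k _ => (hf k).1 y, fun m hm => ?_⟩
  have : ContinuousOn (fun z : Model d × Y =>
      ∑ k, iteratedFDeriv ℝ m (fun x => f k (x, z.2)) z.1) W :=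
    continuousOn_finsetSum _ fun k _ => (hf k).2 m hm
  refine this.congr fun z hz => ?_
  have h := iteratedFDeriv_sum_apply (𝕜 := ℝ) (n := m) (u := Finset.univ) (x := z.1)
    (f := fun k x => f k (x, z.2)) fun k _ =>
      ((hf k).contDiffAt hW hz).of_le (by exact_mod_cast hm)
  refine Eq.trans ?_ h
  congr 1
  ext x
  simp

/-- A transverse function may be multiplied to a tangentially smooth function, provided that it is
continuous at the points around which the latter does not vanish. -/
lemma TangentiallyContDiffOn.transverse_smul {c : Y → ℝ} (hW : IsOpen W)
    (hf : TangentiallyContDiffOn n f W)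
    (hc : ∀ z ∈ W, ContinuousAt c z.2 ∨ ∀ᶠ z' in 𝓝 z, f z' = 0) :
    TangentiallyContDiffOn n (fun z => c z.2 • f z) W := by
  refine ⟨fun y => (hf.1 y).const_smul (c y), fun m hm => ?_⟩
  have key : ContinuousOn (fun z : Model d × Y =>
      c z.2 • iteratedFDeriv ℝ m (fun x => f (x, z.2)) z.1) W := by
    intro z hz
    apply ContinuousAt.continuousWithinAt
    rcases hc z hz with h | h
    · exact (ContinuousAt.comp (f := Prod.snd) h continuousAt_snd).smul
        ((hf.2 m hm).continuousAt (hW.mem_nhds hz))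
    -- Near such a point all tangential derivatives of `f` vanish, so the product is zero there
    -- whatever the behaviour of `c`.
    · have hev : ∀ᶠ z' in 𝓝 z, c z'.2 • iteratedFDeriv ℝ m (fun x => f (x, z'.2)) z'.1 = 0 := by
        filter_upwards [h.eventually_nhds] with z' hz'
        have : (fun x => f (x, z'.2)) =ᶠ[𝓝 z'.1] fun _ => (0 : F) :=
          (Continuous.prodMk_left z'.2).continuousAt.eventually hz'
        rw [(this.iteratedFDeriv ℝ m).eq_of_nhds]
        simp
      exact (continuousAt_const
        (y := (0 : ContinuousMultilinearMap ℝ (fun _ : Fin m => Model d) F))).congr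
        (hev.mono fun _ h => h.symm)
  refine key.congr fun z hz => ?_
  exact iteratedFDeriv_const_smul_apply (𝕜 := ℝ) (a := c z.2) (f := fun x => f (x, z.2))
    (((hf.contDiffAt hW hz).of_le (by exact_mod_cast hm)))

end TangentiallyContDiffOn

namespace FoliatedAtlas

variable {M : Type*} [TopologicalSpace M] {d : ℕ} {r : ℕ∞} {ι : Type*} {T : ι → Type*}
  [∀ i, TopologicalSpace (T i)]

/-! ### Explicit primitives of the modular form -/

section Cocycle

variable {𝒜 : FoliatedAtlas M d r T} {ρ : PartitionOfUnity ι M}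
  {δ : (Σ i, T i) → (Σ i, T i) → ℝ}

lemma IsContinuousCocycle.self (hδ : 𝒜.IsContinuousCocycle δ) (s : Σ i, T i) : δ s s = 1 := by
  have h := hδ.mul s s s (Rel.refl 𝒜 s) (Rel.refl 𝒜 s)
  have h' := hδ.pos s s (Rel.refl 𝒜 s)
  nlinarith [mul_eq_left₀ h'.ne' |>.1 h]

/-- Continuity is assumed with the arguments of δ in the other order; they are exchanged by δ(a, b)
δ(b, a) = δ(a, a) = 1. -/
lemma IsContinuousCocycle.continuousAt_log_hol (hδ : 𝒜.IsContinuousCocycle δ) {i k : ι} {y : T i}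
    (hy : y ∈ (𝒜.hol i k).source) :
    ContinuousAt (fun y => Real.log (δ ⟨k, 𝒜.hol i k y⟩ ⟨i, y⟩)) y := by
  have hmeet : ∀ y ∈ (𝒜.hol i k).source, 𝒜.Meets ⟨i, y⟩ ⟨k, 𝒜.hol i k y⟩ := fun y hy =>
    𝒜.meets_iff.2 ⟨hy, rfl⟩
  have hhol : 𝒜.IsHolonomy (𝒜.hol i k) := by
    have := IsHolonomy.step k _ (IsHolonomy.refl (𝒜 := 𝒜) i)
    rwa [OpenPartialHomeomorph.refl_trans] at this
  have hc := (hδ.continuousOn i k _ hhol).continuousAt ((𝒜.hol i k).open_source.mem_nhds hy)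
  have hpos := hδ.pos _ _ (hmeet y hy).rel
  have := (hc.log hpos.ne').fun_neg
  refine this.congr ?_
  filter_upwards [(𝒜.hol i k).open_source.mem_nhds hy] with y' hy'
  have h1 := hδ.mul _ _ _ (hmeet y' hy').rel (hmeet y' hy').symm.rel
  rw [hδ.self] at h1
  rw [eq_inv_of_mul_eq_one_right h1, Real.log_inv]

lemma eventually_partition_eq_zero (hρ : ρ.IsSubordinate fun i => (𝒜.chart i).source) {k : ι}
    {p : M} (hp : p ∉ (𝒜.chart k).source) : ∀ᶠ q in 𝓝 p, ρ k q = 0 := by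
  have h : p ∉ tsupport (ρ k) := fun h => hp (hρ k h)
  exact (notMem_tsupport_iff_eventuallyEq.1 h)

end Cocycle

variable [Fintype ι]

/-- An explicit primitive of the modular form along the plaques of the chart `i`. -/
def logPrimitive (𝒜 : FoliatedAtlas M d r T) (ρ : PartitionOfUnity ι M)
    (δ : (Σ i, T i) → (Σ i, T i) → ℝ) (i : ι) (z : Model d × T i) : ℝ :=
  ∑ k, Real.log (δ ⟨k, 𝒜.hol i k z.2⟩ ⟨i, z.2⟩) • ρ k ((𝒜.chart i).symm z)

/-- The positive function whose logarithm is `logPrimitive`. -/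
def primitive (𝒜 : FoliatedAtlas M d r T) (ρ : PartitionOfUnity ι M)
    (δ : (Σ i, T i) → (Σ i, T i) → ℝ) (i : ι) (z : Model d × T i) : ℝ :=
  Real.exp (𝒜.logPrimitive ρ δ i z)

variable {𝒜 : FoliatedAtlas M d r T} {ρ : PartitionOfUnity ι M}
  {δ : (Σ i, T i) → (Σ i, T i) → ℝ}

lemma primitive_pos (i : ι) (z : Model d × T i) : 0 < 𝒜.primitive ρ δ i z := Real.exp_pos _

/-- The coefficient of ρₖ depends on `y` only. It is continuous over the domain of the chart `k`,
and outside this domain ρₖ vanishes locally. -/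
lemma tangentiallyContDiffOn_logPrimitive (hδ : 𝒜.IsContinuousCocycle δ)
    (hρ : ρ.IsSubordinate fun i => (𝒜.chart i).source)
    (hρr : ∀ i, 𝒜.TangentiallyContDiff r (ρ i)) (i : ι) :
    TangentiallyContDiffOn r (𝒜.logPrimitive ρ δ i) (𝒜.chart i).target := by
  refine TangentiallyContDiffOn.sum (𝒜.chart i).open_target fun k => ?_
  refine TangentiallyContDiffOn.transverse_smul
    (c := fun y => Real.log (δ ⟨k, 𝒜.hol i k y⟩ ⟨i, y⟩)) (𝒜.chart i).open_target (hρr k i) ?_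
  intro z hz
  by_cases hp : (𝒜.chart i).symm z ∈ (𝒜.chart k).source
  · left
    have : z.1 ∈ 𝒜.overlap i k z.2 := ⟨𝒜.mem_target.1 hz, hp⟩
    exact hδ.continuousAt_log_hol (𝒜.mem_hol_source_of_mem_overlap this)
  · right
    exact ((𝒜.chart i).continuousAt_symm hz).eventually (eventually_partition_eq_zero hρ hp)

lemma continuousOn_primitive (hδ : 𝒜.IsContinuousCocycle δ)
    (hρ : ρ.IsSubordinate fun i => (𝒜.chart i).source)
    (hρr : ∀ i, 𝒜.TangentiallyContDiff r (ρ i)) (i : ι) :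
    ContinuousOn (𝒜.primitive ρ δ i) (𝒜.chart i).target :=
  Real.continuous_exp.comp_continuousOn
    (tangentiallyContDiffOn_logPrimitive hδ hρ hρr i).continuousOn

lemma contDiffOn_primitive (hρr : ∀ i, 𝒜.TangentiallyContDiff r (ρ i)) (i : ι) (y : T i) :
    ContDiffOn ℝ r (fun x => 𝒜.primitive ρ δ i (x, y)) (𝒜.disc i) := by
  refine ContDiffOn.exp (ContDiffOn.sum fun k _ =>
    ContDiffOn.const_smul (Real.log (δ ⟨k, 𝒜.hol i k y⟩ ⟨i, y⟩)) ?_)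
  exact ((hρr k i).1 y).mono fun x hx => 𝒜.mem_target.2 hx

/-- Along a plaque the coefficients log δ are constant, so only the functions ρₖ are differentiated,
which is the formula that defines η. -/
lemma hasFDerivAt_logPrimitive (hr : 1 ≤ r) (hρ : ρ.IsSubordinate fun i => (𝒜.chart i).source)
    (hρr : ∀ i, 𝒜.TangentiallyContDiff r (ρ i)) {i : ι} {y : T i} {x : Model d}
    (hx : x ∈ 𝒜.disc i) :
    HasFDerivAt (fun x' => 𝒜.logPrimitive ρ δ i (x', y)) (𝒜.modularForm ρ δ i (x, y)) x := by
  refine HasFDerivAt.fun_sum fun k _ => ?_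
  have hd : DifferentiableAt ℝ (fun x' => ρ k (𝒜.plaqueMap ⟨i, y⟩ x')) x := by
    have := (hρr k i).contDiffAt (𝒜.chart i).open_target (z := (x, y)) (𝒜.mem_target.2 hx)
    refine this.differentiableAt ?_
    have : r ≠ 0 := by rintro rfl; simp at hr
    exact_mod_cast this
  change HasFDerivAt (fun x' => Real.log (δ ⟨k, 𝒜.hol i k y⟩ ⟨i, y⟩) •
    ρ k (𝒜.plaqueMap ⟨i, y⟩ x')) (𝒜.logCocycle δ k i (𝒜.plaqueMap ⟨i, y⟩ x) •
      fderiv ℝ (fun x' => ρ k (𝒜.plaqueMap ⟨i, y⟩ x')) x) x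
  have h := hd.hasFDerivAt.const_smul (Real.log (δ ⟨k, 𝒜.hol i k y⟩ ⟨i, y⟩))
  by_cases hp : 𝒜.plaqueMap ⟨i, y⟩ x ∈ (𝒜.chart k).source
  · have hx' : x ∈ 𝒜.overlap i k y := ⟨hx, hp⟩
    have e : 𝒜.logCocycle δ k i (𝒜.plaqueMap ⟨i, y⟩ x) =
        Real.log (δ ⟨k, 𝒜.hol i k y⟩ ⟨i, y⟩) := by
      rw [logCocycle, 𝒜.chart_snd_of_mem_overlap hx', 𝒜.chart_plaqueMap (s := ⟨i, y⟩) hx]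
    rw [e]
    exact h
  · have h0 : (fun x' => ρ k (𝒜.plaqueMap ⟨i, y⟩ x')) =ᶠ[𝓝 x] fun _ => 0 :=
      ((𝒜.continuousOn_plaqueMap ⟨i, y⟩).continuousAt
        ((𝒜.isOpen_disc i).mem_nhds hx)).eventually (eventually_partition_eq_zero hρ hp)
    have h1 : fderiv ℝ (fun x' => ρ k (𝒜.plaqueMap ⟨i, y⟩ x')) x = 0 := by
      rw [h0.fderiv_eq]; simp
    rw [h1, smul_zero] at h ⊢
    exact h

/-- On a plaque of a leaf, each function whose logarithm is a primitive of the modular form is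
proportional to the explicit one. -/
lemma IsPrimitiveOn.eq_mul_primitive (hr : 1 ≤ r)
    (hρ : ρ.IsSubordinate fun i => (𝒜.chart i).source)
    (hρr : ∀ i, 𝒜.TangentiallyContDiff r (ρ i)) {h : M → ℝ} {t : Σ i, T i}
    (hh : 𝒜.IsPrimitiveOn (𝒜.modularForm ρ δ) h (𝒜.leaf t)) {s : Σ i, T i} (hs : 𝒜.Rel t s)
    {x : Model d} (hx : x ∈ 𝒜.disc s.1) :
    h (𝒜.plaqueMap s x) =
      h (𝒜.base s) / 𝒜.primitive ρ δ s.1 (0, s.2) * 𝒜.primitive ρ δ s.1 (x, s.2) := by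
  -- Both logarithms are primitives of η, so their difference is constant on the convex disc; it is
  -- evaluated at the centre.
  have hder : ∀ x ∈ 𝒜.disc s.1, HasFDerivAt
      (fun x' => Real.log (h (𝒜.plaqueMap s x')) - 𝒜.logPrimitive ρ δ s.1 (x', s.2))
      (0 : Model d →L[ℝ] ℝ) x := by
    intro x hx
    have h1 := hh.2 s x hx (𝒜.plaqueMap_mem_leaf hs hx)
    have h2 := hasFDerivAt_logPrimitive (δ := δ) hr hρ hρr (y := s.2) hx
    have h3 := HasFDerivAt.fun_sub h1 h2
    rwa [sub_self] at h3
  have hconst := (𝒜.convex_disc s.1).is_const_of_fderivWithin_eq_zero (𝕜 := ℝ)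
    (f := fun x' => Real.log (h (𝒜.plaqueMap s x')) - 𝒜.logPrimitive ρ δ s.1 (x', s.2))
    (fun x hx => (hder x hx).differentiableAt.differentiableWithinAt)
    (fun x hx => by
      rw [fderivWithin_of_isOpen (𝒜.isOpen_disc _) hx, (hder x hx).fderiv])
    hx (𝒜.zero_mem_disc s.1)
  have hp1 := hh.1 _ (𝒜.plaqueMap_mem_leaf hs hx)
  have hp2 := hh.1 _ (𝒜.plaqueMap_mem_leaf hs (𝒜.zero_mem_disc s.1))
  rw [base, ← Real.exp_log hp1, ← Real.exp_log hp2, primitive, primitive, ← Real.exp_sub,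
    ← Real.exp_add]
  congr 1
  linarith

end FoliatedAtlas

/-! ### Linear algebra of bilinear forms in coordinates -/

section Coordinates

variable {d : ℕ}

/-- The matrix of a linear endomorphism of the model space in the standard basis. -/
def modelMatrix (A : Model d →L[ℝ] Model d) : Matrix (Fin d) (Fin d) ℝ :=
  Matrix.of fun a b => A (stdVec b) a

lemma sum_smul_stdVec (v : Model d) : v = ∑ a, v a • stdVec a := by
  ext b
  simp [stdVec, Pi.single_apply]

lemma det_modelMatrix (A : Model d →L[ℝ] Model d) : (modelMatrix A).det = A.det := by
  rw [ContinuousLinearMap.det, ← LinearMap.det_toMatrix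
    (EuclideanSpace.basisFun (Fin d) ℝ).toBasis]
  congr 1

/-- The Gram matrix of a bilinear form in the standard basis. -/
def formMatrix (B : Model d →L[ℝ] Model d →L[ℝ] ℝ) : Matrix (Fin d) (Fin d) ℝ :=
  Matrix.of fun a b => B (stdVec a) (stdVec b)

lemma apply_eq_sum_formMatrix (B : Model d →L[ℝ] Model d →L[ℝ] ℝ) (v w : Model d) :
    B v w = ∑ a, ∑ b, v a * w b * formMatrix B a b := by
  conv_lhs => rw [sum_smul_stdVec v, sum_smul_stdVec w]
  simp only [map_sum, map_smul, sum_apply, smul_apply,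
    smul_eq_mul, Finset.mul_sum, formMatrix, Matrix.of_apply]
  rw [Finset.sum_comm]
  refine Finset.sum_congr rfl fun a _ => Finset.sum_congr rfl fun b _ => by ring

lemma formMatrix_posDef {B : Model d →L[ℝ] Model d →L[ℝ] ℝ} (hs : ∀ v w, B v w = B w v)
    (hp : ∀ v, v ≠ 0 → 0 < B v v) : (formMatrix B).PosDef := by
  refine Matrix.PosDef.of_dotProduct_mulVec_pos ?_ ?_
  · ext a b
    simp [formMatrix, hs (stdVec b)]
  · intro x hx
    have hx' : (WithLp.toLp 2 x : Model d) ≠ 0 := by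
      intro h
      apply hx
      funext a
      exact congrArg (fun v : Model d => v a) h
    have := hp _ hx'
    rw [apply_eq_sum_formMatrix] at this
    refine this.trans_eq ?_
    simp only [dotProduct, Matrix.mulVec, Finset.mul_sum, star_trivial]
    refine Finset.sum_congr rfl fun a _ => Finset.sum_congr rfl fun b _ => by ring

lemma formMatrix_pullback {B B' : Model d →L[ℝ] Model d →L[ℝ] ℝ} {A : Model d →L[ℝ] Model d}
    (h : ∀ v w, B' (A v) (A w) = B v w) :
    formMatrix B = (modelMatrix A).transpose * formMatrix B' * modelMatrix A := by
  ext a b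
  rw [formMatrix, Matrix.of_apply, ← h, apply_eq_sum_formMatrix]
  simp only [Matrix.mul_apply, Matrix.transpose_apply, modelMatrix, Matrix.of_apply,
    Finset.sum_mul]
  rw [Finset.sum_comm]
  refine Finset.sum_congr rfl fun c _ => Finset.sum_congr rfl fun e _ => by ring

end Coordinates

/-! ### Sums over subtypes and integrals over subsets -/

section Auxiliary

lemma tsum_pred {α : Type*} (P : α → Prop) (f : α → ℝ≥0∞) :
    ∑' s : {s // P s}, f s = ∑' s, {s | P s}.indicator f s :=
  tsum_subtype {s | P s} f

lemma tsum_subtype_sigma {ι : Type*} {T : ι → Type*} [Fintype ι] (P : (Σ i, T i) → Prop)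
    (f : (Σ i, T i) → ℝ≥0∞) :
    ∑' s : {s // P s}, f s = ∑ j, ∑' s' : {s' : T j // P ⟨j, s'⟩}, f ⟨j, s'⟩ := by
  rw [tsum_pred, ENNReal.tsum_sigma', tsum_fintype]
  refine Finset.sum_congr rfl fun j _ => ?_
  rw [tsum_pred (fun s' => P ⟨j, s'⟩) fun s' => f ⟨j, s'⟩]
  rfl

lemma tsum_pred_eq_tsum_inter {α : Type*} {P : α → Prop} {S : Set α} {f : α → ℝ≥0∞}
    (hf : ∀ s ∉ S, f s = 0) :
    ∑' s : {s // P s}, f s = ∑' s : {s // s ∈ {s | P s} ∩ S}, f s := by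
  rw [tsum_pred, tsum_pred]
  congr 1
  funext s
  by_cases hs : s ∈ S
  · by_cases hP : P s <;> simp [indicator, hs, hP]
  · simp [indicator, hf s hs]

lemma setLIntegral_eq_of_subset {α : Type*} [MeasurableSpace α] {μ : Measure α} {A B : Set α}
    (hA : MeasurableSet A) (hB : MeasurableSet B) (hAB : A ⊆ B) {f : α → ℝ≥0∞}
    (h : ∀ x ∈ B, x ∉ A → f x = 0) : ∫⁻ x in B, f x ∂μ = ∫⁻ x in A, f x ∂μ := by
  rw [← lintegral_indicator hB, ← lintegral_indicator hA]
  congr 1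
  funext x
  by_cases hx : x ∈ A
  · simp [hx, hAB hx]
  · by_cases hx' : x ∈ B
    · simp [hx, hx', h x hx' hx]
    · simp [hx, hx']

end Auxiliary

/-! ### The Riemannian volume of the leaves -/

namespace LeafwiseMetric

open FoliatedAtlas

variable {M : Type*} [TopologicalSpace M] {d : ℕ} {r : ℕ∞} {ι : Type*} {T : ι → Type*}
  [∀ i, TopologicalSpace (T i)] {𝒜 : FoliatedAtlas M d r T} (g : LeafwiseMetric 𝒜)

lemma gram_posDef {i : ι} {z : Model d × T i} (hz : z ∈ (𝒜.chart i).target) :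
    (g.gram i z).PosDef :=
  formMatrix_posDef (g.symm i z hz) (g.pos i z hz)

lemma gram_det_pos {i : ι} {z : Model d × T i} (hz : z ∈ (𝒜.chart i).target) :
    0 < (g.gram i z).det := (g.gram_posDef hz).det_pos

lemma volDensity_pos {i : ι} {z : Model d × T i} (hz : z ∈ (𝒜.chart i).target) :
    0 < g.volDensity i z := Real.sqrt_pos.2 (g.gram_det_pos hz)

lemma continuousOn_form (i : ι) : ContinuousOn (g.form i) (𝒜.chart i).target :=
  (g.smooth i).continuousOn

lemma continuous_det_formMatrix :
    Continuous fun B : Model d →L[ℝ] Model d →L[ℝ] ℝ => (formMatrix B).det := by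
  refine Continuous.matrix_det ?_
  refine continuous_matrix fun a b => ?_
  simp only [formMatrix, Matrix.of_apply]
  fun_prop

lemma continuousOn_volDensity (i : ι) : ContinuousOn (g.volDensity i) (𝒜.chart i).target :=
  Real.continuous_sqrt.comp_continuousOn
    (continuous_det_formMatrix.comp_continuousOn (g.continuousOn_form i))

lemma form_transition {i j : ι} {y : T i} {x : Model d} (hx : x ∈ 𝒜.overlap i j y)
    (v w : Model d) :
    g.form j (𝒜.transition i j y x, 𝒜.hol i j y) (fderiv ℝ (𝒜.transition i j y) x v)
      (fderiv ℝ (𝒜.transition i j y) x w) = g.form i (x, y) v w := by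
  have h := g.compat i j (𝒜.plaqueMap ⟨i, y⟩ x)
    ⟨𝒜.plaqueMap_mem_source (s := ⟨i, y⟩) hx.1, hx.2⟩ v w
  rw [𝒜.chart_plaqueMap_of_mem_overlap hx, 𝒜.chart_plaqueMap (s := ⟨i, y⟩) hx.1] at h
  exact h

lemma gram_transition {i j : ι} {y : T i} {x : Model d} (hx : x ∈ 𝒜.overlap i j y) :
    g.gram i (x, y) = (modelMatrix (fderiv ℝ (𝒜.transition i j y) x)).transpose *
      g.gram j (𝒜.transition i j y x, 𝒜.hol i j y) *
        modelMatrix (fderiv ℝ (𝒜.transition i j y) x) :=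
  formMatrix_pullback (g.form_transition hx)

/-- With A the Jacobian matrix, G = Aᵀ G' A gives det G = (det A)² det G'. -/
lemma volDensity_transition {i j : ι} {y : T i} {x : Model d} (hx : x ∈ 𝒜.overlap i j y) :
    g.volDensity i (x, y) = |(fderiv ℝ (𝒜.transition i j y) x).det| *
      g.volDensity j (𝒜.transition i j y x, 𝒜.hol i j y) := by
  rw [volDensity, g.gram_transition hx, Matrix.det_mul, Matrix.det_mul, Matrix.det_transpose,
    det_modelMatrix, mul_right_comm, ← sq, Real.sqrt_mul (sq_nonneg _), Real.sqrt_sq_eq_abs]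
  rfl

/-- The integrals over the intersection of two plaques do not depend on the chart. -/
lemma lintegral_overlap (hr : 1 ≤ r) {i j : ι} {y : T i} (hy : y ∈ (𝒜.hol i j).source)
    (F : M → ℝ≥0∞) :
    ∫⁻ x in 𝒜.overlap i j y,
      ENNReal.ofReal (g.volDensity i (x, y)) * F (𝒜.plaqueMap ⟨i, y⟩ x) =
    ∫⁻ x in 𝒜.overlap j i (𝒜.hol i j y), ENNReal.ofReal (g.volDensity j (x, 𝒜.hol i j y)) *
      F (𝒜.plaqueMap ⟨j, 𝒜.hol i j y⟩ x) := by
  rw [← 𝒜.image_transition hy, lintegral_image_eq_lintegral_abs_det_fderiv_mul volume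
    (𝒜.isOpen_overlap i j y).measurableSet
    (fun x hx => (𝒜.differentiableAt_transition hr hx).hasFDerivAt.hasFDerivWithinAt)
    (𝒜.injOn_transition i j y)]
  refine setLIntegral_congr_fun (𝒜.isOpen_overlap i j y).measurableSet fun x hx => ?_
  rw [𝒜.plaqueMap_transition hx, g.volDensity_transition hx,
    ENNReal.ofReal_mul (abs_nonneg _), mul_assoc]

lemma aemeasurable_volDensity (s : Σ i, T i) :
    AEMeasurable (fun x => g.volDensity s.1 (x, s.2)) (volume.restrict (𝒜.disc s.1)) :=
  ((g.continuousOn_volDensity s.1).comp (f := fun x : Model d => (x, s.2)) (by fun_prop)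
    fun _ hx => 𝒜.mem_target.2 hx).aemeasurable (𝒜.isOpen_disc s.1).measurableSet

section Measure

variable [MeasurableSpace M] [BorelSpace M]

lemma aemeasurable_plaqueMap (s : Σ i, T i) :
    AEMeasurable (𝒜.plaqueMap s) (volume.restrict (𝒜.disc s.1)) :=
  (𝒜.continuousOn_plaqueMap s).aemeasurable (𝒜.isOpen_disc s.1).measurableSet

lemma lintegral_leafVolume_eq_tsum (ρ : PartitionOfUnity ι M) (t : Σ i, T i) {f : M → ℝ≥0∞}
    (hf : Measurable f) :
    ∫⁻ p, f p ∂(g.leafVolume ρ t) = ∑' s : {s : Σ i, T i // 𝒜.Rel t s},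
      ∫⁻ x in 𝒜.disc s.1.1, ENNReal.ofReal (ρ s.1.1 (𝒜.plaqueMap s.1 x)) *
        (ENNReal.ofReal (g.volDensity s.1.1 (x, s.1.2)) * f (𝒜.plaqueMap s.1 x)) := by
  rw [leafVolume, lintegral_sum_measure]
  refine tsum_congr fun s => ?_
  have h1 := aemeasurable_plaqueMap (𝒜 := 𝒜) s.1
  have h2 := g.aemeasurable_volDensity s.1
  have h3 : AEMeasurable (fun x => ρ s.1.1 (𝒜.plaqueMap s.1 x)) (volume.restrict (𝒜.disc s.1.1)) :=
    (ρ s.1.1).continuous.measurable.comp_aemeasurable h1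
  rw [lintegral_map' hf.aemeasurable (h1.mono_ac (withDensity_absolutelyContinuous _ _)),
    lintegral_withDensity_eq_lintegral_mul₀ (f := fun x => ENNReal.ofReal
      (ρ s.1.1 (𝒜.plaqueMap s.1 x) * g.volDensity s.1.1 (x, s.1.2))) (h3.mul h2).ennreal_ofReal
      (g := fun x => f (𝒜.plaqueMap s.1 x)) (hf.comp_aemeasurable h1)]
  refine lintegral_congr fun x => ?_
  simp only [Pi.mul_apply]
  rw [ENNReal.ofReal_mul (ρ.nonneg _ _), mul_assoc]

/-- On the domain of the chart `i`, the volume of a leaf is the sum of the volumes of its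
plaques. -/
lemma lintegral_leafVolume [Fintype ι] (hr : 1 ≤ r) {ρ : PartitionOfUnity ι M}
    (hρ : ρ.IsSubordinate fun i => (𝒜.chart i).source) (t : Σ i, T i) (i : ι) {f : M → ℝ≥0∞}
    (hf : Measurable f) (hfi : ∀ p ∉ (𝒜.chart i).source, f p = 0) :
    ∫⁻ p, f p ∂(g.leafVolume ρ t) = ∑' s : {s : T i // 𝒜.Rel t ⟨i, s⟩},
      ∫⁻ x in 𝒜.disc i, ENNReal.ofReal (g.volDensity i (x, s.1)) *
        f (𝒜.plaqueMap ⟨i, s.1⟩ x) := by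
  let I : ∀ (i k : ι), T i → ℝ≥0∞ := fun i k y =>
    ∫⁻ x in 𝒜.disc i, ENNReal.ofReal (g.volDensity i (x, y)) *
      (ENNReal.ofReal (ρ k (𝒜.plaqueMap ⟨i, y⟩ x)) * f (𝒜.plaqueMap ⟨i, y⟩ x))
  have hzero : ∀ k p, p ∉ (𝒜.chart i).source ∩ (𝒜.chart k).source →
      ENNReal.ofReal (ρ k p) * f p = 0 := by
    intro k p hp
    by_cases h : p ∈ (𝒜.chart i).source
    · have : ρ k p = 0 := (eventually_partition_eq_zero hρ fun h' => hp ⟨h, h'⟩).self_of_nhds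
      simp [this]
    · simp [hfi p h]
  have hres : ∀ (i₁ j₁ k : ι) (y : T i₁),
      (∀ p, p ∉ (𝒜.chart j₁).source → ENNReal.ofReal (ρ k p) * f p = 0) →
      I i₁ k y = ∫⁻ x in 𝒜.overlap i₁ j₁ y, ENNReal.ofReal (g.volDensity i₁ (x, y)) *
        (ENNReal.ofReal (ρ k (𝒜.plaqueMap ⟨i₁, y⟩ x)) * f (𝒜.plaqueMap ⟨i₁, y⟩ x)) := by
    intro i₁ j₁ k y h0
    refine setLIntegral_eq_of_subset (𝒜.isOpen_overlap _ _ _).measurableSet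
      (𝒜.isOpen_disc i₁).measurableSet (fun x hx => hx.1) fun x hx hx' => ?_
    rw [h0 _ fun h => hx' ⟨hx, h⟩, mul_zero]
  have hI : ∀ j (y : T j), I j j y = ∫⁻ x in 𝒜.overlap j i y,
      ENNReal.ofReal (g.volDensity j (x, y)) *
        (ENNReal.ofReal (ρ j (𝒜.plaqueMap ⟨j, y⟩ x)) * f (𝒜.plaqueMap ⟨j, y⟩ x)) := fun j y =>
    hres j i j y fun p hp => hzero j p fun h => hp h.1
  have hI' : ∀ j (y : T i), I i j y = ∫⁻ x in 𝒜.overlap i j y,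
      ENNReal.ofReal (g.volDensity i (x, y)) *
        (ENNReal.ofReal (ρ j (𝒜.plaqueMap ⟨i, y⟩ x)) * f (𝒜.plaqueMap ⟨i, y⟩ x)) := fun j y =>
    hres i j j y fun p hp => hzero j p fun h => hp h.2
  have hempty : ∀ (i₁ j₁ : ι) (y : T i₁), y ∉ (𝒜.hol i₁ j₁).source → 𝒜.overlap i₁ j₁ y = ∅ := by
    intro i₁ j₁ y hy
    exact eq_empty_of_forall_notMem fun x hx => hy (𝒜.mem_hol_source_of_mem_overlap hx)
  -- the contribution of the function `ρ j`
  have hj : ∀ j, ∑' s : {s : T j // 𝒜.Rel t ⟨j, s⟩}, I j j s =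
      ∑' s : {s : T i // 𝒜.Rel t ⟨i, s⟩}, I i j s := by
    intro j
    -- Both sums reduce to plaques meeting the other chart. Holonomy pairs these plaques
    -- bijectively, and a change of variables identifies the integrals over the intersections.
    let e : {s : T j // s ∈ {s | 𝒜.Rel t ⟨j, s⟩} ∩ (𝒜.hol j i).source} ≃
        {s : T i // s ∈ {s | 𝒜.Rel t ⟨i, s⟩} ∩ (𝒜.hol i j).source} :=
      { toFun := fun s => ⟨𝒜.hol j i s.1, s.2.1.trans
          (Meets.rel (𝒜.meets_iff.2 ⟨s.2.2, rfl⟩)), 𝒜.hol_mem_hol_source s.2.2⟩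
        invFun := fun s => ⟨𝒜.hol i j s.1, s.2.1.trans
          (Meets.rel (𝒜.meets_iff.2 ⟨s.2.2, rfl⟩)), 𝒜.hol_mem_hol_source s.2.2⟩
        left_inv := fun s => Subtype.ext (𝒜.hol_hol s.2.2)
        right_inv := fun s => Subtype.ext (𝒜.hol_hol s.2.2) }
    rw [tsum_pred_eq_tsum_inter (f := I j j) (S := (𝒜.hol j i).source) fun s hs => by
        rw [hI, hempty _ _ _ hs]; simp,
      tsum_pred_eq_tsum_inter (f := I i j) (S := (𝒜.hol i j).source) fun s hs => by
        rw [hI', hempty _ _ _ hs]; simp, ← e.tsum_eq]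
    refine tsum_congr fun s => ?_
    rw [hI, hI', g.lintegral_overlap hr s.2.2 (fun p => ENNReal.ofReal (ρ j p) * f p)]
    rfl
  rw [g.lintegral_leafVolume_eq_tsum ρ t hf, tsum_subtype_sigma (𝒜.Rel t) fun s =>
    ∫⁻ x in 𝒜.disc s.1, ENNReal.ofReal (ρ s.1 (𝒜.plaqueMap s x)) *
        (ENNReal.ofReal (g.volDensity s.1 (x, s.2)) * f (𝒜.plaqueMap s x))]
  have : ∀ j, ∑' s' : {s' : T j // 𝒜.Rel t ⟨j, s'⟩},
      ∫⁻ x in 𝒜.disc j, ENNReal.ofReal (ρ j (𝒜.plaqueMap ⟨j, s'⟩ x)) *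
        (ENNReal.ofReal (g.volDensity j (x, s')) * f (𝒜.plaqueMap ⟨j, s'⟩ x)) =
      ∑' s : {s : T i // 𝒜.Rel t ⟨i, s⟩}, I i j s := by
    intro j
    rw [← hj]
    refine tsum_congr fun s => lintegral_congr fun x => ?_
    rw [mul_left_comm]
  simp only [this]
  -- All contributions are now expressed in the chart `i`; exchanging the sums lets the partition of
  -- unity add up to one on each plaque.
  rw [← tsum_fintype (L := SummationFilter.unconditional ι), ENNReal.tsum_comm]
  refine tsum_congr fun s => ?_
  rw [tsum_fintype, ← lintegral_finsetSum']
  · refine lintegral_congr fun x => ?_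
    rw [← Finset.mul_sum, ← Finset.sum_mul, ← ENNReal.ofReal_sum_of_nonneg fun k _ => ρ.nonneg k _]
    have := ρ.sum_eq_one (mem_univ (𝒜.plaqueMap ⟨i, s⟩ x))
    rw [finsum_eq_sum_of_fintype] at this
    rw [this, ENNReal.ofReal_one, one_mul]
  · intro k _
    have h1 := aemeasurable_plaqueMap (𝒜 := 𝒜) ⟨i, s⟩
    exact (g.aemeasurable_volDensity ⟨i, s⟩).ennreal_ofReal.mul
      (((ρ k).continuous.measurable.comp_aemeasurable h1).ennreal_ofReal.mul
        (hf.comp_aemeasurable h1))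

end Measure

end LeafwiseMetric

namespace LeafwiseMetric

open FoliatedAtlas

variable {M : Type*} [TopologicalSpace M] {d : ℕ} {r : ℕ∞} {ι : Type*} {T : ι → Type*}
  [∀ i, TopologicalSpace (T i)] {𝒜 : FoliatedAtlas M d r T} (g : LeafwiseMetric 𝒜)

/-! ### The leafwise distance -/

lemma pathLength_reverse (s : Σ i, T i) {c : ℝ → Model d} (hc : ContDiff ℝ 1 c) :
    g.pathLength s (fun u => c (1 - u)) = g.pathLength s c := by
  have hd : ∀ u, deriv (fun u => c (1 - u)) u = -deriv c (1 - u) := by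
    intro u
    have h1 : HasDerivAt (fun u : ℝ => 1 - u) (-1) u := by
      simpa using (hasDerivAt_id u).const_sub 1
    have h2 := ((hc.differentiable (by norm_num)) (1 - u)).hasDerivAt.scomp u h1
    simpa [Function.comp_def] using h2.deriv
  simp only [pathLength, hd]
  rw [← lintegral_indicator measurableSet_Icc, ← lintegral_indicator measurableSet_Icc,
    ← lintegral_sub_left_eq_self _ (1 : ℝ)]
  congr 1
  funext u
  by_cases hu : u ∈ Icc (0 : ℝ) 1
  · have hu' : 1 - u ∈ Icc (0 : ℝ) 1 := ⟨by linarith [hu.2], by linarith [hu.1]⟩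
    simp [indicator_of_mem hu, indicator_of_mem hu']
  · have hu' : 1 - u ∉ Icc (0 : ℝ) 1 := fun h => hu ⟨by linarith [h.2], by linarith [h.1]⟩
    simp [indicator_of_notMem hu, indicator_of_notMem hu']

lemma plaqueEDist_comm_le (p q : M) : g.plaqueEDist p q ≤ g.plaqueEDist q p := by
  refine le_iInf fun s => le_iInf fun c => le_iInf fun hc => ?_
  rw [← g.pathLength_reverse s hc.1]
  refine iInf_le_of_le s (iInf_le_of_le (fun u => c (1 - u)) (iInf_le _ ?_))
  refine ⟨hc.1.comp (by fun_prop), fun u hu => hc.2.1 _ ⟨by linarith [hu.2], by linarith [hu.1]⟩,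
    ?_, ?_⟩
  · simpa using hc.2.2.2
  · simpa using hc.2.2.1

lemma leafEDist_self (p : M) : g.leafEDist p p = 0 := by
  refine le_antisymm ?_ zero_le
  exact iInf_le_of_le 0 (iInf_le_of_le (fun _ => p) (iInf_le_of_le ⟨rfl, rfl⟩ (by simp)))

lemma leafEDist_le_sum (z : ℕ → M) (n : ℕ) :
    g.leafEDist (z 0) (z n) ≤ ∑ k ∈ Finset.range n, g.plaqueEDist (z k) (z (k + 1)) :=
  iInf_le_of_le n (iInf_le_of_le z (iInf_le _ ⟨rfl, rfl⟩))

lemma leafEDist_comm_le (p q : M) : g.leafEDist p q ≤ g.leafEDist q p := by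
  refine le_iInf fun n => le_iInf fun z => le_iInf fun hz => ?_
  have h := g.leafEDist_le_sum (fun k => z (n - k)) n
  simp only [Nat.sub_zero, hz.2, Nat.sub_self, hz.1] at h
  refine h.trans ?_
  rw [← Finset.sum_range_reflect]
  refine Finset.sum_le_sum fun k hk => ?_
  rw [Finset.mem_range] at hk
  have h1 : n - (n - 1 - k) = k + 1 := by omega
  have h2 : n - (n - 1 - k + 1) = k := by omega
  rw [h1, h2]
  exact g.plaqueEDist_comm_le _ _

lemma leafEDist_triangle (p q u : M) :
    g.leafEDist p u ≤ g.leafEDist p q + g.leafEDist q u := by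
  refine ENNReal.le_of_forall_pos_le_add fun ε hε hlt => ?_
  -- Both distances are finite, so each has a chain of length within ε/2 of it; the two chains are
  -- concatenated.
  have hfin := ENNReal.add_lt_top.1 hlt
  have hε' : (ε / 2 : ℝ≥0∞) ≠ 0 := by simp [hε.ne']
  have h1 := ENNReal.lt_add_right hfin.1.ne hε'
  have h2 := ENNReal.lt_add_right hfin.2.ne hε'
  simp only [leafEDist, iInf_lt_iff] at h1 h2
  obtain ⟨n, z, hz, h1⟩ := h1
  obtain ⟨m, w, hw, h2⟩ := h2
  let v : ℕ → M := fun k => if k ≤ n then z k else w (k - n)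
  have hv1 : ∀ k ≤ n, v k = z k := fun k hk => if_pos hk
  have hv2 : ∀ k, v (n + k) = w k := by
    intro k
    rcases Nat.eq_zero_or_pos k with rfl | hk
    · rw [Nat.add_zero, hv1 n le_rfl, hz.2, hw.1]
    · simp only [v]
      rw [if_neg (by omega), Nat.add_sub_cancel_left]
  have hle := g.leafEDist_le_sum v (n + m)
  rw [hv1 0 (Nat.zero_le n), hz.1, hv2, hw.2, Finset.sum_range_add] at hle
  refine hle.trans ?_
  have e1 : ∑ k ∈ Finset.range n, g.plaqueEDist (v k) (v (k + 1)) =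
      ∑ k ∈ Finset.range n, g.plaqueEDist (z k) (z (k + 1)) := by
    refine Finset.sum_congr rfl fun k hk => ?_
    rw [Finset.mem_range] at hk
    rw [hv1 k hk.le, hv1 (k + 1) hk]
  have e2 : ∑ k ∈ Finset.range m, g.plaqueEDist (v (n + k)) (v (n + k + 1)) =
      ∑ k ∈ Finset.range m, g.plaqueEDist (w k) (w (k + 1)) := by
    refine Finset.sum_congr rfl fun k _ => ?_
    rw [hv2, add_assoc, hv2]
  rw [e1, e2]
  refine (add_le_add h1.le h2.le).trans (le_of_eq ?_)
  rw [add_add_add_comm, ENNReal.add_halves]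
  rfl

/-! ### Functions that are Lipschitz for the leafwise distance -/

lemma exists_pos_mul_sq_le_form {i : ι} {S : Set (Model d × T i)} (hS : IsCompact S)
    (hSt : S ⊆ (𝒜.chart i).target) :
    ∃ c : ℝ, 0 < c ∧ ∀ z ∈ S, ∀ v, c * ‖v‖ ^ 2 ≤ g.form i z v v := by
  have hcont : ContinuousOn (fun w : (Model d × T i) × Model d => g.form i w.1 w.2 w.2)
      (S ×ˢ Metric.sphere (0 : Model d) 1) := by
    have h1 : ContinuousOn (fun w : (Model d × T i) × Model d => g.form i w.1)
        (S ×ˢ Metric.sphere (0 : Model d) 1) :=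
      (g.continuousOn_form i).comp continuousOn_fst fun w hw => hSt hw.1
    exact (h1.clm_apply continuousOn_snd).clm_apply continuousOn_snd
  -- A positive minimum over `S` times the unit sphere; homogeneity extends the bound to all
  -- vectors.
  obtain ⟨c, hc, hle⟩ := (hS.prod (isCompact_sphere (0 : Model d) 1)).exists_forall_le'
    hcont (a := 0) fun w hw => g.pos i w.1 (hSt hw.1) w.2 fun h => by
      have := hw.2
      simp [h] at this
  refine ⟨c, hc, fun z hz v => ?_⟩
  rcases eq_or_ne v 0 with rfl | hv
  · simp
  · have hn : 0 < ‖v‖ := norm_pos_iff.2 hv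
    have h := hle (z, ‖v‖⁻¹ • v) ⟨hz, by simp [norm_smul, hn.ne']⟩
    simp only [map_smul, smul_apply, smul_eq_mul] at h
    calc c * ‖v‖ ^ 2 ≤ (‖v‖⁻¹ * (‖v‖⁻¹ * g.form i z v v)) * ‖v‖ ^ 2 := by gcongr
      _ = g.form i z v v := by field_simp

variable {E : Type*} [NormedAddCommGroup E] [NormedSpace ℝ E]

open Classical in
/-- The function `χ(y) θ(x)` in the chart `i`, extended by zero. -/
def bumpFun (𝒜 : FoliatedAtlas M d r T) (i : ι) (θ : Model d → E) (χ : T i → ℝ) (p : M) : E :=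
  if p ∈ (𝒜.chart i).source then χ (𝒜.chart i p).2 • θ (𝒜.chart i p).1 else 0

section Bump

variable {i : ι} {θ : Model d → E} {χ : T i → ℝ}

lemma bumpFun_of_mem {p : M} (hp : p ∈ (𝒜.chart i).source) :
    bumpFun 𝒜 i θ χ p = χ (𝒜.chart i p).2 • θ (𝒜.chart i p).1 := if_pos hp

lemma mem_source_of_bumpFun_ne_zero {p : M} (hp : bumpFun 𝒜 i θ χ p ≠ 0) :
    p ∈ (𝒜.chart i).source := by
  by_contra h
  exact hp (if_neg h)

/-- The function vanishes off the image of the product of the two supports. This image is compact,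
hence closed in the Hausdorff space `M`, and it lies inside the chart. -/
lemma eventually_bumpFun_eq_zero [T2Space M] (hθ : HasCompactSupport θ)
    (hθd : tsupport θ ⊆ 𝒜.disc i) (hχ : HasCompactSupport χ) {p : M}
    (hp : p ∉ (𝒜.chart i).source) : ∀ᶠ q in 𝓝 p, bumpFun 𝒜 i θ χ q = 0 := by
  have hst : tsupport θ ×ˢ tsupport χ ⊆ (𝒜.chart i).target := fun z hz =>
    𝒜.mem_target.2 (hθd hz.1)
  have hK : IsCompact ((𝒜.chart i).symm '' (tsupport θ ×ˢ tsupport χ)) :=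
    (IsCompact.prod hθ hχ).image_of_continuousOn ((𝒜.chart i).continuousOn_symm.mono hst)
  have hpK : p ∉ (𝒜.chart i).symm '' (tsupport θ ×ˢ tsupport χ) := by
    rintro ⟨z, hz, rfl⟩
    exact hp ((𝒜.chart i).map_target (hst hz))
  filter_upwards [hK.isClosed.isOpen_compl.mem_nhds hpK] with q hq
  by_contra hne
  have hqs := mem_source_of_bumpFun_ne_zero hne
  rw [bumpFun_of_mem hqs] at hne
  refine hq ⟨𝒜.chart i q, ⟨?_, ?_⟩, (𝒜.chart i).left_inv hqs⟩
  · exact subset_tsupport _ fun h => hne (by rw [h, smul_zero])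
  · exact subset_tsupport _ fun h => hne (by rw [h, zero_smul])

/-- The Euclidean norm is controlled by the leafwise metric over the compact product of the
supports; elsewhere the left side vanishes. -/
lemma exists_norm_smul_fderiv_le (hθ : HasCompactSupport θ) (hθc : ContDiff ℝ 1 θ)
    (hθd : tsupport θ ⊆ 𝒜.disc i) (hχ : HasCompactSupport χ) (hχc : Continuous χ) :
    ∃ C : ℝ≥0, ∀ z : Model d × T i, ∀ v,
      ‖χ z.2 • fderiv ℝ θ z.1 v‖ ≤ C * √(g.form i z v v) := by
  obtain ⟨c, hc, hle⟩ := g.exists_pos_mul_sq_le_form (i := i) (IsCompact.prod hθ hχ)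
    fun z hz => 𝒜.mem_target.2 (hθd hz.1)
  obtain ⟨A, hA⟩ := (hθ.fderiv (𝕜 := ℝ)).exists_bound_of_continuous
    (hθc.continuous_fderiv (by norm_num))
  obtain ⟨B, hB⟩ := hχ.exists_bound_of_continuous hχc
  have hA0 : 0 ≤ A := (norm_nonneg _).trans (hA 0)
  refine ⟨Real.toNNReal (|B| * A * (√c)⁻¹), fun z v => ?_⟩
  rw [Real.coe_toNNReal _ (by positivity)]
  have hn : 0 ≤ |B| * A * (√c)⁻¹ * √(g.form i z v v) := by positivity
  by_cases hz1 : z.1 ∈ tsupport θ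
  · by_cases hz2 : z.2 ∈ tsupport χ
    · have h1 : √c * ‖v‖ ≤ √(g.form i z v v) := by
        rw [← Real.sqrt_sq (norm_nonneg v), ← Real.sqrt_mul hc.le]
        exact Real.sqrt_le_sqrt (hle z ⟨hz1, hz2⟩ v)
      have hsc : 0 < √c := Real.sqrt_pos.2 hc
      have h2 : ‖v‖ ≤ (√c)⁻¹ * √(g.form i z v v) := by
        rw [le_inv_mul_iff₀ hsc]; exact h1
      rw [norm_smul]
      calc ‖χ z.2‖ * ‖fderiv ℝ θ z.1 v‖ ≤ |B| * (A * ‖v‖) := by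
            gcongr
            · exact (hB _).trans (le_abs_self B)
            · exact (fderiv ℝ θ z.1).le_of_opNorm_le (hA _) v
        _ ≤ |B| * (A * ((√c)⁻¹ * √(g.form i z v v))) := by gcongr
        _ = _ := by ring
    · rw [image_eq_zero_of_notMem_tsupport hz2]
      simpa using hn
  · have : fderiv ℝ θ z.1 = 0 := by
      by_contra h
      exact hz1 (support_fderiv_subset ℝ h)
    simpa [this] using hn

/-- The functions `χ(y) θ(x)` are Lipschitz for the leafwise distance. -/
lemma exists_enorm_bumpFun_sub_le [T2Space M] (hr : 1 ≤ r) (hθ : HasCompactSupport θ)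
    (hθc : ContDiff ℝ 1 θ) (hθd : tsupport θ ⊆ 𝒜.disc i) (hχ : HasCompactSupport χ)
    (hχc : Continuous χ) :
    ∃ C : ℝ≥0, ∀ p q, ‖bumpFun 𝒜 i θ χ p - bumpFun 𝒜 i θ χ q‖ₑ ≤ C * g.leafEDist p q := by
  -- A nonzero constant is wanted because, in `ℝ≥0∞`, multiplication is interchanged below with
  -- infima that may be `∞`.
  obtain ⟨C, hC0, hC⟩ : ∃ C : ℝ≥0, C ≠ 0 ∧ ∀ z : Model d × T i, ∀ v,
      ‖χ z.2 • fderiv ℝ θ z.1 v‖ ≤ C * √(g.form i z v v) := by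
    obtain ⟨C, hC⟩ := g.exists_norm_smul_fderiv_le hθ hθc hθd hχ hχc
    refine ⟨C + 1, by positivity, fun z v => (hC z v).trans ?_⟩
    gcongr
    simp
  -- The derivative must be bounded in every chart, since paths may leave the chart `i`. Inside that
  -- chart the chain rule applies and the change of charts is an isometry; outside, the function
  -- vanishes locally.
  have hloc : ∀ (s : Σ i, T i), ∀ x ∈ 𝒜.disc s.1,
      ContDiffAt ℝ 1 (fun x => bumpFun 𝒜 i θ χ (𝒜.plaqueMap s x)) x ∧
      ∀ v, ‖fderiv ℝ (fun x => bumpFun 𝒜 i θ χ (𝒜.plaqueMap s x)) x v‖ ≤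
        C * √(g.form s.1 (x, s.2) v v) := by
    rintro ⟨j, y⟩ x hx
    dsimp only at hx ⊢
    by_cases hp : 𝒜.plaqueMap ⟨j, y⟩ x ∈ (𝒜.chart i).source
    · have hxo : x ∈ 𝒜.overlap j i y := ⟨hx, hp⟩
      have hev : (fun x => bumpFun 𝒜 i θ χ (𝒜.plaqueMap ⟨j, y⟩ x)) =ᶠ[𝓝 x]
          fun x => χ (𝒜.hol j i y) • θ (𝒜.transition j i y x) := by
        filter_upwards [(𝒜.isOpen_overlap j i y).mem_nhds hxo] with x' hx'
        rw [bumpFun_of_mem hx'.2, 𝒜.chart_plaqueMap_of_mem_overlap hx']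
      have htr : ContDiffAt ℝ 1 (𝒜.transition j i y) x :=
        ((𝒜.contDiffOn_transition j i y).contDiffAt
          ((𝒜.isOpen_overlap j i y).mem_nhds hxo)).of_le (by exact_mod_cast hr)
      have hθt : ContDiffAt ℝ 1 (fun x => θ (𝒜.transition j i y x)) x :=
        hθc.contDiffAt.comp x htr
      refine ⟨(hθt.const_smul (χ (𝒜.hol j i y))).congr_of_eventuallyEq hev, fun v => ?_⟩
      rw [hev.fderiv_eq, fderiv_fun_const_smul (hθt.differentiableAt (by norm_num)), smul_apply]
      have hch : fderiv ℝ (fun x => θ (𝒜.transition j i y x)) x =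
          (fderiv ℝ θ (𝒜.transition j i y x)).comp (fderiv ℝ (𝒜.transition j i y) x) :=
        fderiv_comp x (hθc.differentiable (by norm_num) _) (htr.differentiableAt (by norm_num))
      rw [hch, ← g.form_transition hxo]
      exact hC (𝒜.transition j i y x, 𝒜.hol j i y) _
    · have hev : (fun x => bumpFun 𝒜 i θ χ (𝒜.plaqueMap ⟨j, y⟩ x)) =ᶠ[𝓝 x] fun _ => 0 :=
        ((𝒜.continuousOn_plaqueMap ⟨j, y⟩).continuousAt
          ((𝒜.isOpen_disc j).mem_nhds hx)).eventually (eventually_bumpFun_eq_zero hθ hθd hχ hp)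
      refine ⟨contDiffAt_const.congr_of_eventuallyEq hev, fun v => ?_⟩
      rw [hev.fderiv_eq]
      simp only [fderiv_fun_const, Pi.zero_apply, zero_apply, norm_zero]
      positivity
  -- Integrate the derivative bound along a path in one plaque; chains of paths then follow by the
  -- triangle inequality.
  have hpath : ∀ p q, ‖bumpFun 𝒜 i θ χ p - bumpFun 𝒜 i θ χ q‖ₑ ≤ C * g.plaqueEDist p q := by
    intro p q
    simp only [plaqueEDist, ENNReal.mul_iInf_of_ne (ENNReal.coe_ne_zero.2 hC0) ENNReal.coe_ne_top]
    refine le_iInf fun s => le_iInf fun c => le_iInf fun hc => ?_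
    obtain ⟨hc1, hcd, rfl, rfl⟩ := hc
    have hd : ∀ u ∈ Icc (0 : ℝ) 1,
        ContDiffAt ℝ 1 (fun u => bumpFun 𝒜 i θ χ (𝒜.plaqueMap s (c u))) u :=
      fun u hu => ((hloc s (c u) (hcd u hu)).1).comp u hc1.contDiffAt
    have h1 := enorm_sub_le_lintegral_deriv_of_contDiffOn_Icc
      (f := fun u => bumpFun 𝒜 i θ χ (𝒜.plaqueMap s (c u)))
      (fun u hu => (hd u hu).contDiffWithinAt) zero_le_one
    rw [← edist_eq_enorm_sub, edist_comm, edist_eq_enorm_sub]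
    refine h1.trans ?_
    rw [pathLength, ← lintegral_const_mul' _ _ ENNReal.coe_ne_top]
    refine setLIntegral_mono' measurableSet_Icc fun u hu => ?_
    have h2 : deriv (fun u => bumpFun 𝒜 i θ χ (𝒜.plaqueMap s (c u))) u =
        fderiv ℝ (fun x => bumpFun 𝒜 i θ χ (𝒜.plaqueMap s x)) (c u) (deriv c u) :=
      ((((hloc s (c u) (hcd u hu)).1).differentiableAt (by norm_num)).hasFDerivAt.comp_hasDerivAt u
        (hc1.differentiable (by norm_num) u).hasDerivAt).deriv
    rw [h2, ← ofReal_norm, ← ENNReal.ofReal_coe_nnreal, ← ENNReal.ofReal_mul (NNReal.coe_nonneg C)]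
    exact ENNReal.ofReal_le_ofReal ((hloc s (c u) (hcd u hu)).2 _)
  refine ⟨C, fun p q => ?_⟩
  simp only [leafEDist, ENNReal.mul_iInf_of_ne (ENNReal.coe_ne_zero.2 hC0) ENNReal.coe_ne_top]
  refine le_iInf fun n => le_iInf fun z => le_iInf fun hz => ?_
  rw [← hz.1, ← hz.2, ← edist_eq_enorm_sub, Finset.mul_sum]
  refine (edist_le_range_sum_edist (fun k => bumpFun 𝒜 i θ χ (z k)) n).trans ?_
  refine Finset.sum_le_sum fun k _ => ?_
  rw [edist_eq_enorm_sub]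
  exact hpath _ _

end Bump

/-! ### Leaf topology and Carathéodory measurability -/

section LeafTopology

variable [T2Space M] [∀ i, LocallyCompactSpace (T i)] [∀ i, T2Space (T i)]

lemma exists_compactlySupported_eq_one {X : Type*} [TopologicalSpace X] [LocallyCompactSpace X]
    [T2Space X] {K : Set X} (hK : IsCompact K) :
    ∃ χ : X → ℝ, Continuous χ ∧ HasCompactSupport χ ∧ ∀ y ∈ K, χ y = 1 := by
  obtain ⟨f, hf1, -, hfc, -⟩ := exists_continuous_one_zero_of_isCompact hK isClosed_empty
    (disjoint_empty K)
  exact ⟨f, f.continuous, hfc, hf1⟩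

/-- The leaf topology is coarser than the topology of the leafwise distance. -/
lemma exists_leafEDist_lt_imp_mem (hr : 1 ≤ r) {O : Set M} (hO : IsOpen[𝒜.leafTopology] O) {p : M}
    (hp : p ∈ O) : ∃ ε : ℝ≥0∞, 0 < ε ∧ ∀ q, g.leafEDist p q < ε → q ∈ O := by
  obtain ⟨i, hpi⟩ := 𝒜.cover p
  set x₀ := (𝒜.chart i p).1 with hx₀
  set y₀ := (𝒜.chart i p).2 with hy₀
  have hO' := (𝒜.isOpen_leafTopology_iff.1 hO) ⟨i, y₀⟩
  have hx₀O : x₀ ∈ {x | x ∈ 𝒜.disc i ∧ 𝒜.plaqueMap ⟨i, y₀⟩ x ∈ O} :=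
    ⟨𝒜.chart_fst_mem_disc hpi, by rw [𝒜.plaqueMap_chart hpi]; exact hp⟩
  obtain ⟨θ, hθs, hθc, hθd, -, hθ1⟩ := exists_contDiff_tsupport_subset (n := 1)
    (hO'.mem_nhds hx₀O)
  obtain ⟨χ, hχc, hχs, hχ1⟩ := exists_compactlySupported_eq_one (isCompact_singleton (x := y₀))
  obtain ⟨C, hC⟩ := g.exists_enorm_bumpFun_sub_le (i := i) hr hθc hθd
    (fun x hx => (hθs hx).1) hχs hχc
  have hFp : bumpFun 𝒜 i θ χ p = 1 := by
    rw [bumpFun_of_mem hpi, ← hx₀, ← hy₀, hχ1 _ rfl, hθ1]; simp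
  -- The function equals 1 at `p` and is `C`-Lipschitz, so it cannot vanish at distance less than
  -- 1/(C+1).
  refine ⟨((C : ℝ≥0∞) + 1)⁻¹, by simp, fun q hq => ?_⟩
  obtain ⟨n, z, hz, hlt⟩ : ∃ n, ∃ z : ℕ → M, ∃ _ : z 0 = p ∧ z n = q,
      ∑ k ∈ Finset.range n, g.plaqueEDist (z k) (z (k + 1)) < ((C : ℝ≥0∞) + 1)⁻¹ := by
    simpa only [leafEDist, iInf_lt_iff] using hq
  have hsum : ∀ k ≤ n, ∑ k ∈ Finset.range k, g.plaqueEDist (z k) (z (k + 1)) <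
      ((C : ℝ≥0∞) + 1)⁻¹ := fun k hk =>
    (Finset.sum_le_sum_of_subset (Finset.range_mono hk)).trans_lt hlt
  have hne : ∀ k ≤ n, bumpFun 𝒜 i θ χ (z k) ≠ 0 := by
    intro k hk h0
    have h1 := hC (z 0) (z k)
    rw [h0, hz.1, hFp, sub_zero] at h1
    have h2 : g.leafEDist p (z k) < ((C : ℝ≥0∞) + 1)⁻¹ := by
      rw [← hz.1]
      exact (g.leafEDist_le_sum z k).trans_lt (hsum k hk)
    have h3 : ((C : ℝ≥0∞) + 1) * g.leafEDist p (z k) < 1 := by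
      calc ((C : ℝ≥0∞) + 1) * g.leafEDist p (z k) < ((C : ℝ≥0∞) + 1) * ((C : ℝ≥0∞) + 1)⁻¹ := by
            gcongr
            exact ENNReal.add_ne_top.2 ⟨ENNReal.coe_ne_top, ENNReal.one_ne_top⟩
        _ = 1 := ENNReal.mul_inv_cancel (by simp)
            (ENNReal.add_ne_top.2 ⟨ENNReal.coe_ne_top, ENNReal.one_ne_top⟩)
    have h4 : (C : ℝ≥0∞) * g.leafEDist p (z k) ≤ ((C : ℝ≥0∞) + 1) * g.leafEDist p (z k) := by
      gcongr
      simp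
    have := (h1.trans h4).trans_lt h3
    simp at this
  -- Consecutive vertices share a plaque of some chart and, as the function is nonzero at both, lie
  -- in the chart `i`. A plaque of one chart meets at most one plaque of the other, so the
  -- transverse coordinate is preserved; the path between the vertices is irrelevant.
  have hy : ∀ k ≤ n, (𝒜.chart i (z k)).2 = y₀ := by
    intro k
    induction k with
    | zero => intro _; rw [hz.1]
    | succ k ih =>
      intro hk
      rw [← ih (by omega)]
      have hfin : g.plaqueEDist (z k) (z (k + 1)) < ⊤ :=
        ((Finset.single_le_sum (f := fun k => g.plaqueEDist (z k) (z (k + 1)))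
          (fun _ _ => zero_le) (Finset.mem_range.2 (Nat.lt_of_succ_le hk))).trans_lt hlt).trans_le
          le_top
      simp only [plaqueEDist, iInf_lt_iff] at hfin
      obtain ⟨s, c, ⟨-, hcd, h0, h1⟩, -⟩ := hfin
      have m0 := hcd 0 (by simp)
      have m1 := hcd 1 (by simp)
      refine 𝒜.snd_eq_of_snd_eq (i := s.1) ?_ (mem_source_of_bumpFun_ne_zero (hne _ hk)) ?_
        (mem_source_of_bumpFun_ne_zero (hne k (by omega))) ?_
      · rw [← h1]; exact 𝒜.plaqueMap_mem_source m1
      · rw [← h0]; exact 𝒜.plaqueMap_mem_source m0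
      · rw [← h1, ← h0, 𝒜.chart_plaqueMap m0, 𝒜.chart_plaqueMap m1]
  have hqn := hne n le_rfl
  rw [hz.2] at hqn
  have hqi := mem_source_of_bumpFun_ne_zero hqn
  have hyq := hy n le_rfl
  rw [hz.2] at hyq
  rw [bumpFun_of_mem hqi] at hqn
  have hxq : (𝒜.chart i q).1 ∈ tsupport θ :=
    subset_tsupport _ fun h => hqn (by rw [h, smul_zero])
  have := (hθs hxq).2
  rwa [← hyq, 𝒜.plaqueMap_chart hqi] at this

/-- `M` with the leafwise distance. -/
@[reducible] def leafEMetricSpace (hr : 1 ≤ r) : EMetricSpace M where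
  edist := g.leafEDist
  edist_self := g.leafEDist_self
  edist_comm p q := le_antisymm (g.leafEDist_comm_le p q) (g.leafEDist_comm_le q p)
  edist_triangle := g.leafEDist_triangle
  eq_of_edist_eq_zero := by
    intro p q h
    by_contra hne
    -- Points are closed in `M`, hence in the finer leaf topology; so distinct points are at
    -- positive distance.
    have hopen : IsOpen[𝒜.leafTopology] {q}ᶜ :=
      𝒜.leafTopology_le _ (isOpen_compl_singleton (x := q))
    obtain ⟨ε, hε, h'⟩ := g.exists_leafEDist_lt_imp_mem hr hopen (p := p) hne
    exact h' q (lt_of_eq_of_lt h hε) rfl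

/-- The sets which are closed in the leaf topology are measurable for the Hausdorff measures of the
leafwise distance. -/
lemma measurableSet_caratheodory_of_isClosed (hr : 1 ≤ r) (m : ℝ) {A : Set M}
    (hA : IsClosed[𝒜.leafTopology] A) :
    MeasurableSet[(hausdorffOuter g.leafEDist m).caratheodory] A := by
  let inst := g.leafEMetricSpace hr
  have h1 : IsClosed[inst.toPseudoEMetricSpace.toUniformSpace.toTopologicalSpace] A := by
    rw [← @isOpen_compl_iff, EMetric.isOpen_iff]
    intro p hp
    obtain ⟨ε, hε, h⟩ := g.exists_leafEDist_lt_imp_mem hr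
      ((@isOpen_compl_iff _ _ 𝒜.leafTopology).2 hA) hp
    refine ⟨ε, hε, fun q hq => h q ?_⟩
    rw [Metric.mem_eball, edist_comm] at hq
    exact hq
  -- Hausdorff outer measures are metric outer measures, so the Borel sets of the leafwise distance
  -- are Carathéodory measurable. Leaf-closed sets are among them.
  have h2 := (OuterMeasure.mkMetric'_isMetric (X := M)
    (fun S => Metric.ediam S ^ m)).borel_le_caratheodory
  have h3 : OuterMeasure.mkMetric' (X := M) (fun S => Metric.ediam S ^ m) =
      hausdorffOuter g.leafEDist m := rfl
  rw [h3] at h2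
  exact h2 _ (MeasurableSpace.measurableSet_generateFrom h1.isOpen_compl).of_compl

end LeafTopology

end LeafwiseMetric

/-! ### Volumes of tubes -/

section Tube

lemma IsPreconnected.inter_frontier_nonempty {X : Type*} [TopologicalSpace X] {S V : Set X}
    (hS : IsPreconnected S) (h1 : (S ∩ V).Nonempty) (h2 : (S ∩ Vᶜ).Nonempty) :
    (S ∩ frontier V).Nonempty := by
  by_contra hne
  rw [not_nonempty_iff_eq_empty] at hne
  have hcov : S ⊆ interior V ∪ (closure V)ᶜ := by
    intro p hp
    by_cases hpc : p ∈ closure V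
    · left
      by_contra hi
      have : p ∈ S ∩ frontier V := ⟨hp, hpc, hi⟩
      rw [hne] at this
      exact this
    · exact Or.inr hpc
  obtain ⟨p, hp, hpV⟩ := h1
  obtain ⟨q, hq, hqV⟩ := h2
  obtain ⟨u, -, hu, hu'⟩ := hS _ _ isOpen_interior isClosed_closure.isOpen_compl hcov
    ⟨p, hp, (hcov hp).resolve_right fun h => h (subset_closure hpV)⟩
    ⟨q, hq, (hcov hq).resolve_left fun h => hqV (interior_subset h)⟩
  exact hu' (subset_closure (interior_subset hu))

variable {d : ℕ}

/-- The union of the segments `[x, x + v]` with `x` in `S`. -/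
def tube (S : Set (Model d)) (v : Model d) : Set (Model d) :=
  {x | ∃ x₀ ∈ S, ∃ t ∈ Icc (0 : ℝ) 1, x = x₀ + t • v}

lemma tube_mono {S S' : Set (Model d)} (h : S ⊆ S') (v : Model d) : tube S v ⊆ tube S' v :=
  fun _ ⟨x₀, hx₀, t, ht, hx⟩ => ⟨x₀, h hx₀, t, ht, hx⟩

lemma tube_iUnion (S : ℕ → Set (Model d)) (v : Model d) :
    tube (⋃ n, S n) v ⊆ ⋃ n, tube (S n) v := by
  rintro x ⟨x₀, hx₀, t, ht, hx⟩
  obtain ⟨n, hn⟩ := mem_iUnion.1 hx₀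
  exact mem_iUnion.2 ⟨n, x₀, hn, t, ht, hx⟩

/-- The tube is covered by about ‖v‖/δ balls of radius 2δ centred along one segment, each of volume
of order δ^d. -/
lemma volume_tube_le_of_pos (hd : 1 ≤ d) {S : Set (Model d)} {v : Model d} {δ L : ℝ} (hδ : 0 < δ)
    (hδ1 : δ ≤ 1) (hv : ‖v‖ ≤ L) (hS : ∀ x ∈ S, ∀ x' ∈ S, dist x x' ≤ δ) :
    volume (tube S v) ≤ ENNReal.ofReal (2 ^ d * (L + 3)) * volume (Metric.ball (0 : Model d) 1) *
      ENNReal.ofReal δ ^ (d - 1) := by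
  rcases S.eq_empty_or_nonempty with rfl | ⟨x₀, hx₀⟩
  · have : tube (∅ : Set (Model d)) v = ∅ := by
      ext x; simp [tube]
    simp [this]
  -- Enough subdivision points for steps of length at most δ; the extra 1 keeps `N` positive when `v
  -- = 0`.
  set N : ℕ := ⌈‖v‖ / δ⌉₊ + 1 with hN
  have hNpos : (0 : ℝ) < N := by rw [hN]; positivity
  have hvN : ‖v‖ / N ≤ δ := by
    rw [div_le_iff₀ hNpos, ← div_le_iff₀' hδ]
    refine (Nat.le_ceil _).trans ?_
    rw [hN]; push_cast; linarith
  have hsub : tube S v ⊆ ⋃ k ∈ Finset.range (N + 1),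
      Metric.closedBall (x₀ + ((k : ℝ) / N) • v) (2 * δ) := by
    rintro x ⟨x₁, hx₁, t, ht, rfl⟩
    -- The subdivision point just before parameter `t`: an error δ along `v`, and an error δ from
    -- the diameter of `S`.
    refine mem_biUnion (x := ⌊t * N⌋₊) ?_ ?_
    · have : ⌊t * N⌋₊ ≤ N := by
        refine Nat.floor_le_of_le ?_
        nlinarith [ht.2]
      simpa [Nat.lt_succ_iff] using this
    · rw [Metric.mem_closedBall, dist_eq_norm]
      have hfl := Nat.floor_le (mul_nonneg ht.1 hNpos.le)
      have hfl' := (Nat.lt_floor_add_one (t * N)).le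
      have hab : |t - (⌊t * N⌋₊ : ℝ) / N| ≤ 1 / N := by
        rw [abs_le]
        constructor
        · have : (⌊t * N⌋₊ : ℝ) / N ≤ t := by rw [div_le_iff₀ hNpos]; exact hfl
          have : 0 ≤ 1 / (N : ℝ) := by positivity
          linarith
        · rw [sub_le_iff_le_add, ← add_div, le_div_iff₀ hNpos]; linarith
      have e : x₁ + t • v - (x₀ + ((⌊t * N⌋₊ : ℝ) / N) • v) =
          (x₁ - x₀) + (t - (⌊t * N⌋₊ : ℝ) / N) • v := by module
      rw [e]
      refine (norm_add_le _ _).trans ?_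
      have h1 : ‖x₁ - x₀‖ ≤ δ := by rw [← dist_eq_norm]; exact hS _ hx₁ _ hx₀
      have h2 : ‖(t - (⌊t * N⌋₊ : ℝ) / N) • v‖ ≤ δ := by
        rw [norm_smul, Real.norm_eq_abs]
        calc |t - (⌊t * N⌋₊ : ℝ) / N| * ‖v‖ ≤ 1 / N * ‖v‖ := by gcongr
          _ = ‖v‖ / N := by ring
          _ ≤ δ := hvN
      linarith
  have hL : 0 ≤ L := (norm_nonneg v).trans hv
  calc volume (tube S v) ≤ ∑ k ∈ Finset.range (N + 1),
        volume (Metric.closedBall (x₀ + ((k : ℝ) / N) • v) (2 * δ)) :=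
        (measure_mono hsub).trans (measure_biUnion_finset_le _ _)
    _ = (N + 1 : ℕ) * (ENNReal.ofReal ((2 * δ) ^ d) * volume (Metric.ball (0 : Model d) 1)) := by
        simp only [Measure.addHaar_closedBall volume _ (by positivity : 0 ≤ 2 * δ),
          finrank_euclideanSpace_fin]
        simp
    _ = ENNReal.ofReal ((N + 1 : ℕ) * (2 * δ) ^ d) * volume (Metric.ball (0 : Model d) 1) := by
        rw [ENNReal.ofReal_mul (by positivity), ENNReal.ofReal_natCast, mul_assoc]
    _ ≤ ENNReal.ofReal (2 ^ d * (L + 3) * δ ^ (d - 1)) * volume (Metric.ball (0 : Model d) 1) := by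
        refine mul_le_mul_left (ENNReal.ofReal_le_ofReal ?_) _
        have hN3 : ((N + 1 : ℕ) : ℝ) * δ ≤ L + 3 := by
          have := (Nat.ceil_lt_add_one (div_nonneg (norm_nonneg v) hδ.le)).le
          have h' : ((N + 1 : ℕ) : ℝ) ≤ ‖v‖ / δ + 3 := by
            rw [hN]; push_cast; linarith
          calc ((N + 1 : ℕ) : ℝ) * δ ≤ (‖v‖ / δ + 3) * δ := by gcongr
            _ = ‖v‖ + 3 * δ := by field_simp
            _ ≤ L + 3 := by linarith
        have e : (2 * δ) ^ d = 2 ^ d * (δ * δ ^ (d - 1)) := by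
          rw [mul_pow, ← pow_succ', Nat.sub_add_cancel hd]
        rw [e]
        calc ((N + 1 : ℕ) : ℝ) * (2 ^ d * (δ * δ ^ (d - 1)))
            = 2 ^ d * (((N + 1 : ℕ) : ℝ) * δ) * δ ^ (d - 1) := by ring
          _ ≤ 2 ^ d * (L + 3) * δ ^ (d - 1) := by gcongr
    _ = _ := by
        rw [ENNReal.ofReal_mul (by positivity), ENNReal.ofReal_pow hδ.le, mul_right_comm]

/-- The Hausdorff measure is built from the exact diameter, which may be zero; letting δ' decrease
to δ includes this case. -/
lemma volume_tube_le (hd : 1 ≤ d) {S : Set (Model d)} {v : Model d} {L : ℝ} {δ : ℝ≥0∞}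
    (hδ : δ < 1) (hv : ‖v‖ ≤ L) (hS : ∀ x ∈ S, ∀ x' ∈ S, edist x x' ≤ δ) :
    volume (tube S v) ≤ ENNReal.ofReal (2 ^ d * (L + 3)) * volume (Metric.ball (0 : Model d) 1) *
      δ ^ (d - 1) := by
  have hK : ENNReal.ofReal (2 ^ d * (L + 3)) * volume (Metric.ball (0 : Model d) 1) ≠ ∞ :=
    ENNReal.mul_ne_top ENNReal.ofReal_ne_top measure_ball_lt_top.ne
  have hne : (𝓝[>] δ).NeBot := nhdsGT_neBot_of_exists_gt ⟨1, hδ⟩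
  have hlim : Tendsto (fun δ' : ℝ≥0∞ => ENNReal.ofReal (2 ^ d * (L + 3)) *
      volume (Metric.ball (0 : Model d) 1) * δ' ^ (d - 1)) (𝓝[>] δ)
      (𝓝 (ENNReal.ofReal (2 ^ d * (L + 3)) *
      volume (Metric.ball (0 : Model d) 1) * δ ^ (d - 1))) :=
    ENNReal.Tendsto.const_mul (((ENNReal.continuous_pow (d - 1)).tendsto δ).mono_left
      nhdsWithin_le_nhds) (Or.inr hK)
  refine ge_of_tendsto hlim ?_
  filter_upwards [self_mem_nhdsWithin, nhdsWithin_le_nhds (Iio_mem_nhds hδ)] with δ' h1 h2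
  have hfin : δ' ≠ ∞ := (h2.trans_le le_top).ne
  have := volume_tube_le_of_pos hd (S := S) (v := v) (δ := δ'.toReal)
    (ENNReal.toReal_pos (ne_bot_of_gt h1) hfin) (by
      rw [← ENNReal.toReal_one]; exact (ENNReal.toReal_le_toReal hfin ENNReal.one_ne_top).2 h2.le)
    hv (fun x hx x' hx' => by
      rw [dist_edist]
      exact (ENNReal.toReal_le_toReal (edist_ne_top _ _) hfin).2
        ((hS x hx x' hx').trans h1.le))
  rwa [ENNReal.ofReal_toReal hfin] at this

/-- The outer measure `A ↦ vol (tube (Q ∩ f⁻¹ A) v)`. -/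
def tubeOuter {X : Type*} (f : Model d → X) (Q : Set (Model d)) (v : Model d) : OuterMeasure X where
  measureOf A := volume (tube (Q ∩ f ⁻¹' A) v)
  empty := by
    have : tube (Q ∩ f ⁻¹' ∅) v = ∅ := by
      ext x; simp [tube]
    rw [this, measure_empty]
  mono h := measure_mono (tube_mono (inter_subset_inter_right _ (preimage_mono h)) v)
  iUnion_nat A _ := by
    rw [preimage_iUnion, inter_iUnion]
    exact (measure_mono (tube_iUnion _ v)).trans (measure_iUnion_le _)

/-- Fubini's theorem and translation invariance. The pairs of points are grouped by their difference
`v`. -/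
lemma measure_mul_measure_eq_lintegral {A B : Set (Model d)} (hA : MeasurableSet A)
    (hB : MeasurableSet B) :
    volume A * volume B = ∫⁻ v, volume {x | x ∈ A ∧ x + v ∈ B} := by
  have h1 : ∀ v, volume {x | x ∈ A ∧ x + v ∈ B} =
      ∫⁻ x, A.indicator 1 x * B.indicator 1 (x + v) := by
    intro v
    have hm : MeasurableSet {x | x ∈ A ∧ x + v ∈ B} :=
      hA.inter (hB.preimage (measurable_add_const v))
    rw [← lintegral_indicator_one hm]
    congr 1
    funext x
    by_cases hx : x ∈ A <;> by_cases hx' : x + v ∈ B <;> simp [indicator, hx, hx']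
  simp only [h1]
  rw [lintegral_lintegral_swap]
  · have h2 : ∀ x : Model d, ∫⁻ v, A.indicator 1 x * B.indicator 1 (x + v) =
        A.indicator 1 x * volume B := by
      intro x
      rw [lintegral_const_mul' _ _ (by by_cases h : x ∈ A <;> simp [h]),
        lintegral_add_left_eq_self (fun v => B.indicator (1 : Model d → ℝ≥0∞) v) x,
        lintegral_indicator_one hB]
    simp only [h2]
    rw [lintegral_mul_const _ (measurable_one.indicator hA), lintegral_indicator_one hA]
  · refine Measurable.aemeasurable ?_
    exact ((measurable_one.indicator hA).comp measurable_snd).mul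
      ((measurable_one.indicator hB).comp (measurable_snd.add measurable_fst))

end Tube

/-! ### The relative isoperimetric inequality in the plaques -/

namespace LeafwiseMetric

open FoliatedAtlas

variable {M : Type*} [TopologicalSpace M] {d : ℕ} {r : ℕ∞} {ι : Type*} {T : ι → Type*}
  [∀ i, TopologicalSpace (T i)] {𝒜 : FoliatedAtlas M d r T} (g : LeafwiseMetric 𝒜)
  [T2Space M] [∀ i, LocallyCompactSpace (T i)] [∀ i, T2Space (T i)]

/-- On compact sets, the Euclidean distance is bounded by the leafwise distance. -/
lemma exists_edist_le_mul_leafEDist (hr : 1 ≤ r) {i : ι} {R : ℝ} (hR0 : 0 < R)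
    (hR : R < 𝒜.radius i) {K : Set (T i)} (hK : IsCompact K) :
    ∃ C : ℝ≥0, C ≠ 0 ∧ ∀ y ∈ K, ∀ x ∈ Metric.closedBall (0 : Model d) R,
      ∀ x' ∈ Metric.closedBall (0 : Model d) R,
        edist x x' ≤ C * g.leafEDist (𝒜.plaqueMap ⟨i, y⟩ x) (𝒜.plaqueMap ⟨i, y⟩ x') := by
  obtain ⟨R', hRR', hR'⟩ := exists_between hR
  -- The vector-valued function χ(y) b(x) x is globally Lipschitz for the leafwise distance and
  -- equals the coordinate x on the ball of radius `R` over `K`.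
  let b : ContDiffBump (0 : Model d) := ⟨R, R', hR0, hRR'⟩
  obtain ⟨χ, hχc, hχs, hχ1⟩ := exists_compactlySupported_eq_one hK
  have hb : tsupport (fun x : Model d => b x • x) ⊆ tsupport b :=
    tsupport_smul_subset_left _ _
  obtain ⟨C, hC⟩ := g.exists_enorm_bumpFun_sub_le (i := i) (θ := fun x : Model d => b x • x) hr
    (b.hasCompactSupport.smul_right) (b.contDiff.smul contDiff_id)
    (hb.trans (by
      rw [b.tsupport_eq]
      exact Metric.closedBall_subset_ball hR')) hχs hχc
  refine ⟨C + 1, by positivity, fun y hy x hx x' hx' => ?_⟩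
  have hval : ∀ x ∈ Metric.closedBall (0 : Model d) R,
      bumpFun 𝒜 i (fun x : Model d => b x • x) χ (𝒜.plaqueMap ⟨i, y⟩ x) = x := by
    intro x hx
    have hxd : x ∈ 𝒜.disc i := Metric.closedBall_subset_ball hR hx
    rw [bumpFun_of_mem (𝒜.plaqueMap_mem_source (s := ⟨i, y⟩) hxd),
      𝒜.chart_plaqueMap (s := ⟨i, y⟩) hxd, hχ1 y hy, b.one_of_mem_closedBall hx]
    simp
  have := hC (𝒜.plaqueMap ⟨i, y⟩ x) (𝒜.plaqueMap ⟨i, y⟩ x')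
  rw [hval x hx, hval x' hx', ← edist_eq_enorm_sub] at this
  refine this.trans ?_
  gcongr
  simp

/-- The volumes of the tubes around a set are bounded by its Hausdorff measure. -/
lemma exists_volume_tube_le (hd : 1 ≤ d) (hr : 1 ≤ r) {i : ι} {R : ℝ} (hR0 : 0 < R)
    (hR : R < 𝒜.radius i) {K : Set (T i)} (hK : IsCompact K) (L : ℝ) (hL : 0 ≤ L) :
    ∃ C : ℝ≥0∞, C ≠ ∞ ∧ ∀ y ∈ K, ∀ v : Model d, ‖v‖ ≤ L → ∀ A : Set M,
      volume (tube (Metric.closedBall 0 R ∩ 𝒜.plaqueMap ⟨i, y⟩ ⁻¹' A) v) ≤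
        C * hausdorffOuter g.leafEDist ((d - 1 : ℕ) : ℝ) A := by
  obtain ⟨C₁, hC₁0, hC₁⟩ := g.exists_edist_le_mul_leafEDist hr hR0 hR hK
  set B : ℝ≥0∞ := ENNReal.ofReal (2 ^ d * (L + 3)) * volume (Metric.ball (0 : Model d) 1) with hB
  have hBtop : B ≠ ∞ := ENNReal.mul_ne_top ENNReal.ofReal_ne_top measure_ball_lt_top.ne
  have hB0 : B ≠ 0 := mul_ne_zero (by
    rw [Ne, ENNReal.ofReal_eq_zero, not_le]; positivity)
    (Metric.measure_ball_pos volume _ one_pos).ne'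
  set C : ℝ≥0∞ := B * (C₁ : ℝ≥0∞) ^ (d - 1) with hC
  have hCtop : C ≠ ∞ := ENNReal.mul_ne_top hBtop (ENNReal.pow_ne_top ENNReal.coe_ne_top)
  have hC0 : C ≠ 0 := mul_ne_zero hB0 (pow_ne_zero _ (ENNReal.coe_ne_zero.2 hC₁0))
  refine ⟨C, hCtop, fun y hy v hv A => ?_⟩
  -- Sets of leafwise diameter at most ε have Euclidean diameter at most 1/2 in the ball, below the
  -- threshold 1 of the tube estimate.
  set ε : ℝ≥0∞ := (C₁ : ℝ≥0∞)⁻¹ / 2 with hε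
  have hε0 : 0 < ε := ENNReal.div_pos (by simp) (by simp)
  have hCε : C₁ * ε < 1 := by
    rw [hε, ← mul_div_assoc, ENNReal.mul_inv_cancel (ENNReal.coe_ne_zero.2 hC₁0)
      ENNReal.coe_ne_top]
    simp
  -- The volume of the tube over a set is itself an outer measure. By the maximality of
  -- `OuterMeasure.boundedBy`, it suffices to compare on sets of diameter at most ε.
  have key : tubeOuter (𝒜.plaqueMap ⟨i, y⟩) (Metric.closedBall 0 R) v ≤ C •
      OuterMeasure.boundedBy fun S => ⨅ _ : ediamOf g.leafEDist S ≤ ε,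
        ediamOf g.leafEDist S ^ ((d - 1 : ℕ) : ℝ) := by
    rw [OuterMeasure.smul_boundedBy hCtop, OuterMeasure.le_boundedBy]
    intro S
    simp only [Pi.smul_apply, smul_eq_mul, ENNReal.mul_iInf_of_ne hC0 hCtop]
    refine le_iInf fun hS => ?_
    rw [ENNReal.rpow_natCast, hC, mul_assoc, ← mul_pow]
    refine volume_tube_le hd ?_ hv fun x hx x' hx' => ?_
    · exact (mul_le_mul_right hS _).trans_lt hCε
    · refine (hC₁ y hy x hx.1 x' hx'.1).trans ?_
      gcongr
      exact le_iSup₂_of_le _ hx.2 (le_iSup₂_of_le _ hx'.2 le_rfl)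
  refine (key A).trans ?_
  rw [smul_apply, smul_eq_mul]
  gcongr
  exact (le_iSup₂_of_le (f := fun (ε : ℝ≥0∞) (_ : 0 < ε) => OuterMeasure.boundedBy fun S =>
    ⨅ _ : ediamOf g.leafEDist S ≤ ε, ediamOf g.leafEDist S ^ ((d - 1 : ℕ) : ℝ)) ε hε0 le_rfl)

/-- A relative isoperimetric inequality in the plaques. -/
lemma exists_volume_mul_volume_le (hd : 1 ≤ d) (hr : 1 ≤ r) {i : ι} {R : ℝ} (hR0 : 0 < R)
    (hR : R < 𝒜.radius i) {K : Set (T i)} (hK : IsCompact K) :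
    ∃ C : ℝ≥0∞, C ≠ ∞ ∧ ∀ y ∈ K, ∀ V : Set M,
      MeasurableSet (Metric.closedBall 0 R ∩ 𝒜.plaqueMap ⟨i, y⟩ ⁻¹' V) →
      volume (Metric.closedBall 0 R ∩ 𝒜.plaqueMap ⟨i, y⟩ ⁻¹' V) *
        volume (Metric.closedBall 0 R \ 𝒜.plaqueMap ⟨i, y⟩ ⁻¹' V) ≤
        C * hausdorffOuter g.leafEDist ((d - 1 : ℕ) : ℝ)
          (𝒜.leafBoundary V ∩ 𝒜.plaqueMap ⟨i, y⟩ '' Metric.closedBall 0 R) := by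
  obtain ⟨C, hC, hle⟩ := g.exists_volume_tube_le hd hr hR0 hR hK (2 * R) (by positivity)
  refine ⟨volume (Metric.closedBall (0 : Model d) (2 * R)) * C,
    ENNReal.mul_ne_top measure_closedBall_lt_top.ne hC, fun y hy V hV => ?_⟩
  set Q := Metric.closedBall (0 : Model d) R with hQ
  have hQd : Q ⊆ 𝒜.disc i := Metric.closedBall_subset_ball hR
  have hB : MeasurableSet (Q \ 𝒜.plaqueMap ⟨i, y⟩ ⁻¹' V) := by
    rw [← sdiff_inter_self_eq_sdiff, inter_comm]
    exact Metric.isClosed_closedBall.measurableSet.diff hV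
  rw [measure_mul_measure_eq_lintegral hV hB]
  set H := hausdorffOuter g.leafEDist ((d - 1 : ℕ) : ℝ)
          (𝒜.leafBoundary V ∩ 𝒜.plaqueMap ⟨i, y⟩ '' Q) with hH
  have hbound : ∀ v, volume {x | x ∈ Q ∩ 𝒜.plaqueMap ⟨i, y⟩ ⁻¹' V ∧
      x + v ∈ Q \ 𝒜.plaqueMap ⟨i, y⟩ ⁻¹' V} ≤
      (Metric.closedBall (0 : Model d) (2 * R)).indicator (fun _ => C * H) v := by
    intro v
    by_cases hv : v ∈ Metric.closedBall (0 : Model d) (2 * R)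
    · rw [indicator_of_mem hv]
      -- A crossing point has the form x + t v, so x is reached from the boundary in the direction
      -- `-v`.
      refine (measure_mono ?_).trans (hle y hy (-v)
        (by rw [norm_neg]; exact mem_closedBall_zero_iff.1 hv) _)
      rintro x ⟨⟨hxQ, hxV⟩, hx'Q, hx'V⟩
      have hseg : segment ℝ x (x + v) ⊆ Q := (convex_closedBall _ _).segment_subset hxQ hx'Q
      -- Connectedness is used in the leaf topology, because the boundary of `V` is taken there.
      have hpre : @IsPreconnected M 𝒜.leafTopology (𝒜.plaqueMap ⟨i, y⟩ '' segment ℝ x (x + v)) :=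
        @IsPreconnected.image _ _ _ 𝒜.leafTopology _ (convex_segment x (x + v)).isPreconnected _
          (@ContinuousOn.mono _ _ _ 𝒜.leafTopology _ _ _
            (𝒜.continuousOn_plaqueMap_leafTopology ⟨i, y⟩) (hseg.trans hQd))
      obtain ⟨p, ⟨x₁, hx₁, rfl⟩, hp⟩ := @IsPreconnected.inter_frontier_nonempty M 𝒜.leafTopology
        _ V hpre ⟨_, ⟨x, left_mem_segment ℝ _ _, rfl⟩, hxV⟩
          ⟨_, ⟨x + v, right_mem_segment ℝ _ _, rfl⟩, hx'V⟩
      rw [segment_eq_image'] at hx₁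
      obtain ⟨t, ht, rfl⟩ := hx₁
      have hmem : x + t • (x + v - x) ∈ Q := hseg (by
        rw [segment_eq_image']; exact ⟨t, ht, rfl⟩)
      refine ⟨x + t • (x + v - x), ⟨hmem, hp, _, hmem, rfl⟩, t, ht, ?_⟩
      module
    · rw [indicator_of_notMem hv, nonpos_iff_eq_zero]
      convert measure_empty (μ := (volume : Measure (Model d)))
      refine eq_empty_of_forall_notMem ?_
      rintro x ⟨⟨hxQ, -⟩, hx'Q, -⟩
      refine hv (mem_closedBall_zero_iff.2 ?_)
      have e : v = (x + v) - x := by abel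
      rw [e]
      refine (norm_sub_le _ _).trans ?_
      have h1 := mem_closedBall_zero_iff.1 hxQ
      have h2 := mem_closedBall_zero_iff.1 hx'Q
      linarith
  refine (lintegral_mono hbound).trans ?_
  rw [lintegral_indicator Metric.isClosed_closedBall.measurableSet, setLIntegral_const,
    mul_comm, ← mul_assoc]

end LeafwiseMetric

/-! ### Measurability on plaques and leaves -/

/-- Only the pieces `A s` need to be measurable. Thus no measurability of `w` or `S` for the
Carathéodory σ-algebra of the Hausdorff measure is required in the area estimate. -/
lemma tsum_mul_measure_le_lintegral {X α : Type*} {_ : MeasurableSpace X} [Countable α]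
    (m : Measure X) {S : Set X} {w : X → ℝ≥0∞} {A : α → Set X} {a : α → ℝ≥0∞}
    (hA : ∀ s, MeasurableSet (A s)) (hd : Pairwise (Function.onFun Disjoint A))
    (hS : ∀ s, A s ⊆ S) (hw : ∀ s, ∀ p ∈ A s, a s ≤ w p) :
    ∑' s, a s * m (A s) ≤ ∫⁻ p, S.indicator w p ∂m := by
  calc ∑' s, a s * m (A s) ≤ ∑' s, ∫⁻ p in A s, S.indicator w p ∂m := by
        refine ENNReal.tsum_le_tsum fun s => ?_
        rw [← setLIntegral_const]
        refine setLIntegral_mono' (hA s) fun p hp => ?_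
        rw [indicator_of_mem (hS s hp)]
        exact hw s p hp
    _ = ∫⁻ p in ⋃ s, A s, S.indicator w p ∂m := (lintegral_iUnion hA hd _).symm
    _ ≤ _ := setLIntegral_le_lintegral _ _

lemma measurable_indicator_iUnion {X α : Type*} [MeasurableSpace X] [Countable α] {A : α → Set X}
    (hA : ∀ s, MeasurableSet (A s)) {f : X → ℝ≥0∞} {w : α → X → ℝ≥0∞}
    (hw : ∀ s, Measurable (w s)) (hfw : ∀ s, ∀ p ∈ A s, f p = w s p) :
    Measurable ((⋃ s, A s).indicator f) := by
  intro B hB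
  have e : (⋃ s, A s).indicator f ⁻¹' B =
      (⋃ s, A s ∩ w s ⁻¹' B) ∪ ((⋃ s, A s)ᶜ ∩ {_p | (0 : ℝ≥0∞) ∈ B}) := by
    ext p
    by_cases hp : p ∈ ⋃ s, A s
    · simp only [mem_preimage, indicator_of_mem hp, mem_union, mem_inter_iff,
        mem_compl_iff, hp, not_true_eq_false, false_and, or_false]
      obtain ⟨s, hs⟩ := mem_iUnion.1 hp
      rw [mem_iUnion]
      constructor
      · exact fun h' => ⟨s, hs, by rwa [mem_preimage, ← hfw s p hs]⟩
      · rintro ⟨s', hs', h'⟩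
        rwa [hfw s' p hs']
    · have : ∀ s, p ∉ A s := fun s hs => hp (mem_iUnion.2 ⟨s, hs⟩)
      simp [indicator, this]
  rw [e]
  exact (MeasurableSet.iUnion fun s => (hA s).inter (hw s hB)).union
    ((MeasurableSet.iUnion hA).compl.inter (MeasurableSet.const _))

namespace FoliatedAtlas

variable {M : Type*} [TopologicalSpace M] {d : ℕ} {r : ℕ∞} {ι : Type*} {T : ι → Type*}
  [∀ i, TopologicalSpace (T i)] (𝒜 : FoliatedAtlas M d r T)

lemma mem_plaque_iff {s : Σ i, T i} {p : M} :
    p ∈ 𝒜.plaque s ↔ p ∈ (𝒜.chart s.1).source ∧ (𝒜.chart s.1 p).2 = s.2 := by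
  constructor
  · rintro ⟨x, hx, rfl⟩
    exact ⟨𝒜.plaqueMap_mem_source hx, by rw [𝒜.chart_plaqueMap hx]⟩
  · rintro ⟨h1, h2⟩
    refine ⟨(𝒜.chart s.1 p).1, 𝒜.chart_fst_mem_disc h1, ?_⟩
    have := 𝒜.plaqueMap_chart h1
    rwa [h2] at this

lemma leaf_eq_iUnion_plaque (t : Σ i, T i) :
    𝒜.leaf t = ⋃ s : {s // 𝒜.Rel t s}, 𝒜.plaque s.1 := by
  ext p
  rw [mem_iUnion]
  constructor
  · rintro ⟨i, hi, h⟩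
    exact ⟨⟨_, h⟩, 𝒜.mem_plaque_iff.2 ⟨hi, rfl⟩⟩
  · rintro ⟨s, x, hx, rfl⟩
    exact 𝒜.plaqueMap_mem_leaf s.2 hx

variable [MeasurableSpace M] [BorelSpace M]

lemma measurable_ite_chart {Z : Type*} [TopologicalSpace Z] [MeasurableSpace Z] [BorelSpace Z]
    {i : ι} {f : Model d × T i → Z} (hf : ContinuousOn f (𝒜.chart i).target) (c : Z)
    [DecidablePred fun p => p ∈ (𝒜.chart i).source] :
    Measurable fun p => if p ∈ (𝒜.chart i).source then f (𝒜.chart i p) else c := by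
  have h : ContinuousOn (fun p => f (𝒜.chart i p)) (𝒜.chart i).source :=
    hf.comp (𝒜.chart i).continuousOn fun p hp => (𝒜.chart i).map_source hp
  exact h.measurable_piecewise continuousOn_const (𝒜.chart i).open_source.measurableSet

variable [∀ i, T2Space (T i)]

lemma measurableSet_plaque (s : Σ i, T i) : MeasurableSet (𝒜.plaque s) := by
  have h : IsOpen ((𝒜.chart s.1).source ∩ (fun p => (𝒜.chart s.1 p).2) ⁻¹' {s.2}ᶜ) :=
    (continuous_snd.comp_continuousOn (𝒜.chart s.1).continuousOn).isOpen_inter_preimage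
      (𝒜.chart s.1).open_source isOpen_compl_singleton
  have e : 𝒜.plaque s = (𝒜.chart s.1).source \
      ((𝒜.chart s.1).source ∩ (fun p => (𝒜.chart s.1 p).2) ⁻¹' {s.2}ᶜ) := by
    ext p
    rw [mem_plaque_iff]
    simp only [Set.mem_sdiff, mem_inter_iff, mem_preimage, mem_compl_iff, mem_singleton_iff]
    tauto
  rw [e]
  exact (𝒜.chart s.1).open_source.measurableSet.diff h.measurableSet

lemma measurableSet_leaf [Countable ι] (t : Σ i, T i) : MeasurableSet (𝒜.leaf t) := by
  have : Countable {s // 𝒜.Rel t s} := (𝒜.countable_setOf_rel t).to_subtype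
  rw [leaf_eq_iUnion_plaque]
  exact MeasurableSet.iUnion fun s => 𝒜.measurableSet_plaque s.1

end FoliatedAtlas

/-! ### The weighted volume as a sum over plaques -/

namespace LeafwiseMetric

open FoliatedAtlas

variable {M : Type*} [TopologicalSpace M] {d : ℕ} {r : ℕ∞} {ι : Type*} {T : ι → Type*}
  [∀ i, TopologicalSpace (T i)] {𝒜 : FoliatedAtlas M d r T} (g : LeafwiseMetric 𝒜)

/-- The measure `(h / h(t)) dvol` on `V`. -/
def weightedVolume [MeasurableSpace M] (ρ : PartitionOfUnity ι M) (h : M → ℝ)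
    (t : Σ i, T i) (V : Set M) : Measure M :=
  ((g.leafVolume ρ t).restrict V).withDensity (weight 𝒜 h t)

lemma weightedVolume_univ [MeasurableSpace M] {ρ : PartitionOfUnity ι M} (h : M → ℝ)
    (t : Σ i, T i) (V : Set M) :
    g.weightedVolume ρ h t V univ = g.modifiedVolume ρ h t V := by
  rw [weightedVolume, withDensity_apply _ MeasurableSet.univ, Measure.restrict_univ,
    modifiedVolume]

variable [Fintype ι] {ρ : PartitionOfUnity ι M} {δ : (Σ i, T i) → (Σ i, T i) → ℝ}

/-- The factor between the normalized density on the leaf through `t` and the explicit one on the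
plaque through `s`. -/
def plaqueWeight (𝒜 : FoliatedAtlas M d r T) (ρ : PartitionOfUnity ι M)
    (δ : (Σ i, T i) → (Σ i, T i) → ℝ) (h : M → ℝ) (t s : Σ i, T i) : ℝ≥0∞ :=
  ENNReal.ofReal (h (𝒜.base s) / 𝒜.primitive ρ δ s.1 (0, s.2) / h (𝒜.base t))

/-- The product of the explicit density and the Riemannian density, in the coordinates of the
chart `i`. -/
def totalDensity (ρ : PartitionOfUnity ι M) (δ : (Σ i, T i) → (Σ i, T i) → ℝ) (i : ι)
    (z : Model d × T i) : ℝ :=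
  𝒜.primitive ρ δ i z * g.volDensity i z

lemma totalDensity_pos {i : ι} {z : Model d × T i} (hz : z ∈ (𝒜.chart i).target) :
    0 < g.totalDensity ρ δ i z :=
  mul_pos (primitive_pos i z) (g.volDensity_pos hz)

lemma continuousOn_totalDensity (hδ : 𝒜.IsContinuousCocycle δ)
    (hρ : ρ.IsSubordinate fun i => (𝒜.chart i).source)
    (hρr : ∀ i, 𝒜.TangentiallyContDiff r (ρ i)) (i : ι) :
    ContinuousOn (g.totalDensity ρ δ i) (𝒜.chart i).target :=
  (continuousOn_primitive hδ hρ hρr i).mul (g.continuousOn_volDensity i)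

lemma plaqueWeight_ne_top (h : M → ℝ) (t s : Σ i, T i) : plaqueWeight 𝒜 ρ δ h t s ≠ ∞ :=
  ENNReal.ofReal_ne_top

lemma plaqueWeight_ne_zero {h : M → ℝ} {t s : Σ i, T i}
    (hh : 𝒜.IsPrimitiveOn (𝒜.modularForm ρ δ) h (𝒜.leaf t)) (hs : 𝒜.Rel t s) :
    plaqueWeight 𝒜 ρ δ h t s ≠ 0 := by
  have h1 := hh.1 _ (𝒜.plaqueMap_mem_leaf hs (𝒜.zero_mem_disc s.1))
  have h2 := hh.1 _ (𝒜.base_mem_leaf t)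
  rw [plaqueWeight, Ne, ENNReal.ofReal_eq_zero, not_le]
  exact div_pos (div_pos h1 (primitive_pos _ _)) h2

lemma weight_plaqueMap (hr : 1 ≤ r) (hρ : ρ.IsSubordinate fun i => (𝒜.chart i).source)
    (hρr : ∀ i, 𝒜.TangentiallyContDiff r (ρ i)) {h : M → ℝ} {t s : Σ i, T i}
    (hh : 𝒜.IsPrimitiveOn (𝒜.modularForm ρ δ) h (𝒜.leaf t)) (hs : 𝒜.Rel t s) {x : Model d}
    (hx : x ∈ 𝒜.disc s.1) :
    weight 𝒜 h t (𝒜.plaqueMap s x) =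
      plaqueWeight 𝒜 ρ δ h t s * ENNReal.ofReal (𝒜.primitive ρ δ s.1 (x, s.2)) := by
  rw [weight, plaqueWeight, hh.eq_mul_primitive hr hρ hρr hs hx,
    ← ENNReal.ofReal_mul' (primitive_pos _ _).le]
  congr 1
  ring

section Measure

variable [MeasurableSpace M] [BorelSpace M]

lemma exists_measurable_eq_weight (hr : 1 ≤ r) (hδ : 𝒜.IsContinuousCocycle δ)
    (hρ : ρ.IsSubordinate fun i => (𝒜.chart i).source)
    (hρr : ∀ i, 𝒜.TangentiallyContDiff r (ρ i)) {h : M → ℝ} {t s : Σ i, T i}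
    (hh : 𝒜.IsPrimitiveOn (𝒜.modularForm ρ δ) h (𝒜.leaf t)) (hs : 𝒜.Rel t s) :
    ∃ w : M → ℝ≥0∞, Measurable w ∧ ∀ p ∈ 𝒜.plaque s, weight 𝒜 h t p = w p := by
  classical
  have hm := 𝒜.measurable_ite_chart (f := fun z => ENNReal.ofReal (𝒜.primitive ρ δ s.1 z))
      (ENNReal.continuous_ofReal.comp_continuousOn (continuousOn_primitive hδ hρ hρr s.1)) 0
  refine ⟨_, hm.const_mul (plaqueWeight 𝒜 ρ δ h t s), ?_⟩
  rintro _ ⟨x, hx, rfl⟩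
  rw [weight_plaqueMap hr hρ hρr hh hs hx, if_pos (𝒜.plaqueMap_mem_source hx),
    𝒜.chart_plaqueMap hx]

variable [∀ i, T2Space (T i)]

lemma measurable_indicator_weight (hr : 1 ≤ r) (hδ : 𝒜.IsContinuousCocycle δ)
    (hρ : ρ.IsSubordinate fun i => (𝒜.chart i).source)
    (hρr : ∀ i, 𝒜.TangentiallyContDiff r (ρ i)) {h : M → ℝ} {t : Σ i, T i}
    (hh : 𝒜.IsPrimitiveOn (𝒜.modularForm ρ δ) h (𝒜.leaf t)) :
    Measurable ((𝒜.leaf t).indicator (weight 𝒜 h t)) := by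
  have : Countable {s // 𝒜.Rel t s} := (𝒜.countable_setOf_rel t).to_subtype
  have hex : ∀ s : {s // 𝒜.Rel t s}, ∃ w : M → ℝ≥0∞, Measurable w ∧
      ∀ p ∈ 𝒜.plaque s.1, weight 𝒜 h t p = w p := by
    intro s
    exact exists_measurable_eq_weight hr hδ hρ hρr hh s.2
  choose w hw hww using hex
  have := measurable_indicator_iUnion (A := fun s : {s // 𝒜.Rel t s} => 𝒜.plaque s.1)
    (fun s => 𝒜.measurableSet_plaque s.1) hw hww
  rw [𝒜.leaf_eq_iUnion_plaque t]
  exact this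

lemma leafVolume_compl_leaf (t : Σ i, T i) : g.leafVolume ρ t (𝒜.leaf t)ᶜ = 0 := by
  have hm := (𝒜.measurableSet_leaf t).compl
  rw [← lintegral_indicator_one hm, g.lintegral_leafVolume_eq_tsum ρ t
    (measurable_one.indicator hm), ENNReal.tsum_eq_zero]
  intro s
  rw [setLIntegral_congr_fun (g := fun _ => 0) (𝒜.isOpen_disc s.1.1).measurableSet, lintegral_zero]
  intro x hx
  simp only
  rw [indicator_of_notMem (by simpa using 𝒜.plaqueMap_mem_leaf s.2 hx)]
  simp

/-- In the chart `i`, the weighted volume is a sum over the plaques. -/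
lemma lintegral_weightedVolume (hr : 1 ≤ r) (hδ : 𝒜.IsContinuousCocycle δ)
    (hρ : ρ.IsSubordinate fun i => (𝒜.chart i).source)
    (hρr : ∀ i, 𝒜.TangentiallyContDiff r (ρ i)) {h : M → ℝ} {t : Σ i, T i}
    (hh : 𝒜.IsPrimitiveOn (𝒜.modularForm ρ δ) h (𝒜.leaf t)) {V : Set M} (hV : MeasurableSet V)
    (i : ι) {f : M → ℝ≥0∞} (hf : Measurable f) (hfi : ∀ p ∉ (𝒜.chart i).source, f p = 0) :
    ∫⁻ p, f p ∂(g.weightedVolume ρ h t V) = ∑' s : {s : T i // 𝒜.Rel t ⟨i, s⟩},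
      plaqueWeight 𝒜 ρ δ h t ⟨i, s⟩ * ∫⁻ x in 𝒜.disc i,
        ENNReal.ofReal (g.totalDensity ρ δ i (x, s.1)) *
          V.indicator f (𝒜.plaqueMap ⟨i, s.1⟩ x) := by
  have hwm := measurable_indicator_weight hr hδ hρ hρr hh
  -- The function `h` is controlled on the leaf only, so the weight is replaced by its measurable
  -- truncation to the leaf, which carries the volume.
  have hae : weight 𝒜 h t =ᵐ[(g.leafVolume ρ t).restrict V]
      (𝒜.leaf t).indicator (weight 𝒜 h t) := by
    refine ae_restrict_of_ae ?_
    have := measure_eq_zero_iff_ae_notMem.1 (g.leafVolume_compl_leaf (ρ := ρ) t)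
    filter_upwards [this] with p hp
    rw [indicator_of_mem (by simpa using hp)]
  rw [weightedVolume, withDensity_congr_ae hae, lintegral_withDensity_eq_lintegral_mul _ hwm hf,
    ← lintegral_indicator hV, g.lintegral_leafVolume hr hρ t i ((hwm.mul hf).indicator hV)
      (fun p hp => by simp [indicator, hfi p hp])]
  refine tsum_congr fun s => ?_
  rw [← lintegral_const_mul' _ _ (plaqueWeight_ne_top _ _ _)]
  refine setLIntegral_congr_fun (𝒜.isOpen_disc i).measurableSet fun x hx => ?_
  by_cases hxV : 𝒜.plaqueMap ⟨i, s.1⟩ x ∈ V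
  · rw [indicator_of_mem hxV, indicator_of_mem hxV, Pi.mul_apply,
      indicator_of_mem (𝒜.plaqueMap_mem_leaf s.2 hx),
      weight_plaqueMap (s := ⟨i, s.1⟩) hr hρ hρr hh s.2 hx, totalDensity,
      ENNReal.ofReal_mul (primitive_pos _ _).le]
    ring
  · simp [indicator_of_notMem hxV]

end Measure

end LeafwiseMetric

/-! ### Finiteness and positivity of the modified volume; the area estimate -/

namespace LeafwiseMetric

open FoliatedAtlas

variable {M : Type*} [TopologicalSpace M] {d : ℕ} {r : ℕ∞} {ι : Type*} {T : ι → Type*}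
  [∀ i, TopologicalSpace (T i)] {𝒜 : FoliatedAtlas M d r T} (g : LeafwiseMetric 𝒜)

lemma measurableSet_of_isCompactDomain [MeasurableSpace M] [BorelSpace M] [T2Space M]
    {t : Σ i, T i} {V : Set M} (hV : 𝒜.IsCompactDomain t V) :
    MeasurableSet V :=
  (𝒜.isCompact_of_isCompact_leafTopology hV.2.2.1).isClosed.measurableSet

variable [Fintype ι] {ρ : PartitionOfUnity ι M} {δ : (Σ i, T i) → (Σ i, T i) → ℝ}

lemma continuousOn_totalDensity_slice (hδ : 𝒜.IsContinuousCocycle δ)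
    (hρ : ρ.IsSubordinate fun i => (𝒜.chart i).source)
    (hρr : ∀ i, 𝒜.TangentiallyContDiff r (ρ i)) (i : ι) (y : T i) :
    ContinuousOn (fun x => g.totalDensity ρ δ i (x, y)) (𝒜.disc i) :=
  (g.continuousOn_totalDensity hδ hρ hρr i).comp (f := fun x : Model d => (x, y)) (by fun_prop)
    fun _ hx => 𝒜.mem_target.2 hx

section Measure

variable [MeasurableSpace M] [BorelSpace M] [T2Space M] [∀ i, T2Space (T i)]

/-- Plaques of one chart are disjoint, so a single term of the sum survives; its density is
continuous on the compact set `Q`. -/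
lemma weightedVolume_plaque_lt_top (hr : 1 ≤ r) (hδ : 𝒜.IsContinuousCocycle δ)
    (hρ : ρ.IsSubordinate fun i => (𝒜.chart i).source)
    (hρr : ∀ i, 𝒜.TangentiallyContDiff r (ρ i)) {h : M → ℝ} {t : Σ i, T i}
    (hh : 𝒜.IsPrimitiveOn (𝒜.modularForm ρ δ) h (𝒜.leaf t)) {V : Set M} (hV : MeasurableSet V)
    {i : ι} (y : T i) {Q : Set (Model d)} (hQ : IsCompact Q) (hQd : Q ⊆ 𝒜.disc i) :
    g.weightedVolume ρ h t V (𝒜.plaqueMap ⟨i, y⟩ '' Q) < ∞ := by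
  classical
  have hB : IsCompact (𝒜.plaqueMap ⟨i, y⟩ '' Q) :=
    hQ.image_of_continuousOn ((𝒜.continuousOn_plaqueMap ⟨i, y⟩).mono hQd)
  have hBm := hB.isClosed.measurableSet
  have hBi : ∀ p ∉ (𝒜.chart i).source,
      (𝒜.plaqueMap ⟨i, y⟩ '' Q).indicator (1 : M → ℝ≥0∞) p = 0 := by
    intro p hp
    refine indicator_of_notMem ?_ _
    rintro ⟨x, hx, rfl⟩
    exact hp (𝒜.plaqueMap_mem_source (s := ⟨i, y⟩) (hQd hx))
  rw [← lintegral_indicator_one hBm, g.lintegral_weightedVolume hr hδ hρ hρr hh hV i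
    (measurable_one.indicator hBm) hBi]
  have hfin : ∫⁻ x in Q, ENNReal.ofReal (g.totalDensity ρ δ i (x, y)) < ∞ := by
    have hcont := (g.continuousOn_totalDensity_slice hδ hρ hρr i y).mono hQd
    have hint : IntegrableOn (fun x => g.totalDensity ρ δ i (x, y)) Q volume :=
      hcont.integrableOn_compact hQ
    exact Integrable.lintegral_lt_top hint
  have hterm : ∀ s : {s : T i // 𝒜.Rel t ⟨i, s⟩}, (∫⁻ x in 𝒜.disc i,
      ENNReal.ofReal (g.totalDensity ρ δ i (x, s.1)) * V.indicator
        ((𝒜.plaqueMap ⟨i, y⟩ '' Q).indicator 1) (𝒜.plaqueMap ⟨i, s.1⟩ x)) ≤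
      if s.1 = y then ∫⁻ x in Q, ENNReal.ofReal (g.totalDensity ρ δ i (x, y)) else 0 := by
    intro s
    have hle : ∀ x ∈ 𝒜.disc i, V.indicator ((𝒜.plaqueMap ⟨i, y⟩ '' Q).indicator (1 : M → ℝ≥0∞))
        (𝒜.plaqueMap ⟨i, s.1⟩ x) ≠ 0 → s.1 = y ∧ x ∈ Q := by
      intro x hx hne
      have h1 : 𝒜.plaqueMap ⟨i, s.1⟩ x ∈ 𝒜.plaqueMap ⟨i, y⟩ '' Q := by
        by_contra hn
        apply hne
        by_cases hv : 𝒜.plaqueMap ⟨i, s.1⟩ x ∈ V <;> simp [indicator, hn]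
      obtain ⟨x', hx', he⟩ := h1
      have := congrArg (𝒜.chart i) he
      rw [𝒜.chart_plaqueMap (s := ⟨i, y⟩) (hQd hx'), 𝒜.chart_plaqueMap (s := ⟨i, s.1⟩) hx] at this
      obtain ⟨h2, h3⟩ := Prod.ext_iff.1 this
      exact ⟨h3.symm, by rw [← show x' = x from h2]; exact hx'⟩
    have hle1 : ∀ p, V.indicator ((𝒜.plaqueMap ⟨i, y⟩ '' Q).indicator (1 : M → ℝ≥0∞)) p ≤ 1 := by
      intro p
      refine indicator_le' (fun p _ => indicator_le' (fun _ _ => le_rfl) (fun _ _ => zero_le) p)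
        (fun _ _ => zero_le) p
    split_ifs with hs
    · rw [← lintegral_indicator (𝒜.isOpen_disc i).measurableSet,
        ← lintegral_indicator hQ.isClosed.measurableSet]
      refine lintegral_mono fun x => ?_
      by_cases hx : x ∈ 𝒜.disc i
      · rw [indicator_of_mem hx]
        by_cases hxQ : x ∈ Q
        · rw [indicator_of_mem hxQ, hs]
          exact (mul_le_mul_right (hle1 _) _).trans (mul_one _).le
        · rw [not_not.1 (mt (hle x hx) fun h => hxQ h.2), mul_zero]
          exact zero_le
      · rw [indicator_of_notMem hx]
        exact zero_le
    · rw [nonpos_iff_eq_zero, setLIntegral_congr_fun (g := fun _ => 0)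
        (𝒜.isOpen_disc i).measurableSet, lintegral_zero]
      intro x hx
      simp only
      rw [not_not.1 (mt (hle x hx) fun h => hs h.1), mul_zero]
  by_cases hy : 𝒜.Rel t ⟨i, y⟩
  · rw [tsum_eq_single ⟨y, hy⟩]
    · have := hterm ⟨y, hy⟩
      rw [if_pos rfl] at this
      exact ENNReal.mul_lt_top (lt_top_iff_ne_top.2 (plaqueWeight_ne_top _ _ _))
        (this.trans_lt hfin)
    · intro s hs
      have := hterm s
      rw [if_neg fun h => hs (Subtype.ext h), nonpos_iff_eq_zero] at this
      rw [this, mul_zero]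
  · rw [ENNReal.tsum_eq_zero.2]
    · exact ENNReal.zero_lt_top
    · intro s
      have := hterm s
      rw [if_neg (fun h' => hy (by rw [← h']; exact s.2)), nonpos_iff_eq_zero] at this
      rw [this, mul_zero]

/-- Compactness in the leaf topology covers `V` by finitely many compact pieces of plaques.
Compactness in `M` alone would not suffice. -/
lemma modifiedVolume_ne_top (hr : 1 ≤ r) (hδ : 𝒜.IsContinuousCocycle δ)
    (hρ : ρ.IsSubordinate fun i => (𝒜.chart i).source)
    (hρr : ∀ i, 𝒜.TangentiallyContDiff r (ρ i)) {h : M → ℝ} {t : Σ i, T i}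
    (hh : 𝒜.IsPrimitiveOn (𝒜.modularForm ρ δ) h (𝒜.leaf t)) {V : Set M}
    (hV : 𝒜.IsCompactDomain t V) : g.modifiedVolume ρ h t V ≠ ∞ := by
  have hVm := measurableSet_of_isCompactDomain hV
  have hlt : g.weightedVolume ρ h t V V < ∞ := by
    refine @IsCompact.induction_on M 𝒜.leafTopology V hV.2.2.1
      (fun S => g.weightedVolume ρ h t V S < ∞) (by simp)
      (fun S S' hS h' => (measure_mono hS).trans_lt h')
      (fun S S' hS hS' => (measure_union_le _ _).trans_lt (ENNReal.add_lt_top.2 ⟨hS, hS'⟩)) ?_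
    intro p hp
    obtain ⟨i, hi⟩ := 𝒜.cover p
    obtain ⟨ε, hε, hεd⟩ := Metric.nhds_basis_closedBall.mem_iff.1
      ((𝒜.isOpen_disc i).mem_nhds (𝒜.chart_fst_mem_disc hi))
    refine ⟨𝒜.plaqueMap ⟨i, (𝒜.chart i p).2⟩ '' Metric.closedBall (𝒜.chart i p).1 ε, ?_,
      g.weightedVolume_plaque_lt_top hr hδ hρ hρr hh hVm _ (isCompact_closedBall _ _) hεd⟩
    refine @mem_nhdsWithin_of_mem_nhds M 𝒜.leafTopology _ _ _ ?_
    refine Filter.mem_of_superset (@IsOpen.mem_nhds M 𝒜.leafTopology p _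
      (𝒜.isOpen_leafTopology_image ⟨i, (𝒜.chart i p).2⟩ (Metric.isOpen_ball (x := (𝒜.chart i p).1)
        (ε := ε)) (Metric.ball_subset_closedBall.trans hεd)) ?_)
      (image_mono Metric.ball_subset_closedBall)
    exact ⟨_, Metric.mem_ball_self hε, 𝒜.plaqueMap_chart hi⟩
  have e : g.weightedVolume ρ h t V V = g.modifiedVolume ρ h t V := by
    rw [weightedVolume, withDensity_apply _ hVm, Measure.restrict_restrict hVm, inter_self,
      modifiedVolume]
  rw [← e]
  exact hlt.ne

/-- A nonempty closure of an interior has nonempty interior, hence contains a nonempty open piece of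
a plaque, where the density is positive. -/
lemma modifiedVolume_ne_zero (hr : 1 ≤ r) (hδ : 𝒜.IsContinuousCocycle δ)
    (hρ : ρ.IsSubordinate fun i => (𝒜.chart i).source)
    (hρr : ∀ i, 𝒜.TangentiallyContDiff r (ρ i)) {h : M → ℝ} {t : Σ i, T i}
    (hh : 𝒜.IsPrimitiveOn (𝒜.modularForm ρ δ) h (𝒜.leaf t)) {V : Set M}
    (hV : 𝒜.IsCompactDomain t V) : g.modifiedVolume ρ h t V ≠ 0 := by
  have hVm := measurableSet_of_isCompactDomain hV
  intro h0
  rw [← weightedVolume_univ, Measure.measure_univ_eq_zero] at h0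
  obtain ⟨hVl, hVne, -, hcl⟩ := hV
  obtain ⟨p, hp⟩ : (@interior M 𝒜.leafTopology V).Nonempty := by
    rw [nonempty_iff_ne_empty]
    intro he
    rw [he, @closure_empty M 𝒜.leafTopology] at hcl
    exact hVne.ne_empty hcl.symm
  obtain ⟨i, hi⟩ := 𝒜.cover p
  have hrel := rel_of_mem_leaf (hVl (@interior_subset M 𝒜.leafTopology _ _ hp)) hi
  have hopen := (𝒜.isOpen_leafTopology_iff.1 (@isOpen_interior M 𝒜.leafTopology V))
    ⟨i, (𝒜.chart i p).2⟩
  set O := {x | x ∈ 𝒜.disc i ∧ 𝒜.plaqueMap ⟨i, (𝒜.chart i p).2⟩ x ∈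
    @interior M 𝒜.leafTopology V} with hO
  have hOne : O.Nonempty := ⟨(𝒜.chart i p).1, 𝒜.chart_fst_mem_disc hi, by
    rw [𝒜.plaqueMap_chart hi]; exact hp⟩
  have hsm := (𝒜.chart i).open_source.measurableSet
  have hsum := g.lintegral_weightedVolume hr hδ hρ hρr hh hVm i
    (measurable_one.indicator hsm) (fun q hq => indicator_of_notMem hq _)
  rw [h0, lintegral_zero_measure] at hsum
  have hz := ENNReal.tsum_eq_zero.1 hsum.symm ⟨(𝒜.chart i p).2, hrel⟩
  rw [mul_eq_zero, or_iff_right (plaqueWeight_ne_zero hh hrel)] at hz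
  have hz2 : ∫⁻ x in O, ENNReal.ofReal (g.totalDensity ρ δ i (x, (𝒜.chart i p).2)) = 0 := by
    rw [← nonpos_iff_eq_zero, ← hz]
    refine le_trans ?_ (lintegral_mono_set (s := O) fun x hx => hx.1)
    refine setLIntegral_mono' hopen.measurableSet fun x hx => ?_
    rw [indicator_of_mem (@interior_subset M 𝒜.leafTopology _ _ hx.2),
      indicator_of_mem (𝒜.plaqueMap_mem_source (s := ⟨i, (𝒜.chart i p).2⟩) hx.1), Pi.one_apply,
      mul_one]
  rw [lintegral_eq_zero_iff' ((((g.continuousOn_totalDensity_slice hδ hρ hρr i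
    (𝒜.chart i p).2).mono fun x hx => hx.1).aemeasurable hopen.measurableSet).ennreal_ofReal)]
    at hz2
  have hz3 : ∀ᵐ x ∂(volume.restrict O), False := by
    filter_upwards [hz2, ae_restrict_mem hopen.measurableSet] with x hx hxO
    have := g.totalDensity_pos (ρ := ρ) (δ := δ) (z := (x, (𝒜.chart i p).2))
      (𝒜.mem_target.2 hxO.1)
    simp only [Pi.zero_apply, ENNReal.ofReal_eq_zero] at hx
    linarith
  rw [eventually_false_iff_eq_bot, ae_eq_bot, Measure.restrict_eq_zero] at hz3
  exact (hopen.measure_pos volume hOne).ne' hz3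

end Measure

/-- The sum over the plaques of the weighted Hausdorff measures of a leaf-closed set is bounded by
its modified area. -/
lemma exists_tsum_hausdorff_le [T2Space M] [∀ i, LocallyCompactSpace (T i)] [∀ i, T2Space (T i)]
    (hr : 1 ≤ r) (hδ : 𝒜.IsContinuousCocycle δ)
    (hρ : ρ.IsSubordinate fun i => (𝒜.chart i).source)
    (hρr : ∀ i, 𝒜.TangentiallyContDiff r (ρ i)) {i : ι} {Q : Set (Model d)} (hQ : IsCompact Q)
    (hQd : Q ⊆ 𝒜.disc i) {K : Set (T i)} (hK : IsCompact K) :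
    ∃ C : ℝ≥0∞, C ≠ ∞ ∧ ∀ (h : M → ℝ) (t : Σ i, T i),
      𝒜.IsPrimitiveOn (𝒜.modularForm ρ δ) h (𝒜.leaf t) → ∀ S : Set M,
      IsClosed[𝒜.leafTopology] S →
      ∑' s : {s : T i // s ∈ {s | 𝒜.Rel t ⟨i, s⟩} ∩ K}, plaqueWeight 𝒜 ρ δ h t ⟨i, s⟩ *
        hausdorffOuter g.leafEDist ((d - 1 : ℕ) : ℝ) (S ∩ 𝒜.plaqueMap ⟨i, s⟩ '' Q) ≤
        C * g.modifiedArea h t S := by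
  -- On the part of a plaque over `Q`, the weight is the plaque weight times the explicit density,
  -- so it is at least `c` times the plaque weight.
  obtain ⟨c, hc, hcle⟩ := (hQ.prod hK).exists_forall_le' (a := 0)
    ((continuousOn_primitive hδ hρ hρr i).mono fun z hz => 𝒜.mem_target.2 (hQd hz.1))
    fun z _ => primitive_pos i z
  set b : ℝ≥0∞ := volume (Metric.ball (0 : EuclideanSpace ℝ (Fin (d - 1))) (1 / 2)) with hb
  have hb0 : b ≠ 0 := (Metric.measure_ball_pos volume _ (by norm_num)).ne'
  have hbt : b ≠ ∞ := measure_ball_lt_top.ne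
  have hc0 : ENNReal.ofReal c ≠ 0 := by simpa using hc
  refine ⟨(b * ENNReal.ofReal c)⁻¹, ENNReal.inv_ne_top.2 (mul_ne_zero hb0 hc0),
    fun h t hh S hS => ?_⟩
  have hcount : Countable {s : T i // s ∈ {s | 𝒜.Rel t ⟨i, s⟩} ∩ K} := by
    have := (𝒜.countable_setOf_rel t).to_subtype
    refine Function.Injective.countable
      (f := fun s : {s : T i // s ∈ {s | 𝒜.Rel t ⟨i, s⟩} ∩ K} =>
        (⟨⟨i, s.1⟩, s.2.1⟩ : {s | 𝒜.Rel t s})) ?_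
    rintro ⟨a, ha⟩ ⟨b, hb⟩ h
    simpa using h
  have hmeas : ∀ s : {s : T i // s ∈ {s | 𝒜.Rel t ⟨i, s⟩} ∩ K},
      MeasurableSet[(hausdorffOuter g.leafEDist ((d - 1 : ℕ) : ℝ)).caratheodory]
        (S ∩ 𝒜.plaqueMap ⟨i, s⟩ '' Q) := by
    intro s
    refine g.measurableSet_caratheodory_of_isClosed hr _ (@IsClosed.inter M _ _ 𝒜.leafTopology hS
      (𝒜.isClosed_leafTopology_of_isClosed ?_))
    exact (hQ.image_of_continuousOn
      ((𝒜.continuousOn_plaqueMap ⟨i, s.1⟩).mono hQd)).isClosed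
  have hdisj : Pairwise (Function.onFun Disjoint
      fun s : {s : T i // s ∈ {s | 𝒜.Rel t ⟨i, s⟩} ∩ K} => S ∩ 𝒜.plaqueMap ⟨i, s.1⟩ '' Q) := by
    intro s s' hss
    refine disjoint_left.2 ?_
    rintro _ ⟨-, x, hx, rfl⟩ ⟨-, x', hx', he⟩
    have := congrArg (𝒜.chart i) he
    rw [𝒜.chart_plaqueMap (s := ⟨i, s.1⟩) (hQd hx),
      𝒜.chart_plaqueMap (s := ⟨i, s'.1⟩) (hQd hx')] at this
    exact hss (Subtype.ext (Prod.ext_iff.1 this).2.symm)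
  have key := @tsum_mul_measure_le_lintegral M _
    (hausdorffOuter g.leafEDist ((d - 1 : ℕ) : ℝ)).caratheodory hcount
    (@OuterMeasure.toMeasure M (hausdorffOuter g.leafEDist ((d - 1 : ℕ) : ℝ)).caratheodory
        (hausdorffOuter g.leafEDist ((d - 1 : ℕ) : ℝ)) le_rfl) S (weight 𝒜 h t)
    (fun s => S ∩ 𝒜.plaqueMap ⟨i, s.1⟩ '' Q)
    (fun s => plaqueWeight 𝒜 ρ δ h t ⟨i, s.1⟩ * ENNReal.ofReal c) hmeas hdisj
    (fun s => inter_subset_left) (by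
      rintro s _ ⟨-, x, hx, rfl⟩
      rw [weight_plaqueMap (s := ⟨i, s.1⟩) hr hρ hρr hh s.2.1 (hQd hx)]
      exact mul_le_mul_right (ENNReal.ofReal_le_ofReal (hcle (x, s.1) ⟨hx, s.2.2⟩)) _)
  rw [ENNReal.mul_inv (Or.inl hb0) (Or.inl hbt), modifiedArea, areaIntegral, ← hb]
  have e1 : ∀ x : ℝ≥0∞, b⁻¹ * (ENNReal.ofReal c)⁻¹ * (b * x) = (ENNReal.ofReal c)⁻¹ * x := by
    intro x
    calc b⁻¹ * (ENNReal.ofReal c)⁻¹ * (b * x) = b⁻¹ * b * ((ENNReal.ofReal c)⁻¹ * x) := by ring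
      _ = _ := by rw [ENNReal.inv_mul_cancel hb0 hbt, one_mul]
  rw [e1, ← ENNReal.div_eq_inv_mul, ENNReal.le_div_iff_mul_le (Or.inl hc0)
    (Or.inl ENNReal.ofReal_ne_top), ← ENNReal.tsum_mul_right]
  refine le_trans (ENNReal.tsum_le_tsum fun s => ?_) key
  -- The pieces are Carathéodory measurable, so on them the measure agrees with the outer measure.
  rw [@toMeasure_apply M (hausdorffOuter g.leafEDist ((d - 1 : ℕ) : ℝ)).caratheodory _ le_rfl _
    (hmeas s), mul_right_comm]

end LeafwiseMetric

lemma continuous_of_eq_zero_off_compact {X : Type*} [TopologicalSpace X] [T2Space X]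
    {U B : Set X} (hU : IsOpen U) (hB : IsCompact B) (hBU : B ⊆ U) {F : X → ℝ}
    (hF : ContinuousOn F U) (h0 : ∀ x ∉ B, F x = 0) : Continuous F := by
  rw [continuous_iff_continuousAt]
  intro x
  by_cases hx : x ∈ U
  · exact hF.continuousAt (hU.mem_nhds hx)
  · refine (continuousAt_const (y := (0 : ℝ))).congr ?_
    filter_upwards [hB.isClosed.isOpen_compl.mem_nhds fun h => hx (hBU h)] with x' hx'
    exact (h0 x' hx').symm

lemma setLIntegral_le_mul_measure_inter {X : Type*} [MeasurableSpace X] {m : Measure X}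
    {A Q : Set X} (hQ : MeasurableSet Q) {u : X → ℝ≥0∞} {b : ℝ≥0∞}
    (hu : ∀ x, u x ≤ b) (hu0 : ∀ x ∉ Q, u x = 0) : ∫⁻ x in A, u x ∂m ≤ b * m (Q ∩ A) := by
  calc ∫⁻ x in A, u x ∂m ≤ ∫⁻ x in A, Q.indicator (fun _ => b) x ∂m := by
        refine lintegral_mono fun x => ?_
        by_cases hx : x ∈ Q
        · rw [indicator_of_mem hx]; exact hu x
        · rw [hu0 x hx]; exact zero_le
    _ = b * m (Q ∩ A) := by
        rw [lintegral_indicator hQ, setLIntegral_const, Measure.restrict_apply hQ]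

/-- If neither `A` nor its complement is large, the mass of `u` on `A` is nearly
proportional to that of `v`. -/
lemma lintegral_mul_setLIntegral_le {X : Type*} [MeasurableSpace X] {m : Measure X}
    {A Q : Set X} (hA : MeasurableSet A) (hQ : MeasurableSet Q) {u v : X → ℝ≥0∞} {b c : ℝ≥0∞}
    (hu : ∀ x, u x ≤ b) (hu0 : ∀ x ∉ Q, u x = 0) (hv : ∀ x, v x ≤ c) (hv0 : ∀ x ∉ Q, v x = 0) :
    (∫⁻ x, v x ∂m) * ∫⁻ x in A, u x ∂m ≤ (∫⁻ x, u x ∂m) * (∫⁻ x in A, v x ∂m) +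
      b * c * (m (Q ∩ A) * m (Q ∩ Aᶜ)) := by
  have h1 := setLIntegral_le_mul_measure_inter (m := m) (A := A) hQ hu hu0
  have h2 := setLIntegral_le_mul_measure_inter (m := m) (A := Aᶜ) hQ hv hv0
  have h3 : ∫⁻ x in A, u x ∂m ≤ ∫⁻ x, u x ∂m := setLIntegral_le_lintegral _ _
  -- Split ∫ v between `A` and its complement. The part over `A` is bounded by means of ∫_A u ≤ ∫ u;
  -- the other gives the product of the two volumes.
  rw [← lintegral_add_compl v hA, add_mul, mul_comm (∫⁻ x in A, v x ∂m)]
  refine add_le_add (mul_le_mul_left h3 _) ?_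
  rw [mul_comm]
  refine (mul_le_mul' h1 h2).trans (le_of_eq (by ring))

/-! ### The spread of a function over the plaques -/

namespace LeafwiseMetric

open FoliatedAtlas

variable {M : Type*} [TopologicalSpace M] {d : ℕ} {r : ℕ∞} {ι : Type*} {T : ι → Type*}
  [∀ i, TopologicalSpace (T i)] {𝒜 : FoliatedAtlas M d r T} (g : LeafwiseMetric 𝒜)

/-- A compact set in the domain of a chart lies in the product of a smaller disc and a compact
set. -/
lemma exists_compact_prod {i : ι} {A : Set M} (hA : IsCompact A) (hAi : A ⊆ (𝒜.chart i).source)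
    {R₀ : ℝ} (hR₀ : R₀ < 𝒜.radius i) :
    ∃ R, R₀ ≤ R ∧ R < 𝒜.radius i ∧ ∃ K : Set (T i), IsCompact K ∧
      ∀ p ∈ A, (𝒜.chart i p).1 ∈ Metric.closedBall 0 R ∧ (𝒜.chart i p).2 ∈ K := by
  have hcont : ContinuousOn (fun p => 𝒜.radius i - ‖(𝒜.chart i p).1‖) A :=
    continuousOn_const.sub ((continuous_fst.comp_continuousOn
      ((𝒜.chart i).continuousOn.mono hAi)).norm)
  obtain ⟨c, hc, hle⟩ := hA.exists_forall_le' hcont (a := 0) fun p hp => by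
    have := 𝒜.chart_fst_mem_disc (hAi hp)
    rw [disc, mem_ball_zero_iff] at this
    linarith
  refine ⟨max R₀ (𝒜.radius i - c), le_max_left _ _, max_lt hR₀ (by linarith),
    (fun p => (𝒜.chart i p).2) '' A, hA.image_of_continuousOn
      (continuous_snd.comp_continuousOn ((𝒜.chart i).continuousOn.mono hAi)), fun p hp =>
      ⟨?_, p, hp, rfl⟩⟩
  rw [mem_closedBall_zero_iff]
  refine le_trans ?_ (le_max_right _ _)
  linarith [hle p hp]

/-- A fixed continuous function with compact support in the disc of the chart `i`. -/
def kernel (𝒜 : FoliatedAtlas M d r T) (i : ι) (x : Model d) : ℝ :=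
  max 0 (𝒜.radius i / 2 - ‖x‖)

lemma kernel_nonneg (i : ι) (x : Model d) : 0 ≤ kernel 𝒜 i x := le_max_left _ _

lemma continuous_kernel (i : ι) : Continuous (kernel 𝒜 i) := by
  unfold kernel; fun_prop

lemma kernel_le (i : ι) (x : Model d) : kernel 𝒜 i x ≤ 𝒜.radius i / 2 :=
  max_le (by linarith [𝒜.radius_pos i]) (by linarith [norm_nonneg x])

lemma kernel_eq_zero {i : ι} {x : Model d} (hx : x ∉ Metric.closedBall 0 (𝒜.radius i / 2)) :
    kernel 𝒜 i x = 0 := by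
  rw [mem_closedBall_zero_iff, not_le] at hx
  exact max_eq_left (by linarith)

lemma lintegral_kernel_ne_top (i : ι) : ∫⁻ x, ENNReal.ofReal (kernel 𝒜 i x) ≠ ∞ := by
  have h := setLIntegral_le_mul_measure_inter (m := volume) (A := univ)
    (Q := Metric.closedBall (0 : Model d) (𝒜.radius i / 2))
    Metric.isClosed_closedBall.measurableSet
    (fun x => ENNReal.ofReal_le_ofReal (kernel_le (𝒜 := 𝒜) i x))
    (fun x hx => by rw [kernel_eq_zero hx, ENNReal.ofReal_zero])
  rw [Measure.restrict_univ] at h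
  refine (h.trans_lt (ENNReal.mul_lt_top ENNReal.ofReal_lt_top ?_)).ne
  rw [inter_univ]
  exact measure_closedBall_lt_top

lemma lintegral_kernel_ne_zero (i : ι) : ∫⁻ x, ENNReal.ofReal (kernel 𝒜 i x) ≠ 0 := by
  intro h
  rw [lintegral_eq_zero_iff (continuous_kernel i).measurable.ennreal_ofReal] at h
  have hpos := 𝒜.radius_pos i
  have hz : volume (Metric.ball (0 : Model d) (𝒜.radius i / 2)) = 0 := by
    refine measure_mono_null ?_ h
    intro x hx
    rw [mem_ball_zero_iff] at hx
    simp only [mem_compl_iff, Set.mem_ofPred_eq, Pi.zero_apply, ENNReal.ofReal_eq_zero, not_le]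
    exact lt_max_of_lt_right (by linarith)
  exact (Metric.measure_ball_pos volume _ (by positivity)).ne' hz

variable [Fintype ι] {ρ : PartitionOfUnity ι M} {δ : (Σ i, T i) → (Σ i, T i) → ℝ}

open Classical in
/-- The function `f` times the density, in the coordinates of the chart `i`. -/
def chartDensity (ρ : PartitionOfUnity ι M) (δ : (Σ i, T i) → (Σ i, T i) → ℝ) (i : ι) (f : M → ℝ)
    (z : Model d × T i) : ℝ :=
  if z ∈ (𝒜.chart i).target then g.totalDensity ρ δ i z * f ((𝒜.chart i).symm z) else 0

/-- The integral of `f` times the density over the plaque through `y`. -/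
def plaqueIntegral (ρ : PartitionOfUnity ι M) (δ : (Σ i, T i) → (Σ i, T i) → ℝ) (i : ι)
    (f : M → ℝ) (y : T i) : ℝ :=
  ∫ x, g.chartDensity ρ δ i f (x, y)

open Classical in
/-- The function whose integral is compared with that of `f`. -/
def spread (ρ : PartitionOfUnity ι M) (δ : (Σ i, T i) → (Σ i, T i) → ℝ) (i : ι)
    (f : M → ℝ) (p : M) : ℝ :=
  if p ∈ (𝒜.chart i).source then kernel 𝒜 i (𝒜.chart i p).1 *
    (g.plaqueIntegral ρ δ i f (𝒜.chart i p).2 / g.totalDensity ρ δ i (𝒜.chart i p)) else 0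

section Spread

variable {i : ι} {f : M → ℝ}

lemma chartDensity_of_mem {x : Model d} {y : T i} (hx : x ∈ 𝒜.disc i) :
    g.chartDensity ρ δ i f (x, y) =
      g.totalDensity ρ δ i (x, y) * f (𝒜.plaqueMap ⟨i, y⟩ x) := by
  rw [chartDensity, if_pos ((𝒜.mem_target (z := (x, y))).2 hx), plaqueMap]

lemma chartDensity_of_notMem {x : Model d} {y : T i} (hx : x ∉ 𝒜.disc i) :
    g.chartDensity ρ δ i f (x, y) = 0 := by
  rw [chartDensity, if_neg fun h => hx ((𝒜.mem_target (z := (x, y))).1 h)]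

lemma chartDensity_nonneg (hf0 : ∀ p, 0 ≤ f p) (z : Model d × T i) :
    0 ≤ g.chartDensity ρ δ i f z := by
  rw [chartDensity]
  split_ifs with hz
  · exact mul_nonneg (g.totalDensity_pos hz).le (hf0 _)
  · exact le_rfl

lemma plaqueIntegral_nonneg (hf0 : ∀ p, 0 ≤ f p) (y : T i) : 0 ≤ g.plaqueIntegral ρ δ i f y :=
  integral_nonneg fun _ => g.chartDensity_nonneg hf0 _

lemma spread_nonneg (hf0 : ∀ p, 0 ≤ f p) (p : M) : 0 ≤ g.spread ρ δ i f p := by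
  rw [spread]
  split_ifs with hp
  · exact mul_nonneg (kernel_nonneg _ _) (div_nonneg (g.plaqueIntegral_nonneg hf0 _)
      (g.totalDensity_pos ((𝒜.chart i).map_source hp)).le)
  · exact le_rfl

lemma chartDensity_eq_zero {Q : Set (Model d)} {K : Set (T i)}
    (hsupp : ∀ p ∈ (𝒜.chart i).source, f p ≠ 0 → (𝒜.chart i p).1 ∈ Q ∧ (𝒜.chart i p).2 ∈ K)
    {z : Model d × T i} (hz : z ∉ Q ×ˢ K) : g.chartDensity ρ δ i f z = 0 := by
  rw [chartDensity]
  split_ifs with hzt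
  · by_contra hne
    have := hsupp _ ((𝒜.chart i).map_target hzt) fun h => hne (by rw [h, mul_zero])
    rw [(𝒜.chart i).right_inv hzt] at this
    exact hz this
  · rfl

lemma plaqueIntegral_eq_zero {Q : Set (Model d)} {K : Set (T i)}
    (hsupp : ∀ p ∈ (𝒜.chart i).source, f p ≠ 0 → (𝒜.chart i p).1 ∈ Q ∧ (𝒜.chart i p).2 ∈ K)
    {y : T i} (hy : y ∉ K) : g.plaqueIntegral ρ δ i f y = 0 := by
  rw [plaqueIntegral]
  simp [fun x : Model d => g.chartDensity_eq_zero (ρ := ρ) (δ := δ) hsupp (z := (x, y))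
    fun h => hy h.2]

variable [∀ i, T2Space (T i)]

lemma continuous_chartDensity (hδ : 𝒜.IsContinuousCocycle δ)
    (hρ : ρ.IsSubordinate fun i => (𝒜.chart i).source)
    (hρr : ∀ i, 𝒜.TangentiallyContDiff r (ρ i)) (hf : Continuous f) {Q : Set (Model d)}
    (hQ : IsCompact Q) (hQd : Q ⊆ 𝒜.disc i) {K : Set (T i)} (hK : IsCompact K)
    (hsupp : ∀ p ∈ (𝒜.chart i).source, f p ≠ 0 → (𝒜.chart i p).1 ∈ Q ∧ (𝒜.chart i p).2 ∈ K) :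
    Continuous (g.chartDensity ρ δ i f) := by
  refine continuous_of_eq_zero_off_compact (𝒜.chart i).open_target (hQ.prod hK)
    (fun z hz => 𝒜.mem_target.2 (hQd hz.1)) ?_ fun z hz => g.chartDensity_eq_zero hsupp hz
  refine ((g.continuousOn_totalDensity hδ hρ hρr i).mul
    (hf.comp_continuousOn (𝒜.chart i).continuousOn_symm)).congr fun z hz => ?_
  rw [chartDensity, if_pos hz]
  rfl

lemma integrable_chartDensity (hδ : 𝒜.IsContinuousCocycle δ)
    (hρ : ρ.IsSubordinate fun i => (𝒜.chart i).source)
    (hρr : ∀ i, 𝒜.TangentiallyContDiff r (ρ i)) (hf : Continuous f) {Q : Set (Model d)}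
    (hQ : IsCompact Q) (hQd : Q ⊆ 𝒜.disc i) {K : Set (T i)} (hK : IsCompact K)
    (hsupp : ∀ p ∈ (𝒜.chart i).source, f p ≠ 0 → (𝒜.chart i p).1 ∈ Q ∧ (𝒜.chart i p).2 ∈ K)
    (y : T i) : Integrable fun x => g.chartDensity ρ δ i f (x, y) :=
  ((g.continuous_chartDensity hδ hρ hρr hf hQ hQd hK hsupp).comp
    (Continuous.prodMk_left y)).integrable_of_hasCompactSupport
    (HasCompactSupport.intro hQ fun _ hx => g.chartDensity_eq_zero hsupp fun h => hx h.1)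

/-- The integrand is jointly continuous and supported, for all `y`, over the same compact set `Q`.
-/
lemma continuous_plaqueIntegral [∀ i, FirstCountableTopology (T i)]
    [∀ i, LocallyCompactSpace (T i)] (hδ : 𝒜.IsContinuousCocycle δ)
    (hρ : ρ.IsSubordinate fun i => (𝒜.chart i).source)
    (hρr : ∀ i, 𝒜.TangentiallyContDiff r (ρ i)) (hf : Continuous f) {Q : Set (Model d)}
    (hQ : IsCompact Q) (hQd : Q ⊆ 𝒜.disc i) {K : Set (T i)} (hK : IsCompact K)
    (hsupp : ∀ p ∈ (𝒜.chart i).source, f p ≠ 0 → (𝒜.chart i p).1 ∈ Q ∧ (𝒜.chart i p).2 ∈ K) :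
    Continuous (g.plaqueIntegral ρ δ i f) := by
  have hG := g.continuous_chartDensity hδ hρ hρr hf hQ hQd hK hsupp
  have h := continuous_parametric_integral_of_continuous (μ := (volume : Measure (Model d)))
    (f := fun (y : T i) (x : Model d) => g.chartDensity ρ δ i f (x, y))
    (hG.comp continuous_swap) hQ
  refine h.congr fun y => ?_
  rw [plaqueIntegral, setIntegral_eq_integral_of_forall_compl_eq_zero]
  exact fun x hx => g.chartDensity_eq_zero hsupp fun h => hx h.1

/-- Continuity is what makes the spread an admissible test function for weak convergence. The kernel
bounds its support in the disc, and the plaque integral bounds it transversally. -/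
lemma continuous_spread [T2Space M] [∀ i, FirstCountableTopology (T i)]
    [∀ i, LocallyCompactSpace (T i)] (hδ : 𝒜.IsContinuousCocycle δ)
    (hρ : ρ.IsSubordinate fun i => (𝒜.chart i).source)
    (hρr : ∀ i, 𝒜.TangentiallyContDiff r (ρ i)) (hf : Continuous f) {Q : Set (Model d)}
    (hQ : IsCompact Q) (hQd : Q ⊆ 𝒜.disc i) {K : Set (T i)} (hK : IsCompact K)
    (hsupp : ∀ p ∈ (𝒜.chart i).source, f p ≠ 0 → (𝒜.chart i p).1 ∈ Q ∧ (𝒜.chart i p).2 ∈ K) :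
    Continuous (g.spread ρ δ i f) := by
  have hsub : Metric.closedBall (0 : Model d) (𝒜.radius i / 2) ×ˢ K ⊆ (𝒜.chart i).target :=
    fun z hz => 𝒜.mem_target.2 (Metric.closedBall_subset_ball
      (by linarith [𝒜.radius_pos i]) hz.1)
  refine continuous_of_eq_zero_off_compact (𝒜.chart i).open_source
    (((isCompact_closedBall (0 : Model d) (𝒜.radius i / 2)).prod hK).image_of_continuousOn
      ((𝒜.chart i).continuousOn_symm.mono hsub)) ?_ ?_ ?_
  · rintro _ ⟨z, hz, rfl⟩
    exact (𝒜.chart i).map_target (hsub hz)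
  · have hc := (𝒜.chart i).continuousOn
    have hP := g.continuous_plaqueIntegral hδ hρ hρr hf hQ hQd hK hsupp
    refine ContinuousOn.congr (f := fun p => kernel 𝒜 i (𝒜.chart i p).1 *
      (g.plaqueIntegral ρ δ i f (𝒜.chart i p).2 / g.totalDensity ρ δ i (𝒜.chart i p))) ?_
      fun p hp => if_pos hp
    refine ((continuous_kernel i).comp_continuousOn (continuous_fst.comp_continuousOn hc)).mul
      ((hP.comp_continuousOn (continuous_snd.comp_continuousOn hc)).div
        ((g.continuousOn_totalDensity hδ hρ hρr i).comp hc
          fun p hp => (𝒜.chart i).map_source hp)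
        fun p hp => (g.totalDensity_pos ((𝒜.chart i).map_source hp)).ne')
  · intro p hp
    by_contra hne
    have hps : p ∈ (𝒜.chart i).source := by
      by_contra h
      exact hne (if_neg h)
    rw [spread, if_pos hps] at hne
    refine hp ⟨𝒜.chart i p, ⟨?_, ?_⟩, (𝒜.chart i).left_inv hps⟩
    · by_contra h
      exact hne (by rw [kernel_eq_zero h, zero_mul])
    · by_contra h
      exact hne (by rw [g.plaqueIntegral_eq_zero hsupp h, zero_div, mul_zero])

end Spread

end LeafwiseMetric

/-! ### Comparison of a function with its spread -/

namespace LeafwiseMetric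

open FoliatedAtlas

variable {M : Type*} [TopologicalSpace M] {d : ℕ} {r : ℕ∞} {ι : Type*} {T : ι → Type*}
  [∀ i, TopologicalSpace (T i)] {𝒜 : FoliatedAtlas M d r T} (g : LeafwiseMetric 𝒜)

section Comparison

variable {i : ι}

lemma measurableSet_plaque_trace (y : T i) {V : Set M} (hV : IsClosed V) :
    MeasurableSet (𝒜.disc i ∩ 𝒜.plaqueMap ⟨i, y⟩ ⁻¹' V) := by
  have h := (𝒜.continuousOn_plaqueMap ⟨i, y⟩).isOpen_inter_preimage (𝒜.isOpen_disc i)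
    hV.isOpen_compl
  have e : 𝒜.disc i ∩ 𝒜.plaqueMap ⟨i, y⟩ ⁻¹' V =
      𝒜.disc i \ (𝒜.disc i ∩ 𝒜.plaqueMap ⟨i, y⟩ ⁻¹' Vᶜ) := by
    ext x
    simp only [mem_inter_iff, mem_preimage, Set.mem_sdiff, mem_compl_iff]
    tauto
  rw [e]
  exact (𝒜.isOpen_disc i).measurableSet.diff h.measurableSet

lemma setLIntegral_disc_indicator (y : T i) {V : Set M} (hV : IsClosed V)
    {u : Model d → ℝ≥0∞} {F : M → ℝ≥0∞} {v : Model d → ℝ≥0∞}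
    (h : ∀ x ∈ 𝒜.disc i, u x * F (𝒜.plaqueMap ⟨i, y⟩ x) = v x) :
    ∫⁻ x in 𝒜.disc i, u x * V.indicator F (𝒜.plaqueMap ⟨i, y⟩ x) =
      ∫⁻ x in 𝒜.disc i ∩ 𝒜.plaqueMap ⟨i, y⟩ ⁻¹' V, v x := by
  rw [← lintegral_indicator (𝒜.isOpen_disc i).measurableSet,
    ← lintegral_indicator (measurableSet_plaque_trace y hV)]
  congr 1
  funext x
  by_cases hx : x ∈ 𝒜.disc i
  · by_cases hxV : 𝒜.plaqueMap ⟨i, y⟩ x ∈ V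
    · rw [indicator_of_mem hx, indicator_of_mem hxV, indicator_of_mem (mem_inter hx hxV), h x hx]
    · rw [indicator_of_mem hx, indicator_of_notMem hxV, indicator_of_notMem fun h => hxV h.2,
        mul_zero]
  · rw [indicator_of_notMem hx, indicator_of_notMem fun h => hx h.1]

variable
  [Fintype ι] {ρ : PartitionOfUnity ι M} {δ : (Σ i, T i) → (Σ i, T i) → ℝ}
  [MeasurableSpace M] [BorelSpace M] [T2Space M] [∀ i, T2Space (T i)]
  [∀ i, FirstCountableTopology (T i)] [∀ i, LocallyCompactSpace (T i)] {f : M → ℝ}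

/-- The integrals of `f` and of its spread differ at most by a multiple of the modified area of the
boundary. -/
lemma exists_comparison (hd : 1 ≤ d) (hr : 1 ≤ r) (hδ : 𝒜.IsContinuousCocycle δ)
    (hρ : ρ.IsSubordinate fun i => (𝒜.chart i).source)
    (hρr : ∀ i, 𝒜.TangentiallyContDiff r (ρ i)) (hf : Continuous f) (hf0 : ∀ p, 0 ≤ f p)
    (hfi : ∀ p ∉ (𝒜.chart i).source, f p = 0) {R : ℝ}
    (hR0 : 𝒜.radius i / 2 ≤ R) (hR : R < 𝒜.radius i) {K : Set (T i)} (hK : IsCompact K)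
    (hsupp : ∀ p ∈ (𝒜.chart i).source, f p ≠ 0 →
      (𝒜.chart i p).1 ∈ Metric.closedBall 0 R ∧ (𝒜.chart i p).2 ∈ K) :
    ∃ C : ℝ≥0∞, C ≠ ∞ ∧ ∀ (h : M → ℝ) (t : Σ i, T i) (V : Set M),
      𝒜.IsPrimitiveOn (𝒜.modularForm ρ δ) h (𝒜.leaf t) → 𝒜.IsCompactDomain t V →
      ((∫⁻ x, ENNReal.ofReal (kernel 𝒜 i x)) *
          ∫⁻ p, ENNReal.ofReal (f p) ∂(g.weightedVolume ρ h t V) ≤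
        ∫⁻ p, ENNReal.ofReal (g.spread ρ δ i f p) ∂(g.weightedVolume ρ h t V) +
          C * g.modifiedArea h t (𝒜.leafBoundary V)) ∧
      (∫⁻ p, ENNReal.ofReal (g.spread ρ δ i f p) ∂(g.weightedVolume ρ h t V) ≤
        (∫⁻ x, ENNReal.ofReal (kernel 𝒜 i x)) *
          ∫⁻ p, ENNReal.ofReal (f p) ∂(g.weightedVolume ρ h t V) +
          C * g.modifiedArea h t (𝒜.leafBoundary V)) := by
  have hRpos : 0 < R := lt_of_lt_of_le (by have := 𝒜.radius_pos i; positivity) hR0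
  set Q := Metric.closedBall (0 : Model d) R with hQ
  have hQd : Q ⊆ 𝒜.disc i := Metric.closedBall_subset_ball hR
  have hQc : IsCompact Q := isCompact_closedBall _ _
  have hQm : MeasurableSet Q := Metric.isClosed_closedBall.measurableSet
  have hG := g.continuous_chartDensity hδ hρ hρr hf hQc hQd hK hsupp
  obtain ⟨B, hB⟩ := (HasCompactSupport.intro (hQc.prod hK) fun z hz =>
    g.chartDensity_eq_zero (ρ := ρ) (δ := δ) hsupp hz).exists_bound_of_continuous hG
  obtain ⟨C₁, hC₁, hiso⟩ := g.exists_volume_mul_volume_le hd hr hRpos hR hK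
  obtain ⟨C₂, hC₂, harea⟩ := g.exists_tsum_hausdorff_le hr hδ hρ hρr hQc hQd hK
  set b : ℝ≥0∞ := ENNReal.ofReal B with hb
  set c : ℝ≥0∞ := ENNReal.ofReal (𝒜.radius i / 2) with hc
  refine ⟨b * c * C₁ * C₂, ENNReal.mul_ne_top (ENNReal.mul_ne_top (ENNReal.mul_ne_top
    ENNReal.ofReal_ne_top ENNReal.ofReal_ne_top) hC₁) hC₂, fun h t V hh hV => ?_⟩
  have hVc : IsClosed V := (𝒜.isCompact_of_isCompact_leafTopology hV.2.2.1).isClosed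
  have hVm := hVc.measurableSet
  have hsc := g.continuous_spread hδ hρ hρr hf hQc hQd hK hsupp
  have hκQ : ∀ x ∉ Q, ENNReal.ofReal (kernel 𝒜 i x) = 0 := fun x hx => by
    rw [kernel_eq_zero fun h' => hx (Metric.closedBall_subset_closedBall hR0 h'),
      ENNReal.ofReal_zero]
  have hκc : ∀ x, ENNReal.ofReal (kernel 𝒜 i x) ≤ c := fun x =>
    ENNReal.ofReal_le_ofReal (kernel_le i x)
  have huQ : ∀ y : T i, ∀ x ∉ Q, ENNReal.ofReal (g.chartDensity ρ δ i f (x, y)) = 0 :=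
    fun y x hx => by
      rw [g.chartDensity_eq_zero hsupp (z := (x, y)) fun h' => hx h'.1, ENNReal.ofReal_zero]
  have hub : ∀ (y : T i) (x), ENNReal.ofReal (g.chartDensity ρ δ i f (x, y)) ≤ b := fun y x =>
    ENNReal.ofReal_le_ofReal ((le_abs_self _).trans (hB (x, y)))
  have hE : ∀ y, ENNReal.ofReal (g.plaqueIntegral ρ δ i f y) =
      ∫⁻ x, ENNReal.ofReal (g.chartDensity ρ δ i f (x, y)) := fun y =>
    ofReal_integral_eq_lintegral_ofReal
      (g.integrable_chartDensity hδ hρ hρr hf hQc hQd hK hsupp y)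
      (Eventually.of_forall fun x => g.chartDensity_nonneg hf0 _)
  set A : T i → Set (Model d) := fun y => 𝒜.disc i ∩ 𝒜.plaqueMap ⟨i, y⟩ ⁻¹' V with hA
  have hAm : ∀ y, MeasurableSet (A y) := fun y => measurableSet_plaque_trace y hVc
  -- the contributions of the plaques
  have hf_sum : ∫⁻ p, ENNReal.ofReal (f p) ∂(g.weightedVolume ρ h t V) =
      ∑' s : {s : T i // s ∈ {s | 𝒜.Rel t ⟨i, s⟩} ∩ K}, plaqueWeight 𝒜 ρ δ h t ⟨i, s⟩ *
        ∫⁻ x in A s, ENNReal.ofReal (g.chartDensity ρ δ i f (x, s.1)) := by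
    rw [g.lintegral_weightedVolume hr hδ hρ hρr hh hVm i hf.measurable.ennreal_ofReal
      fun p hp => by rw [hfi p hp, ENNReal.ofReal_zero]]
    rw [← tsum_pred_eq_tsum_inter (P := fun s => 𝒜.Rel t ⟨i, s⟩)
      (f := fun s => plaqueWeight 𝒜 ρ δ h t ⟨i, s⟩ *
        ∫⁻ x in A s, ENNReal.ofReal (g.chartDensity ρ δ i f (x, s)))]
    · refine tsum_congr fun s => ?_
      rw [setLIntegral_disc_indicator s.1 hVc
        (v := fun x => ENNReal.ofReal (g.chartDensity ρ δ i f (x, s.1)))]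
      intro x hx
      rw [g.chartDensity_of_mem hx, ENNReal.ofReal_mul
        (g.totalDensity_pos ((𝒜.mem_target (z := (x, s.1))).2 hx)).le]
    · intro s hs
      simp [fun x : Model d => g.chartDensity_eq_zero (ρ := ρ) (δ := δ) hsupp (z := (x, s))
        fun h' => hs h'.2]
  -- The total density cancels the denominator of the spread, leaving the plaque integral of `f`
  -- times the kernel.
  have hs_sum : ∫⁻ p, ENNReal.ofReal (g.spread ρ δ i f p) ∂(g.weightedVolume ρ h t V) =
      ∑' s : {s : T i // s ∈ {s | 𝒜.Rel t ⟨i, s⟩} ∩ K}, plaqueWeight 𝒜 ρ δ h t ⟨i, s⟩ *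
        ((∫⁻ x, ENNReal.ofReal (g.chartDensity ρ δ i f (x, s.1))) *
          ∫⁻ x in A s, ENNReal.ofReal (kernel 𝒜 i x)) := by
    rw [g.lintegral_weightedVolume hr hδ hρ hρr hh hVm i hsc.measurable.ennreal_ofReal
      fun p hp => by rw [spread, if_neg hp, ENNReal.ofReal_zero]]
    rw [← tsum_pred_eq_tsum_inter (P := fun s => 𝒜.Rel t ⟨i, s⟩)
      (f := fun s => plaqueWeight 𝒜 ρ δ h t ⟨i, s⟩ *
        ((∫⁻ x, ENNReal.ofReal (g.chartDensity ρ δ i f (x, s))) *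
          ∫⁻ x in A s, ENNReal.ofReal (kernel 𝒜 i x)))]
    · refine tsum_congr fun s => ?_
      rw [setLIntegral_disc_indicator s.1 hVc
        (v := fun x => ENNReal.ofReal (g.plaqueIntegral ρ δ i f s.1) *
          ENNReal.ofReal (kernel 𝒜 i x)), lintegral_const_mul' _ _ ENNReal.ofReal_ne_top, hE]
      intro x hx
      have hpos := g.totalDensity_pos (ρ := ρ) (δ := δ) ((𝒜.mem_target (z := (x, s.1))).2 hx)
      rw [spread, if_pos (𝒜.plaqueMap_mem_source (s := ⟨i, s.1⟩) hx),
        𝒜.chart_plaqueMap (s := ⟨i, s.1⟩) hx, ← ENNReal.ofReal_mul hpos.le,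
        ← ENNReal.ofReal_mul (g.plaqueIntegral_nonneg hf0 _)]
      congr 1
      field_simp
    · intro s hs
      simp [fun x : Model d => g.chartDensity_eq_zero (ρ := ρ) (δ := δ) hsupp (z := (x, s))
        fun h' => hs h'.2]
  set H : T i → ℝ≥0∞ := fun s => hausdorffOuter g.leafEDist ((d - 1 : ℕ) : ℝ)
    (𝒜.leafBoundary V ∩ 𝒜.plaqueMap ⟨i, s⟩ '' Q) with hH
  have hvol : ∀ s ∈ K, volume (Q ∩ A s) * volume (Q ∩ (A s)ᶜ) ≤ C₁ * H s := by
    intro s hs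
    have e1 : Q ∩ A s = Q ∩ 𝒜.plaqueMap ⟨i, s⟩ ⁻¹' V := by
      ext x
      simp only [hA, mem_inter_iff, mem_preimage]
      exact ⟨fun h' => ⟨h'.1, h'.2.2⟩, fun h' => ⟨h'.1, hQd h'.1, h'.2⟩⟩
    have e2 : Q ∩ (A s)ᶜ = Q \ 𝒜.plaqueMap ⟨i, s⟩ ⁻¹' V := by
      ext x
      simp only [hA, mem_inter_iff, mem_preimage, mem_compl_iff, Set.mem_sdiff, not_and]
      exact ⟨fun h' => ⟨h'.1, h'.2 (hQd h'.1)⟩, fun h' => ⟨h'.1, fun _ => h'.2⟩⟩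
    rw [e1, e2]
    exact hiso s hs V (by rw [← e1]; exact hQm.inter (hAm s))
  have hbd := harea h t hh (𝒜.leafBoundary V) (@isClosed_frontier M 𝒜.leafTopology V)
  -- The isoperimetric inequality on each plaque, followed by summation of the pieces of the
  -- boundary into the modified area.
  have herr : ∑' s : {s : T i // s ∈ {s | 𝒜.Rel t ⟨i, s⟩} ∩ K}, plaqueWeight 𝒜 ρ δ h t ⟨i, s⟩ *
      (b * c * (volume (Q ∩ A s) * volume (Q ∩ (A s)ᶜ))) ≤
      b * c * C₁ * C₂ * g.modifiedArea h t (𝒜.leafBoundary V) := by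
    calc _ ≤ ∑' s : {s : T i // s ∈ {s | 𝒜.Rel t ⟨i, s⟩} ∩ K},
          b * c * C₁ * (plaqueWeight 𝒜 ρ δ h t ⟨i, s⟩ * H s) := by
          refine ENNReal.tsum_le_tsum fun s => ?_
          refine (mul_le_mul_right (mul_le_mul_right (hvol s.1 s.2.2) _) _).trans (le_of_eq ?_)
          ring
      _ = b * c * C₁ * ∑' s : {s : T i // s ∈ {s | 𝒜.Rel t ⟨i, s⟩} ∩ K},
          plaqueWeight 𝒜 ρ δ h t ⟨i, s⟩ * H s := ENNReal.tsum_mul_left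
      _ ≤ b * c * C₁ * (C₂ * g.modifiedArea h t (𝒜.leafBoundary V)) := mul_le_mul_right hbd _
      _ = _ := by ring
  rw [hf_sum, hs_sum, ← ENNReal.tsum_mul_left]
  constructor
  · refine le_trans ?_ (add_le_add le_rfl herr)
    rw [← ENNReal.tsum_add]
    refine ENNReal.tsum_le_tsum fun s => ?_
    rw [← mul_add, mul_left_comm]
    refine mul_le_mul_right ?_ _
    exact lintegral_mul_setLIntegral_le (hAm s) hQm (hub s.1) (huQ s.1) hκc hκQ
  · refine le_trans ?_ (add_le_add le_rfl herr)
    rw [← ENNReal.tsum_add]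
    refine ENNReal.tsum_le_tsum fun s => ?_
    rw [mul_left_comm (∫⁻ x, ENNReal.ofReal (kernel 𝒜 i x)), ← mul_add]
    refine mul_le_mul_right ?_ _
    rw [mul_comm b c]
    -- The same estimate with the kernel and the density of `f` exchanged.
    exact lintegral_mul_setLIntegral_le (hAm s) hQm hκc hκQ (hub s.1) (huQ s.1)

end Comparison

end LeafwiseMetric

/-! ### Weak limits of the averaging measures -/

/-- In a compact metrizable space, each sequence of probability measures has a weakly convergent
subsequence. -/
lemma exists_subseq_tendsto_integral {X : Type*} [TopologicalSpace X] [CompactSpace X]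
    [TopologicalSpace.MetrizableSpace X] [MeasurableSpace X] [BorelSpace X] (m : ℕ → Measure X)
    (hm : ∀ n, IsProbabilityMeasure (m n)) :
    ∃ μ : Measure X, IsProbabilityMeasure μ ∧ ∃ φ : ℕ → ℕ, StrictMono φ ∧ ∀ f : C(X, ℝ),
      Tendsto (fun n => ∫ p, f p ∂(m (φ n))) atTop (𝓝 (∫ p, f p ∂μ)) := by
  let _ := TopologicalSpace.metrizableSpaceMetric X
  let m' : ℕ → ProbabilityMeasure X := fun n => ⟨m n, hm n⟩
  obtain ⟨μ, φ, hφ, hlim⟩ := CompactSpace.tendsto_subseq m'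
  refine ⟨μ, inferInstance, φ, hφ, fun f => ?_⟩
  exact ProbabilityMeasure.tendsto_iff_forall_integral_tendsto.1 hlim
    (BoundedContinuousFunction.mkOfCompact f)

/-- The support of a weak limit of measures carried by the sets `V n` lies in their limit set. -/
lemma support_subset_limitSet {X : Type*} [TopologicalSpace X] [CompactSpace X]
    [TopologicalSpace.MetrizableSpace X] [MeasurableSpace X] [BorelSpace X] {m : ℕ → Measure X}
    {V : ℕ → Set X} (hmV : ∀ n, m n (V n)ᶜ = 0) {μ : Measure X}
    [IsFiniteMeasure μ] {φ : ℕ → ℕ} (hφ : StrictMono φ)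
    (hlim : ∀ f : C(X, ℝ), Tendsto (fun n => ∫ p, f p ∂(m (φ n))) atTop (𝓝 (∫ p, f p ∂μ))) :
    μ.support ⊆ LeafwiseMetric.limitSet V := by
  let _ := TopologicalSpace.metrizableSpaceMetric X
  intro p hp
  -- Otherwise the tent function on the ball has integral zero for all large indices, hence for μ,
  -- and the ball is null although `p` lies in the support.
  have key : ∀ ε > 0, ∀ N, ∃ n > N, (V n ∩ Metric.ball p ε).Nonempty := by
    intro ε hε N
    by_contra! hcon
    let F : C(X, ℝ) := ⟨fun q => max 0 (ε - dist q p), by fun_prop⟩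
    have hF0 : ∀ q, 0 ≤ F q := fun q => le_max_left _ _
    have hFi : ∫ q, F q ∂μ = 0 := by
      refine tendsto_nhds_unique (hlim F) (tendsto_const_nhds.congr' ?_)
      filter_upwards [eventually_gt_atTop N] with n hn
      have hn' : φ n > N := lt_of_lt_of_le hn hφ.le_apply
      symm
      refine integral_eq_zero_of_ae ?_
      have : ∀ᵐ q ∂(m (φ n)), q ∈ V (φ n) := hmV _
      filter_upwards [this] with q hq
      have hnot : q ∉ Metric.ball p ε := fun h' => by
        have : q ∈ V (φ n) ∩ Metric.ball p ε := ⟨hq, h'⟩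
        rw [hcon _ hn'] at this
        exact this
      rw [Metric.mem_ball, not_lt] at hnot
      exact max_eq_left (by linarith)
    rw [integral_eq_zero_iff_of_nonneg hF0
      (F.continuous.integrable_of_hasCompactSupport
        (HasCompactSupport.of_compactSpace _))] at hFi
    have hpos := (Measure.mem_support_iff_forall p).1 hp _ (Metric.ball_mem_nhds p hε)
    refine hpos.ne' (measure_mono_null ?_ hFi)
    intro q hq hq0
    rw [Metric.mem_ball] at hq
    have : max 0 (ε - dist q p) = 0 := hq0
    have := max_eq_left_iff.1 this
    linarith
  choose! n hn hne using key
  let e : ℕ → ℝ := fun k => 1 / ((k : ℝ) + 1)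
  have he : ∀ k, 0 < e k := fun k => by positivity
  -- Each index is chosen beyond the previous one, at the next scale 1/(k+1).
  let ψ : ℕ → ℕ := fun k => Nat.rec (n (e 0) 0) (fun k v => n (e (k + 1)) v) k
  have hψ : ∀ k, ψ k < ψ (k + 1) := fun k => hn _ (he _) _
  have hψne : ∀ k, (V (ψ k) ∩ Metric.ball p (e k)).Nonempty := by
    intro k
    cases k with
    | zero => exact hne _ (he _) _
    | succ k => exact hne _ (he _) _
  choose q hq using hψne
  refine ⟨ψ, q, strictMono_nat_of_lt_succ hψ, fun k => (hq k).1, ?_⟩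
  rw [tendsto_iff_dist_tendsto_zero]
  exact squeeze_zero (fun _ => dist_nonneg) (fun k => (Metric.mem_ball.1 (hq k).2).le)
    tendsto_one_div_add_atTop_nhds_zero_nat

lemma tendsto_lintegral_ofReal {X : Type*} [TopologicalSpace X] [CompactSpace X]
    [MeasurableSpace X] [BorelSpace X] {m : ℕ → Measure X} [∀ n, IsFiniteMeasure (m n)]
    {μ : Measure X} [IsFiniteMeasure μ]
    (hlim : ∀ f : C(X, ℝ), Tendsto (fun n => ∫ p, f p ∂(m n)) atTop (𝓝 (∫ p, f p ∂μ)))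
    {f : X → ℝ} (hf : Continuous f) (hf0 : ∀ p, 0 ≤ f p) :
    Tendsto (fun n => ∫⁻ p, ENNReal.ofReal (f p) ∂(m n)) atTop
      (𝓝 (∫⁻ p, ENNReal.ofReal (f p) ∂μ)) := by
  have hint : ∀ (m : Measure X) [IsFiniteMeasure m],
      ENNReal.ofReal (∫ p, f p ∂m) = ∫⁻ p, ENNReal.ofReal (f p) ∂m := fun m _ =>
    ofReal_integral_eq_lintegral_ofReal
      (hf.integrable_of_hasCompactSupport (HasCompactSupport.of_compactSpace _))
      (Eventually.of_forall hf0)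
  have key : Tendsto (fun n => ENNReal.ofReal (∫ p, f p ∂(m n))) atTop
      (𝓝 (ENNReal.ofReal (∫ p, f p ∂μ))) := ENNReal.tendsto_ofReal (hlim ⟨f, hf⟩)
  simpa only [hint] using key

namespace LeafwiseMetric

open FoliatedAtlas

variable {M : Type*} [TopologicalSpace M] {d : ℕ} {r : ℕ∞} {ι : Type*} {T : ι → Type*}
  [∀ i, TopologicalSpace (T i)] {𝒜 : FoliatedAtlas M d r T} (g : LeafwiseMetric 𝒜)
  {ρ : PartitionOfUnity ι M} [MeasurableSpace M]

lemma averagingMeasure_eq (h : M → ℝ) (t : Σ i, T i) (V : Set M) :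
    g.averagingMeasure ρ h t V = (g.modifiedVolume ρ h t V)⁻¹ • g.weightedVolume ρ h t V := rfl

lemma averagingMeasure_compl {h : M → ℝ} {t : Σ i, T i} {V : Set M}
    (hV : MeasurableSet V) : g.averagingMeasure ρ h t V Vᶜ = 0 := by
  rw [averagingMeasure, Measure.smul_apply, withDensity_apply _ hV.compl,
    Measure.restrict_restrict hV.compl]
  simp

variable [Fintype ι] {δ : (Σ i, T i) → (Σ i, T i) → ℝ}
  [BorelSpace M] [T2Space M] [∀ i, TopologicalSpace.SeparableSpace (T i)]
  [∀ i, TopologicalSpace.MetrizableSpace (T i)]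

lemma isProbabilityMeasure_averagingMeasure (hr : 1 ≤ r) (hδ : 𝒜.IsContinuousCocycle δ)
    (hρ : ρ.IsSubordinate fun i => (𝒜.chart i).source)
    (hρr : ∀ i, 𝒜.TangentiallyContDiff r (ρ i)) {h : M → ℝ} {t : Σ i, T i} {V : Set M}
    (hh : 𝒜.IsPrimitiveOn (𝒜.modularForm ρ δ) h (𝒜.leaf t)) (hV : 𝒜.IsCompactDomain t V) :
    IsProbabilityMeasure (g.averagingMeasure ρ h t V) := by
  refine ⟨?_⟩
  rw [averagingMeasure_eq, Measure.smul_apply, weightedVolume_univ, smul_eq_mul]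
  exact ENNReal.inv_mul_cancel (g.modifiedVolume_ne_zero hr hδ hρ hρr hh hV)
    (g.modifiedVolume_ne_top hr hδ hρ hρr hh hV)

variable [CompactSpace M] {h : M → ℝ} {y : ℕ → Σ i, T i} {V : ℕ → Set M}

lemma exists_isAveragingLimit (hr : 1 ≤ r) (hδ : 𝒜.IsContinuousCocycle δ)
    (hρ : ρ.IsSubordinate fun i => (𝒜.chart i).source)
    (hρr : ∀ i, 𝒜.TangentiallyContDiff r (ρ i))
    (hV : g.IsAveragingSequence ρ (𝒜.modularForm ρ δ) h y V) :
    ∃ μ : Measure M, g.IsAveragingLimit ρ h y V μ := by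
  have := 𝒜.metrizableSpace
  obtain ⟨μ, h1, φ, h2⟩ := exists_subseq_tendsto_integral
    (fun n => g.averagingMeasure ρ h (y n) (V n))
    fun n => g.isProbabilityMeasure_averagingMeasure hr hδ hρ hρr (hV.primitive n) (hV.domain n)
  exact ⟨μ, h1, φ, h2⟩

lemma IsAveragingLimit.support_subset
    (hV : g.IsAveragingSequence ρ (𝒜.modularForm ρ δ) h y V) {μ : Measure M}
    (hμ : g.IsAveragingLimit ρ h y V μ) : μ.support ⊆ limitSet V := by
  have := 𝒜.metrizableSpace
  obtain ⟨h1, φ, hφ, hlim⟩ := hμ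
  have hm := fun n => measurableSet_of_isCompactDomain (hV.domain n)
  exact support_subset_limitSet (m := fun n => g.averagingMeasure ρ h (y n) (V n))
    (fun n => g.averagingMeasure_compl (hm n)) hφ hlim

variable [∀ i, LocallyCompactSpace (T i)]

/-- In the limit, the integrals of `f` and of its spread are proportional. -/
lemma IsAveragingLimit.lintegral_spread (hd : 1 ≤ d) (hr : 1 ≤ r) (hδ : 𝒜.IsContinuousCocycle δ)
    (hρ : ρ.IsSubordinate fun i => (𝒜.chart i).source)
    (hρr : ∀ i, 𝒜.TangentiallyContDiff r (ρ i))
    (hV : g.IsAveragingSequence ρ (𝒜.modularForm ρ δ) h y V) {μ : Measure M}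
    (hμ : g.IsAveragingLimit ρ h y V μ) {i : ι} {f : M → ℝ} (hf : Continuous f)
    (hf0 : ∀ p, 0 ≤ f p) (hfi : ∀ p ∉ (𝒜.chart i).source, f p = 0) {R : ℝ}
    (hR0 : 𝒜.radius i / 2 ≤ R) (hR : R < 𝒜.radius i) {K : Set (T i)} (hK : IsCompact K)
    (hsupp : ∀ p ∈ (𝒜.chart i).source, f p ≠ 0 →
      (𝒜.chart i p).1 ∈ Metric.closedBall 0 R ∧ (𝒜.chart i p).2 ∈ K) :
    ∫⁻ p, ENNReal.ofReal (g.spread ρ δ i f p) ∂μ =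
      (∫⁻ x, ENNReal.ofReal (kernel 𝒜 i x)) * ∫⁻ p, ENNReal.ofReal (f p) ∂μ := by
  obtain ⟨h1, φ, hφ, hlim⟩ := hμ
  obtain ⟨C, hC, hcomp⟩ := g.exists_comparison hd hr hδ hρ hρr hf hf0 hfi hR0 hR hK hsupp
  have hprob := fun n => g.isProbabilityMeasure_averagingMeasure hr hδ hρ hρr
    (hV.primitive (φ n)) (hV.domain (φ n))
  have hQd : Metric.closedBall (0 : Model d) R ⊆ 𝒜.disc i := Metric.closedBall_subset_ball hR
  have hs := g.continuous_spread hδ hρ hρr hf (isCompact_closedBall _ _) hQd hK hsupp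
  have t1 := tendsto_lintegral_ofReal hlim hf hf0
  have t2 := tendsto_lintegral_ofReal hlim hs (g.spread_nonneg hf0)
  have t1' := ENNReal.Tendsto.const_mul (a := ∫⁻ x, ENNReal.ofReal (kernel 𝒜 i x)) t1
    (Or.inr (lintegral_kernel_ne_top i))
  -- After division by the modified volume, the error is a constant times the averaging ratio, which
  -- tends to zero.
  have t3 := ENNReal.Tendsto.const_mul (a := C) (hV.tendsto.comp hφ.tendsto_atTop)
    (Or.inr hC)
  rw [mul_zero] at t3
  have hav : ∀ n (F : M → ℝ≥0∞), ∫⁻ p, F p ∂(g.averagingMeasure ρ h (y (φ n)) (V (φ n))) =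
      (g.modifiedVolume ρ h (y (φ n)) (V (φ n)))⁻¹ *
        ∫⁻ p, F p ∂(g.weightedVolume ρ h (y (φ n)) (V (φ n))) := fun n F => by
    rw [averagingMeasure_eq, lintegral_smul_measure, smul_eq_mul]
  apply le_antisymm
  · have t4 := t1'.add t3
    rw [add_zero] at t4
    refine le_of_tendsto_of_tendsto' t2 t4 fun n => ?_
    have := mul_le_mul_right (hcomp h (y (φ n)) (V (φ n)) (hV.primitive _) (hV.domain _)).2
      (g.modifiedVolume ρ h (y (φ n)) (V (φ n)))⁻¹
    rw [hav, hav]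
    refine this.trans (le_of_eq ?_)
    simp only [Function.comp, div_eq_mul_inv]
    ring
  · have t4 := t2.add t3
    rw [add_zero] at t4
    refine le_of_tendsto_of_tendsto' t1' t4 fun n => ?_
    have := mul_le_mul_right (hcomp h (y (φ n)) (V (φ n)) (hV.primitive _) (hV.domain _)).1
      (g.modifiedVolume ρ h (y (φ n)) (V (φ n)))⁻¹
    rw [hav, hav]
    refine le_trans (le_of_eq ?_) (this.trans (le_of_eq ?_))
    · ring
    · simp only [Function.comp, div_eq_mul_inv]
      ring

end LeafwiseMetric

/-! ### The local product structure of the limits -/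

/-- Both measures are recovered on `W` by dividing by `f`. This passes from integrals of compactly
supported functions to the measures themselves. -/
lemma restrict_eq_of_withDensity_eq {X : Type*} [MeasurableSpace X] {μ ν : Measure X}
    {f : X → ℝ≥0∞} (hf : Measurable f) (hf' : ∀ x, f x ≠ ∞) {W : Set X} (hW : MeasurableSet W)
    (hfW : ∀ x ∈ W, f x ≠ 0) (h : μ.withDensity f = ν.withDensity f) :
    μ.restrict W = ν.restrict W := by
  have key : ∀ m : Measure X, m.restrict W =
      ((m.withDensity f).restrict W).withDensity fun x => (f x)⁻¹ := by
    intro m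
    rw [restrict_withDensity hW, withDensity_inv_same hf ?_ (Eventually.of_forall hf')]
    exact (ae_restrict_iff' hW).2 (Eventually.of_forall hfW)
  rw [key μ, key ν, h]

namespace LeafwiseMetric

open FoliatedAtlas

variable {M : Type*} [TopologicalSpace M] {d : ℕ} {r : ℕ∞} {ι : Type*} {T : ι → Type*}
  [∀ i, TopologicalSpace (T i)] {𝒜 : FoliatedAtlas M d r T} (g : LeafwiseMetric 𝒜)
  [MeasurableSpace M]

lemma HasModularForm.isTangentiallySmooth [∀ i, MeasurableSpace (T i)] {μ : Measure M}
    {η : 𝒜.LocalForms} (hμ : g.HasModularForm μ η) : g.IsTangentiallySmooth μ := by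
  intro i
  obtain ⟨ν, k, h1, h2⟩ := hμ i
  exact ⟨ν, k, h1, h2.mono fun y hy => hy.1⟩

variable [Fintype ι] {ρ : PartitionOfUnity ι M} {δ : (Σ i, T i) → (Σ i, T i) → ℝ}

lemma aemeasurable_kernel_div [BorelSpace M] (hδ : 𝒜.IsContinuousCocycle δ)
    (hρ : ρ.IsSubordinate fun i => (𝒜.chart i).source)
    (hρr : ∀ i, 𝒜.TangentiallyContDiff r (ρ i)) (i : ι) (μ : Measure M) :
    AEMeasurable (fun p => ENNReal.ofReal
      (kernel 𝒜 i (𝒜.chart i p).1 / g.totalDensity ρ δ i (𝒜.chart i p)))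
      (μ.restrict (𝒜.chart i).source) := by
  have hc := (𝒜.chart i).continuousOn
  refine (ContinuousOn.aemeasurable ?_ (𝒜.chart i).open_source.measurableSet).ennreal_ofReal
  exact ((continuous_kernel i).comp_continuousOn (continuous_fst.comp_continuousOn hc)).div
    ((g.continuousOn_totalDensity hδ hρ hρr i).comp hc fun p hp => (𝒜.chart i).map_source hp)
    fun p hp => (g.totalDensity_pos ((𝒜.chart i).map_source hp)).ne'

variable [∀ i, MeasurableSpace (T i)]

/-- The transverse measure of `μ` in the chart `i`. -/
def transverseMeasure (ρ : PartitionOfUnity ι M) (δ : (Σ i, T i) → (Σ i, T i) → ℝ)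
    (μ : Measure M) (i : ι) : Measure (T i) :=
  (∫⁻ x, ENNReal.ofReal (kernel 𝒜 i x))⁻¹ •
    ((μ.restrict (𝒜.chart i).source).withDensity fun p => ENNReal.ofReal
      (kernel 𝒜 i (𝒜.chart i p).1 / g.totalDensity ρ δ i (𝒜.chart i p))).map
      fun p => (𝒜.chart i p).2

/-- The measure on the domain of the chart `i` with transverse measure `ν` and the explicit density
along the plaques. -/
def plaqueProduct (ρ : PartitionOfUnity ι M) (δ : (Σ i, T i) → (Σ i, T i) → ℝ) (i : ι)
    (ν : Measure (T i)) : Measure M :=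
  (((volume.prod ν).restrict (𝒜.chart i).target).withDensity fun z =>
    ENNReal.ofReal (g.totalDensity ρ δ i z)).map (𝒜.chart i).symm

variable [BorelSpace M] [∀ i, BorelSpace (T i)]

lemma lintegral_transverseMeasure (hδ : 𝒜.IsContinuousCocycle δ)
    (hρ : ρ.IsSubordinate fun i => (𝒜.chart i).source)
    (hρr : ∀ i, 𝒜.TangentiallyContDiff r (ρ i)) (i : ι) (μ : Measure M)
    {F : T i → ℝ≥0∞} (hF : Measurable F) :
    ∫⁻ y, F y ∂(g.transverseMeasure ρ δ μ i) = (∫⁻ x, ENNReal.ofReal (kernel 𝒜 i x))⁻¹ *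
      ∫⁻ p in (𝒜.chart i).source, ENNReal.ofReal
        (kernel 𝒜 i (𝒜.chart i p).1 / g.totalDensity ρ δ i (𝒜.chart i p)) *
          F (𝒜.chart i p).2 ∂μ := by
  have hs : AEMeasurable (fun p => (𝒜.chart i p).2) (μ.restrict (𝒜.chart i).source) :=
    (continuous_snd.comp_continuousOn (𝒜.chart i).continuousOn).aemeasurable
      (𝒜.chart i).open_source.measurableSet
  rw [transverseMeasure, lintegral_smul_measure, smul_eq_mul, lintegral_map' hF.aemeasurable
    (hs.mono_ac (withDensity_absolutelyContinuous _ _)),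
    lintegral_withDensity_eq_lintegral_mul₀ (g := fun p => F (𝒜.chart i p).2)
      (g.aemeasurable_kernel_div hδ hρ hρr i μ)
      (hF.comp_aemeasurable hs)]
  rfl

variable [∀ i, SecondCountableTopology (T i)]

lemma lintegral_plaqueProduct (hδ : 𝒜.IsContinuousCocycle δ)
    (hρ : ρ.IsSubordinate fun i => (𝒜.chart i).source)
    (hρr : ∀ i, 𝒜.TangentiallyContDiff r (ρ i)) (i : ι) (ν : Measure (T i)) [SFinite ν]
    {F : M → ℝ≥0∞} (hF : Measurable F) :
    ∫⁻ p, F p ∂(g.plaqueProduct ρ δ i ν) =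
      ∫⁻ y, (∫⁻ x in 𝒜.disc i, ENNReal.ofReal (g.totalDensity ρ δ i (x, y)) *
        F (𝒜.plaqueMap ⟨i, y⟩ x) ∂volume) ∂ν := by
  have hm : MeasurableSet (𝒜.chart i).target := (𝒜.chart i).open_target.measurableSet
  have hs : AEMeasurable (𝒜.chart i).symm ((volume.prod ν).restrict (𝒜.chart i).target) :=
    (𝒜.chart i).continuousOn_symm.aemeasurable hm
  have hD : AEMeasurable (fun z => ENNReal.ofReal (g.totalDensity ρ δ i z))
      ((volume.prod ν).restrict (𝒜.chart i).target) :=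
    ((g.continuousOn_totalDensity hδ hρ hρr i).aemeasurable hm).ennreal_ofReal
  have e : (volume.prod ν).restrict (𝒜.chart i).target =
      (volume.restrict (𝒜.disc i)).prod ν := by
    rw [𝒜.target_eq, ← Measure.prod_restrict, Measure.restrict_univ]
    rfl
  rw [plaqueProduct, lintegral_map' hF.aemeasurable
    (hs.mono_ac (withDensity_absolutelyContinuous _ _)),
    lintegral_withDensity_eq_lintegral_mul₀ (g := fun z => F ((𝒜.chart i).symm z)) hD
      (hF.comp_aemeasurable hs)]
  have hDF : AEMeasurable ((fun z => ENNReal.ofReal (g.totalDensity ρ δ i z)) *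
      fun z => F ((𝒜.chart i).symm z)) _ := hD.mul (hF.comp_aemeasurable hs)
  rw [e] at hDF ⊢
  rw [lintegral_prod_symm _ hDF]
  rfl

variable [∀ i, TopologicalSpace.MetrizableSpace (T i)] [∀ i, LocallyCompactSpace (T i)]

lemma isLocallyFiniteMeasure_transverseMeasure (hδ : 𝒜.IsContinuousCocycle δ)
    (hρ : ρ.IsSubordinate fun i => (𝒜.chart i).source)
    (hρr : ∀ i, 𝒜.TangentiallyContDiff r (ρ i)) (i : ι) (μ : Measure M) [IsFiniteMeasure μ] :
    IsLocallyFiniteMeasure (g.transverseMeasure ρ δ μ i) := by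
  refine ⟨fun y => ?_⟩
  obtain ⟨K, hK, hy⟩ := exists_compact_mem_nhds y
  refine ⟨K, hy, ?_⟩
  set Q := Metric.closedBall (0 : Model d) (𝒜.radius i / 2) with hQ
  have hsub : Q ×ˢ K ⊆ (𝒜.chart i).target := fun z hz => 𝒜.mem_target.2
    (Metric.closedBall_subset_ball (by linarith [𝒜.radius_pos i]) hz.1)
  have hcont : ContinuousOn (fun z : Model d × T i => kernel 𝒜 i z.1 / g.totalDensity ρ δ i z)
      (Q ×ˢ K) :=
    (((continuous_kernel i).comp continuous_fst).continuousOn.div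
      (g.continuousOn_totalDensity hδ hρ hρr i) fun z hz => (g.totalDensity_pos hz).ne').mono hsub
  -- Over `K` the weight is bounded on `Q` by `B` and vanishes off `Q`, so the finite measure μ
  -- bounds the transverse mass of `K`.
  obtain ⟨B, hB⟩ := ((isCompact_closedBall _ _).prod hK).exists_bound_of_continuousOn hcont
  rw [← lintegral_indicator_one hK.isClosed.measurableSet,
    g.lintegral_transverseMeasure hδ hρ hρr i μ
      (measurable_one.indicator hK.isClosed.measurableSet)]
  refine ENNReal.mul_lt_top (ENNReal.inv_lt_top.2
    (pos_iff_ne_zero.2 (lintegral_kernel_ne_zero i))) ?_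
  refine lt_of_le_of_lt (lintegral_mono (g := fun _ => ENNReal.ofReal B) fun p => ?_) ?_
  · by_cases hpK : (𝒜.chart i p).2 ∈ K
    · rw [indicator_of_mem hpK, Pi.one_apply, mul_one]
      by_cases hpQ : (𝒜.chart i p).1 ∈ Q
      · exact ENNReal.ofReal_le_ofReal ((le_abs_self _).trans (hB (𝒜.chart i p) ⟨hpQ, hpK⟩))
      · rw [kernel_eq_zero hpQ, zero_div, ENNReal.ofReal_zero]
        exact zero_le
    · rw [indicator_of_notMem hpK, mul_zero]
      exact zero_le
  · rw [lintegral_const]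
    exact ENNReal.mul_lt_top ENNReal.ofReal_lt_top (measure_lt_top _ _)

variable [CompactSpace M] [T2Space M] {h : M → ℝ} {y : ℕ → Σ i, T i} {V : ℕ → Set M}

/-- A limit of averaging measures and its plaque product integrate the same functions alike. -/
lemma IsAveragingLimit.lintegral_eq (hd : 1 ≤ d) (hr : 1 ≤ r) (hδ : 𝒜.IsContinuousCocycle δ)
    (hρ : ρ.IsSubordinate fun i => (𝒜.chart i).source)
    (hρr : ∀ i, 𝒜.TangentiallyContDiff r (ρ i))
    (hV : g.IsAveragingSequence ρ (𝒜.modularForm ρ δ) h y V) {μ : Measure M}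
    (hμ : g.IsAveragingLimit ρ h y V μ) {i : ι} {f : M → ℝ} (hf : Continuous f)
    (hf0 : ∀ p, 0 ≤ f p) (hfi : tsupport f ⊆ (𝒜.chart i).source) :
    ∫⁻ p, ENNReal.ofReal (f p) ∂μ =
      ∫⁻ p, ENNReal.ofReal (f p) ∂(g.plaqueProduct ρ δ i (g.transverseMeasure ρ δ μ i)) := by
  have := hμ.1
  have := g.isLocallyFiniteMeasure_transverseMeasure hδ hρ hρr i μ
  obtain ⟨R, hR0, hR, K, hK, hRK⟩ := exists_compact_prod (R₀ := 𝒜.radius i / 2)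
    (isClosed_tsupport f).isCompact hfi (by linarith [𝒜.radius_pos i])
  have hsupp : ∀ p ∈ (𝒜.chart i).source, f p ≠ 0 →
      (𝒜.chart i p).1 ∈ Metric.closedBall 0 R ∧ (𝒜.chart i p).2 ∈ K :=
    fun p _ hp => hRK p (subset_tsupport f hp)
  have hfz : ∀ p ∉ (𝒜.chart i).source, f p = 0 := fun p hp =>
    image_eq_zero_of_notMem_tsupport fun h' => hp (hfi h')
  have hQd : Metric.closedBall (0 : Model d) R ⊆ 𝒜.disc i := Metric.closedBall_subset_ball hR
  have key := IsAveragingLimit.lintegral_spread g hd hr hδ hρ hρr hV hμ hf hf0 hfz hR0 hR hK hsupp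
  have hP := g.continuous_plaqueIntegral hδ hρ hρr hf (isCompact_closedBall _ _) hQd hK hsupp
  have hE : ∀ y, ENNReal.ofReal (g.plaqueIntegral ρ δ i f y) =
      ∫⁻ x, ENNReal.ofReal (g.chartDensity ρ δ i f (x, y)) := fun y =>
    ofReal_integral_eq_lintegral_ofReal
      (g.integrable_chartDensity hδ hρ hρr hf (isCompact_closedBall _ _) hQd hK hsupp y)
      (Eventually.of_forall fun x => g.chartDensity_nonneg hf0 _)
  rw [g.lintegral_plaqueProduct hδ hρ hρr i _ hf.measurable.ennreal_ofReal]
  have e1 : ∀ y, ∫⁻ x in 𝒜.disc i, ENNReal.ofReal (g.totalDensity ρ δ i (x, y)) *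
      ENNReal.ofReal (f (𝒜.plaqueMap ⟨i, y⟩ x)) = ENNReal.ofReal (g.plaqueIntegral ρ δ i f y) := by
    intro y
    rw [hE, ← lintegral_indicator (𝒜.isOpen_disc i).measurableSet]
    refine lintegral_congr fun x => ?_
    by_cases hx : x ∈ 𝒜.disc i
    · rw [indicator_of_mem hx, g.chartDensity_of_mem hx, ENNReal.ofReal_mul
        (g.totalDensity_pos ((𝒜.mem_target (z := (x, y))).2 hx)).le]
    · rw [indicator_of_notMem hx, g.chartDensity_of_notMem hx, ENNReal.ofReal_zero]
  rw [lintegral_congr e1, g.lintegral_transverseMeasure hδ hρ hρr i μ hP.measurable.ennreal_ofReal,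
    ← lintegral_indicator (𝒜.chart i).open_source.measurableSet]
  -- The transverse measure is chosen so that integrating I_f against it gives ∫ spread dμ / ∫κ; the
  -- identity `key` turns this into ∫ f dμ.
  have e2 : ∀ p, (𝒜.chart i).source.indicator (fun p => ENNReal.ofReal
      (kernel 𝒜 i (𝒜.chart i p).1 / g.totalDensity ρ δ i (𝒜.chart i p)) *
        ENNReal.ofReal (g.plaqueIntegral ρ δ i f (𝒜.chart i p).2)) p =
      ENNReal.ofReal (g.spread ρ δ i f p) := by
    intro p
    by_cases hp : p ∈ (𝒜.chart i).source
    · rw [indicator_of_mem hp, spread, if_pos hp, ← ENNReal.ofReal_mul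
        (div_nonneg (kernel_nonneg _ _) (g.totalDensity_pos ((𝒜.chart i).map_source hp)).le)]
      congr 1
      ring
    · rw [indicator_of_notMem hp, spread, if_neg hp, ENNReal.ofReal_zero]
  rw [lintegral_congr e2, key, ← mul_assoc,
    ENNReal.inv_mul_cancel (lintegral_kernel_ne_zero i) (lintegral_kernel_ne_top i), one_mul]

/-- Near each point of the chart, the two measures multiplied by a tent function are finite and
agree on continuous functions, hence are equal; a countable subcover glues the local equalities. -/
lemma IsAveragingLimit.measure_eq (hd : 1 ≤ d) (hr : 1 ≤ r)
    (hδ : 𝒜.IsContinuousCocycle δ) (hρ : ρ.IsSubordinate fun i => (𝒜.chart i).source)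
    (hρr : ∀ i, 𝒜.TangentiallyContDiff r (ρ i))
    (hV : g.IsAveragingSequence ρ (𝒜.modularForm ρ δ) h y V) {μ : Measure M}
    (hμ : g.IsAveragingLimit ρ h y V μ) {i : ι} {B : Set M} (hB : B ⊆ (𝒜.chart i).source) :
    μ B = g.plaqueProduct ρ δ i (g.transverseMeasure ρ δ μ i) B := by
  have := hμ.1
  have := 𝒜.metrizableSpace
  have := 𝒜.secondCountableTopology
  let _ := TopologicalSpace.metrizableSpaceMetric M
  set μ' := g.plaqueProduct ρ δ i (g.transverseMeasure ρ δ μ i) with hμ'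
  -- The hypothesis on `p` is placed inside the existential so that `choose` gives a family indexed
  -- by all of `M`.
  have hloc : ∀ p : M, ∃ W : Set M, p ∈ (𝒜.chart i).source →
      W ∈ 𝓝[(𝒜.chart i).source] p ∧ μ.restrict W = μ'.restrict W := by
    intro p
    by_cases hp : p ∈ (𝒜.chart i).source
    swap
    · exact ⟨∅, fun h' => (hp h').elim⟩
    obtain ⟨ε, hε, hsub⟩ := Metric.nhds_basis_closedBall.mem_iff.1
      ((𝒜.chart i).open_source.mem_nhds hp)
    let f : M → ℝ := fun q => max 0 (ε - dist q p)
    have hf : Continuous f := by fun_prop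
    have hf0 : ∀ q, 0 ≤ f q := fun q => le_max_left _ _
    have hfz : ∀ q ∉ Metric.closedBall p ε, f q = 0 := fun q hq => by
      rw [Metric.mem_closedBall, not_le] at hq
      exact max_eq_left (by linarith)
    refine ⟨Metric.ball p ε, fun _ => ⟨mem_nhdsWithin_of_mem_nhds (Metric.ball_mem_nhds p hε),
      restrict_eq_of_withDensity_eq (f := fun q => ENNReal.ofReal (f q))
        hf.measurable.ennreal_ofReal (fun _ => ENNReal.ofReal_ne_top)
        Metric.isOpen_ball.measurableSet ?_ ?_⟩⟩
    · intro q hq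
      rw [Metric.mem_ball] at hq
      exact (ENNReal.ofReal_pos.2 (lt_max_of_lt_right (by linarith))).ne'
    · have hfin : IsFiniteMeasure (μ.withDensity fun q => ENNReal.ofReal (f q)) :=
        isFiniteMeasure_withDensity_ofReal
          (hf.integrable_of_hasCompactSupport (HasCompactSupport.of_compactSpace _)).2
      refine ext_of_forall_lintegral_eq_of_IsFiniteMeasure fun u => ?_
      have hu : Measurable fun x => (u x : ℝ≥0∞) := u.continuous.measurable.coe_nnreal_ennreal
      rw [lintegral_withDensity_eq_lintegral_mul _ hf.measurable.ennreal_ofReal hu,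
        lintegral_withDensity_eq_lintegral_mul _ hf.measurable.ennreal_ofReal hu]
      have hcon : Continuous fun q => f q * (u q : ℝ) :=
        hf.mul (NNReal.continuous_coe.comp u.continuous)
      have e : ((fun q => ENNReal.ofReal (f q)) * fun x => (u x : ℝ≥0∞)) =
          fun q => ENNReal.ofReal (f q * (u q : ℝ)) := by
        funext q
        rw [Pi.mul_apply, ENNReal.ofReal_mul (hf0 q), ENNReal.ofReal_coe_nnreal]
      rw [e]
      refine IsAveragingLimit.lintegral_eq g hd hr hδ hρ hρr hV hμ hcon
        (fun q => mul_nonneg (hf0 q) (u q).2) (subset_trans ?_ hsub)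
      refine closure_minimal (fun q hq => ?_) Metric.isClosed_closedBall
      by_contra hq'
      exact hq (by simp [hfz q hq'])
  choose W hW using hloc
  obtain ⟨t, hts, htc, hcov⟩ := TopologicalSpace.countable_cover_nhdsWithin
    (f := W) (s := (𝒜.chart i).source) fun p hp => (hW p hp).1
  have hres := (Measure.restrict_biUnion_congr (μ := μ) (ν := μ') (t := W) htc).2
    fun p hp => (hW p (hts hp)).2
  rw [← Measure.restrict_eq_self μ (hB.trans hcov), hres,
    Measure.restrict_eq_self μ' (hB.trans hcov)]

open Classical in
/-- The local decompositions of a limit of averaging measures. -/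
lemma IsAveragingLimit.isLocalDecomposition (hd : 1 ≤ d) (hr : 1 ≤ r)
    (hδ : 𝒜.IsContinuousCocycle δ) (hρ : ρ.IsSubordinate fun i => (𝒜.chart i).source)
    (hρr : ∀ i, 𝒜.TangentiallyContDiff r (ρ i))
    (hV : g.IsAveragingSequence ρ (𝒜.modularForm ρ δ) h y V) {μ : Measure M}
    (hμ : g.IsAveragingLimit ρ h y V μ) (i : ι) :
    g.IsLocalDecomposition μ i (g.transverseMeasure ρ δ μ i)
      fun z => if z ∈ (𝒜.chart i).target then 𝒜.primitive ρ δ i z else 0 := by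
  have := hμ.1
  have hfin := g.isLocallyFiniteMeasure_transverseMeasure hδ hρ hρr i μ
  refine ⟨hfin, ?_, fun z => ?_, fun B hB hBi => ?_⟩
  · exact (continuousOn_primitive hδ hρ hρr i).measurable_piecewise continuousOn_const
      (𝒜.chart i).open_target.measurableSet
  · split_ifs
    · exact (primitive_pos _ _).le
    · exact le_rfl
  · rw [IsAveragingLimit.measure_eq g hd hr hδ hρ hρr hV hμ hBi,
      ← lintegral_indicator_one hB,
      g.lintegral_plaqueProduct hδ hρ hρr i _ (measurable_one.indicator hB)]
    refine lintegral_congr fun y => ?_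
    have hAm : MeasurableSet (𝒜.disc i ∩ 𝒜.plaqueMap ⟨i, y⟩ ⁻¹' B) := by
      have := (𝒜.continuousOn_plaqueMap ⟨i, y⟩).measurable_piecewise
        (g := fun _ => 𝒜.base ⟨i, y⟩) continuousOn_const (𝒜.isOpen_disc i).measurableSet
      convert (𝒜.isOpen_disc i).measurableSet.inter (this hB) using 1
      ext x
      simp +contextual [Set.piecewise]
    rw [← lintegral_indicator (𝒜.isOpen_disc i).measurableSet, ← lintegral_indicator hAm]
    refine lintegral_congr fun x => ?_
    by_cases hx : x ∈ 𝒜.disc i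
    · by_cases hxB : 𝒜.plaqueMap ⟨i, y⟩ x ∈ B
      · rw [indicator_of_mem hx, indicator_of_mem hxB, indicator_of_mem (mem_inter hx hxB),
          if_pos ((𝒜.mem_target (z := (x, y))).2 hx), Pi.one_apply, mul_one]
        rfl
      · rw [indicator_of_mem hx, indicator_of_notMem hxB, indicator_of_notMem fun h => hxB h.2,
          mul_zero]
    · rw [indicator_of_notMem hx, indicator_of_notMem fun h => hx h.1]

open Classical in
lemma IsAveragingLimit.hasModularForm (hd : 1 ≤ d) (hr : 1 ≤ r)
    (hδ : 𝒜.IsContinuousCocycle δ) (hρ : ρ.IsSubordinate fun i => (𝒜.chart i).source)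
    (hρr : ∀ i, 𝒜.TangentiallyContDiff r (ρ i))
    (hV : g.IsAveragingSequence ρ (𝒜.modularForm ρ δ) h y V) {μ : Measure M}
    (hμ : g.IsAveragingLimit ρ h y V μ) : g.HasModularForm μ (𝒜.modularForm ρ δ) := by
  intro i
  refine ⟨_, _, IsAveragingLimit.isLocalDecomposition g hd hr hδ hρ hρr hV hμ i,
    Eventually.of_forall fun y => ?_⟩
  have e : ∀ x ∈ 𝒜.disc i, (if (x, y) ∈ (𝒜.chart i).target then 𝒜.primitive ρ δ i (x, y) else 0) =
      𝒜.primitive ρ δ i (x, y) := fun x hx => by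
    rw [if_pos ((𝒜.mem_target (z := (x, y))).2 hx)]
  refine ⟨((contDiffOn_primitive hρr i y).of_le ?_).congr e, fun x hx => ⟨?_, ?_⟩⟩
  · exact_mod_cast tsub_le_self
  · rw [e x hx]
    exact primitive_pos _ _
  · refine (hasFDerivAt_logPrimitive hr hρ hρr hx).congr_of_eventuallyEq ?_
    filter_upwards [(𝒜.isOpen_disc i).mem_nhds hx] with x' hx'
    rw [e x' hx', primitive, Real.log_exp]

end LeafwiseMetric

/-! ### Tangential regularity of products, determinants and inverse matrices -/

section TangentialRegularity

variable {d : ℕ} {Y : Type*}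

/-- The derivative of `F(x, y)` in the tangential direction `v`. -/
def tangentialDeriv (F : Model d × Y → ℝ) (v : Model d) (z : Model d × Y) : ℝ :=
  fderiv ℝ (fun x => F (x, z.2)) z.1 v

variable {F G : Model d × Y → ℝ}

lemma tangentialDeriv_add {v : Model d} {z : Model d × Y}
    (hF : DifferentiableAt ℝ (fun x => F (x, z.2)) z.1)
    (hG : DifferentiableAt ℝ (fun x => G (x, z.2)) z.1) :
    tangentialDeriv (fun z => F z + G z) v z = tangentialDeriv F v z + tangentialDeriv G v z := by
  simp only [tangentialDeriv]
  rw [fderiv_fun_add hF hG]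
  rfl

lemma tangentialDeriv_mul {v : Model d} {z : Model d × Y}
    (hF : DifferentiableAt ℝ (fun x => F (x, z.2)) z.1)
    (hG : DifferentiableAt ℝ (fun x => G (x, z.2)) z.1) :
    tangentialDeriv (fun z => F z * G z) v z =
      F z * tangentialDeriv G v z + G z * tangentialDeriv F v z := by
  simp only [tangentialDeriv]
  rw [fderiv_fun_mul hF hG]
  rfl

lemma tangentialDeriv_comp {φ : ℝ → ℝ} {v : Model d} {z : Model d × Y}
    (hF : DifferentiableAt ℝ (fun x => F (x, z.2)) z.1) (hφ : DifferentiableAt ℝ φ (F z)) :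
    tangentialDeriv (fun z => φ (F z)) v z = deriv φ (F z) * tangentialDeriv F v z := by
  have := (HasDerivAt.comp_hasFDerivAt z.1 (f := fun x => F (x, z.2)) hφ.hasDerivAt
    hF.hasFDerivAt).fderiv
  simp only [tangentialDeriv]
  change fderiv ℝ (φ ∘ fun x => F (x, z.2)) z.1 v = _
  rw [this]
  rfl

variable [TopologicalSpace Y]

/-- `F` is differentiable in the tangential variable at the points of `W`, and continuous on `W`
together with its tangential derivatives. -/
structure TangentiallyC1On (F : Model d × Y → ℝ) (W : Set (Model d × Y)) : Prop where
  differentiableAt : ∀ z ∈ W, DifferentiableAt ℝ (fun x => F (x, z.2)) z.1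
  continuousOn : ContinuousOn F W
  continuousOn_deriv : ∀ v, ContinuousOn (tangentialDeriv F v) W

/-- `F` and its tangential derivatives are of class `C^1` in the tangential variable. -/
structure TangentiallyC2On (F : Model d × Y → ℝ) (W : Set (Model d × Y)) : Prop where
  c1 : TangentiallyC1On F W
  deriv_c1 : ∀ v, TangentiallyC1On (tangentialDeriv F v) W

variable {W : Set (Model d × Y)}

namespace TangentiallyC1On

lemma mono (hF : TangentiallyC1On F W) {W' : Set (Model d × Y)} (h : W' ⊆ W) :
    TangentiallyC1On F W' :=
  ⟨fun z hz => hF.1 z (h hz), hF.2.mono h, fun v => (hF.3 v).mono h⟩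

lemma congr (hF : TangentiallyC1On F W) (hW : ∀ z ∈ W, ∀ᶠ x in 𝓝 z.1, (x, z.2) ∈ W)
    (h : ∀ z ∈ W, G z = F z) : TangentiallyC1On G W := by
  have key : ∀ z ∈ W, (fun x => G (x, z.2)) =ᶠ[𝓝 z.1] fun x => F (x, z.2) := fun z hz =>
    (hW z hz).mono fun x hx => h _ hx
  refine ⟨fun z hz => (hF.1 z hz).congr_of_eventuallyEq (key z hz), hF.2.congr h, fun v =>
    (hF.3 v).congr fun z hz => ?_⟩
  rw [tangentialDeriv, (key z hz).fderiv_eq]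
  rfl

lemma const (c : ℝ) : TangentiallyC1On (fun _ : Model d × Y => c) W :=
  ⟨fun _ _ => differentiableAt_const _, continuousOn_const, fun v => by
    have : tangentialDeriv (fun _ : Model d × Y => c) v = fun _ => 0 := by
      funext z
      simp [tangentialDeriv]
    rw [this]
    exact continuousOn_const⟩

lemma add (hF : TangentiallyC1On F W) (hG : TangentiallyC1On G W) :
    TangentiallyC1On (fun z => F z + G z) W :=
  ⟨fun z hz => (hF.1 z hz).add (hG.1 z hz), hF.2.add hG.2, fun v =>
    ((hF.3 v).add (hG.3 v)).congr fun z hz => tangentialDeriv_add (hF.1 z hz) (hG.1 z hz)⟩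

lemma mul (hF : TangentiallyC1On F W) (hG : TangentiallyC1On G W) :
    TangentiallyC1On (fun z => F z * G z) W :=
  ⟨fun z hz => (hF.1 z hz).mul (hG.1 z hz), hF.2.mul hG.2, fun v =>
    ((hF.2.mul (hG.3 v)).add (hG.2.mul (hF.3 v))).congr fun z hz =>
      tangentialDeriv_mul (hF.1 z hz) (hG.1 z hz)⟩

lemma sum {α : Type*} {s : Finset α} {f : α → Model d × Y → ℝ}
    (h : ∀ a ∈ s, TangentiallyC1On (f a) W) : TangentiallyC1On (fun z => ∑ a ∈ s, f a z) W := by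
  classical
  induction s using Finset.induction_on with
  | empty => simpa using const (W := W) 0
  | insert a s ha ih =>
    simp only [Finset.sum_insert ha]
    exact (h a (Finset.mem_insert_self _ _)).add
      (ih fun b hb => h b (Finset.mem_insert_of_mem hb))

lemma prod {α : Type*} {s : Finset α} {f : α → Model d × Y → ℝ}
    (h : ∀ a ∈ s, TangentiallyC1On (f a) W) : TangentiallyC1On (fun z => ∏ a ∈ s, f a z) W := by
  classical
  induction s using Finset.induction_on with
  | empty => simpa using const (W := W) 1
  | insert a s ha ih =>
    simp only [Finset.prod_insert ha]
    exact (h a (Finset.mem_insert_self _ _)).mul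
      (ih fun b hb => h b (Finset.mem_insert_of_mem hb))

lemma comp (hF : TangentiallyC1On F W) {φ : ℝ → ℝ} (hφ : ∀ z ∈ W, ContDiffAt ℝ 1 φ (F z)) :
    TangentiallyC1On (fun z => φ (F z)) W := by
  have hd : ∀ z ∈ W, DifferentiableAt ℝ φ (F z) := fun z hz =>
    (hφ z hz).differentiableAt one_ne_zero
  refine ⟨fun z hz => (hd z hz).comp z.1 (hF.1 z hz), fun z hz =>
    (hφ z hz).continuousAt.comp_continuousWithinAt (hF.2 z hz), fun v => ?_⟩
  refine ContinuousOn.congr (f := fun z => deriv φ (F z) * tangentialDeriv F v z)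
    (ContinuousOn.mul (fun z hz => ?_) (hF.3 v))
    fun z hz => tangentialDeriv_comp (hF.1 z hz) (hd z hz)
  have h1 : ContinuousAt (fderiv ℝ φ) (F z) :=
    ((hφ z hz).fderiv_right (m := 0) (by norm_num)).continuousAt
  have h2 : ContinuousAt (deriv φ) (F z) := by
    have : deriv φ = fun x => fderiv ℝ φ x 1 := by
      funext x
      rw [fderiv_apply_one_eq_deriv]
    rw [this]
    exact h1.clm_apply continuousAt_const
  exact h2.comp_continuousWithinAt (hF.2 z hz)

lemma det {n : Type*} [Fintype n] [DecidableEq n] {A : Model d × Y → Matrix n n ℝ}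
    (h : ∀ a b, TangentiallyC1On (fun z => A z a b) W) :
    TangentiallyC1On (fun z => (A z).det) W := by
  simp only [Matrix.det_apply']
  exact sum fun σ _ => (const _).mul (prod fun a _ => h _ _)

/-- By Cramer's rule the entries of the inverse are quotients of determinants. -/
lemma matrix_inv {n : Type*} [Fintype n] [DecidableEq n] {A : Model d × Y → Matrix n n ℝ}
    (h : ∀ a b, TangentiallyC1On (fun z => A z a b) W) (hA : ∀ z ∈ W, (A z).det ≠ 0) (a b : n) :
    TangentiallyC1On (fun z => (A z)⁻¹ a b) W := by
  have e : (fun z => (A z)⁻¹ a b) = fun z =>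
      ((A z).det)⁻¹ * ((A z).updateRow b (Pi.single a 1)).det := by
    funext z
    rw [Matrix.inv_def, Matrix.smul_apply, Ring.inverse_eq_inv', Matrix.adjugate_apply,
      smul_eq_mul]
  rw [e]
  refine ((det h).comp fun z hz => contDiffAt_inv ℝ (hA z hz)).mul (det fun c e => ?_)
  by_cases hc : c = b
  · subst hc
    simpa [Matrix.updateRow_self] using const _
  · simpa [Matrix.updateRow_ne hc] using h c e

end TangentiallyC1On

lemma TangentiallyContDiffOn.clm_comp {E : Type*} [NormedAddCommGroup E] [NormedSpace ℝ E]
    {n : ℕ∞} {f : Model d × Y → E} (hf : TangentiallyContDiffOn n f W)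
    (hW : ∀ y, IsOpen {x | (x, y) ∈ W}) (L : E →L[ℝ] ℝ) :
    TangentiallyContDiffOn n (fun z => L (f z)) W := by
  refine ⟨fun y => L.contDiff.comp_contDiffOn (hf.1 y), fun k hk => ?_⟩
  refine ContinuousOn.congr (f := fun z : Model d × Y => L.compContinuousMultilinearMap
    (iteratedFDeriv ℝ k (fun x => f (x, z.2)) z.1)) ?_ fun z hz => ?_
  · exact ((ContinuousLinearMap.compContinuousMultilinearMapL ℝ (fun _ : Fin k => Model d) E ℝ L
      ).continuous).comp_continuousOn (hf.2 k hk)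
  · have : ContDiffAt ℝ n (fun x => f (x, z.2)) z.1 :=
      (hf.1 z.2).contDiffAt ((hW z.2).mem_nhds hz)
    exact L.iteratedFDeriv_comp_left this (by exact_mod_cast hk)

lemma TangentiallyContDiffOn.tangentiallyC1On {n : ℕ∞} (hn : 1 ≤ n)
    (hF : TangentiallyContDiffOn n F W) (hW : ∀ y, IsOpen {x | (x, y) ∈ W}) :
    TangentiallyC1On F W := by
  refine ⟨fun z hz => ((hF.1 z.2).contDiffAt ((hW z.2).mem_nhds hz)).differentiableAt ?_, ?_,
    fun v => ?_⟩
  · have : n ≠ 0 := by rintro rfl; simp at hn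
    exact_mod_cast this
  · refine ((ContinuousMultilinearMap.apply ℝ (fun _ : Fin 0 => Model d) ℝ
      (fun _ => 0)).continuous.comp_continuousOn (hF.2 0 (by simp))).congr fun z hz => ?_
    simp
  · refine ((ContinuousMultilinearMap.apply ℝ (fun _ : Fin 1 => Model d) ℝ
      (fun _ => v)).continuous.comp_continuousOn (hF.2 1 (by exact_mod_cast hn))).congr
        fun z hz => ?_
    simp [tangentialDeriv]

lemma TangentiallyContDiffOn.tangentiallyC2On {n : ℕ∞} (hn : 2 ≤ n)
    (hF : TangentiallyContDiffOn n F W) (hW : ∀ y, IsOpen {x | (x, y) ∈ W}) :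
    TangentiallyC2On F W := by
  have hn1 : 1 ≤ n := le_trans (by norm_num) hn
  have h1 := hF.tangentiallyC1On hn1 hW
  have hd : ∀ z ∈ W, DifferentiableAt ℝ (fderiv ℝ fun x => F (x, z.2)) z.1 := fun z hz => by
    have := (hF.1 z.2).contDiffAt ((hW z.2).mem_nhds hz)
    refine (this.fderiv_right (m := 1) ?_).differentiableAt one_ne_zero
    have : ((2 : ℕ∞) : WithTop ℕ∞) ≤ n := by exact_mod_cast hn
    exact (by norm_num : (1 : WithTop ℕ∞) + 1 ≤ 2).trans this
  refine ⟨h1, fun v => ⟨fun z hz => (hd z hz).clm_apply (differentiableAt_const _), h1.3 v,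
    fun w => ?_⟩⟩
  refine ((ContinuousMultilinearMap.apply ℝ (fun _ : Fin 2 => Model d) ℝ
      ![w, v]).continuous.comp_continuousOn (hF.2 2 (by exact_mod_cast hn))).congr fun z hz => ?_
  have : tangentialDeriv (tangentialDeriv F v) w z =
      fderiv ℝ (fun x => fderiv ℝ (fun x => F (x, z.2)) x v) z.1 w := rfl
  rw [this, fderiv_clm_apply (hd z hz) (differentiableAt_const _)]
  simp [iteratedFDeriv_two_apply]

namespace TangentiallyC2On

lemma mul (hF : TangentiallyC2On F W) (hG : TangentiallyC2On G W)
    (hW : ∀ z ∈ W, ∀ᶠ x in 𝓝 z.1, (x, z.2) ∈ W) : TangentiallyC2On (fun z => F z * G z) W :=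
  ⟨hF.1.mul hG.1, fun v => ((hF.1.mul (hG.2 v)).add (hG.1.mul (hF.2 v))).congr hW fun z hz =>
    tangentialDeriv_mul (hF.1.1 z hz) (hG.1.1 z hz)⟩

lemma exp (hF : TangentiallyC2On F W) (hW : ∀ z ∈ W, ∀ᶠ x in 𝓝 z.1, (x, z.2) ∈ W) :
    TangentiallyC2On (fun z => Real.exp (F z)) W := by
  have h1 := hF.1.comp (φ := Real.exp) fun z _ => Real.contDiff_exp.contDiffAt
  refine ⟨h1, fun v => (h1.mul (hF.2 v)).congr hW fun z hz => ?_⟩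
  rw [tangentialDeriv_comp (hF.1.1 z hz) Real.differentiableAt_exp, Real.deriv_exp]

end TangentiallyC2On

end TangentialRegularity

/-! ### Integration by parts on a disc -/

section Divergence

variable {d : ℕ} {Y : Type*} [TopologicalSpace Y]

lemma integrableOn_of_eq_zero_off_compact {Ω Q : Set (Model d)} (hΩ : IsOpen Ω) (hQ : IsCompact Q)
    (hQΩ : Q ⊆ Ω) {f : Model d → ℝ} (hf : ContinuousOn f Ω) (h0 : ∀ x ∈ Ω \ Q, f x = 0) :
    IntegrableOn f Ω :=
  ((hf.mono hQΩ).integrableOn_compact hQ).of_forall_sdiff_eq_zero hΩ.measurableSet h0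

/-- The integral of a derivative of a compactly supported function vanishes. -/
lemma setIntegral_fderiv_eq_zero {Ω Q : Set (Model d)} (hΩ : IsOpen Ω) (hQ : IsCompact Q)
    (hQΩ : Q ⊆ Ω) {X : Model d → ℝ} (hX : ∀ x ∈ Ω, DifferentiableAt ℝ X x) {v : Model d}
    (hX' : ContinuousOn (fun x => fderiv ℝ X x v) Ω) (h0 : ∀ x ∈ Ω \ Q, X x = 0) :
    ∫ x in Ω, fderiv ℝ X x v = 0 := by
  -- The extension by zero is differentiable everywhere with a continuous, compactly supported
  -- derivative in the direction `v`, so integration by parts against the constant 1 applies.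
  set Z : Model d → ℝ := Ω.indicator X with hZ
  have hZΩ : ∀ x ∈ Ω, Z =ᶠ[𝓝 x] X := fun x hx => by
    filter_upwards [hΩ.mem_nhds hx] with x' hx'
    exact indicator_of_mem hx' X
  have hZ0 : ∀ x ∉ Q, Z x = 0 := fun x hx => by
    by_cases hx' : x ∈ Ω
    · rw [hZ, indicator_of_mem hx', h0 x ⟨hx', hx⟩]
    · exact indicator_of_notMem hx' X
  have hZQ : ∀ x ∉ Q, Z =ᶠ[𝓝 x] fun _ => 0 := fun x hx => by
    filter_upwards [hQ.isClosed.isOpen_compl.mem_nhds hx] with x' hx'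
    exact hZ0 x' hx'
  have hdiff : Differentiable ℝ Z := fun x => by
    by_cases hx : x ∈ Q
    · exact (hX x (hQΩ hx)).congr_of_eventuallyEq (hZΩ x (hQΩ hx))
    · exact (differentiableAt_const (0 : ℝ)).congr_of_eventuallyEq (hZQ x hx)
  have hd0 : ∀ x ∉ Q, fderiv ℝ Z x v = 0 := fun x hx => by
    rw [(hZQ x hx).fderiv_eq]
    simp
  have hcont : Continuous fun x => fderiv ℝ Z x v := by
    refine continuous_of_eq_zero_off_compact hΩ hQ hQΩ (hX'.congr fun x hx => ?_) hd0
    rw [(hZΩ x hx).fderiv_eq]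
  have i1 : Integrable Z := hdiff.continuous.integrable_of_hasCompactSupport
    (HasCompactSupport.intro hQ hZ0)
  have i2 : Integrable fun x => fderiv ℝ Z x v := hcont.integrable_of_hasCompactSupport
    (HasCompactSupport.intro hQ hd0)
  have key := integral_mul_fderiv_eq_neg_fderiv_mul_of_integrable (μ := volume) (f := Z)
    (g := fun _ => (1 : ℝ)) (v := v) (by simpa using i2) (by simp) (by simpa using i1)
    (fun x _ => hdiff x) fun x _ => differentiableAt_const _
  simp only [mul_one, fderiv_fun_const, Pi.zero_apply, zero_apply, mul_zero,
    integral_zero] at key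
  have e : ∫ x in Ω, fderiv ℝ X x v = ∫ x in Ω, fderiv ℝ Z x v :=
    setIntegral_congr_fun hΩ.measurableSet fun x hx => by
      rw [(hZΩ x hx).fderiv_eq]
  rw [e, setIntegral_eq_integral_of_forall_compl_eq_zero fun x hx => hd0 x fun h => hx (hQΩ h)]
  linarith

/-- A function on a single plaque is treated as one on Ω × {y}, so that the regularity of the flux
is proved only once, for families. -/
lemma tangentiallyC2On_slice {Ω : Set (Model d)} (hΩ : IsOpen Ω) {u : Model d → ℝ}
    (hu : ContDiffOn ℝ 2 u Ω) (y : Y) :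
    TangentiallyC2On (fun z : Model d × Y => u z.1) (Ω ×ˢ {y}) := by
  refine TangentiallyContDiffOn.tangentiallyC2On (n := 2) le_rfl
    ⟨fun y' => ContDiffOn.mono (s := Ω) (by exact_mod_cast hu) fun x hx => hx.1, fun k hk => ?_⟩
    fun y' => ?_
  · have h1 := hu.continuousOn_iteratedFDerivWithin (m := k) (by exact_mod_cast hk)
      hΩ.uniqueDiffOn
    have h2 := h1.comp (s := Ω ×ˢ {y}) continuous_fst.continuousOn fun z hz => hz.1
    exact h2.congr fun z hz => (iteratedFDerivWithin_of_isOpen k hΩ hz.1).symm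
  · by_cases h : y' = y
    · simpa [h] using hΩ
    · simp [h]

lemma continuousOn_slice {Ω : Set (Model d)} {F : Model d × Y → ℝ} {y : Y}
    (hF : ContinuousOn F (Ω ×ˢ {y})) : ContinuousOn (fun x => F (x, y)) Ω :=
  hF.comp (Continuous.prodMk_left y).continuousOn fun _ hx => ⟨hx, rfl⟩

end Divergence

/-! ### The Laplace operator: weak form and Green's formula -/

namespace LeafwiseMetric

open FoliatedAtlas

variable {M : Type*} [TopologicalSpace M] {d : ℕ} {r : ℕ∞} {ι : Type*} {T : ι → Type*}
  [∀ i, TopologicalSpace (T i)] {𝒜 : FoliatedAtlas M d r T} (g : LeafwiseMetric 𝒜)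

/-- The components of the gradient of `u`, multiplied by the volume density. -/
def flux (i : ι) (u : Model d × T i → ℝ) (a : Fin d) (z : Model d × T i) : ℝ :=
  g.volDensity i z * ∑ b, (g.gram i z)⁻¹ a b * tangentialDeriv u (stdVec b) z

/-- The inner product of two covectors. -/
def pairing (i : ι) (z : Model d × T i) (α β : Model d →L[ℝ] ℝ) : ℝ :=
  ∑ a, ∑ b, (g.gram i z)⁻¹ a b * (α (stdVec a) * β (stdVec b))

lemma plaqueLaplacian_eq (i : ι) (u : Model d × T i → ℝ) (z : Model d × T i) :
    g.plaqueLaplacian ⟨i, z.2⟩ (fun x => u (x, z.2)) z.1 =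
      (g.volDensity i z)⁻¹ * ∑ a, tangentialDeriv (g.flux i u a) (stdVec a) z := rfl

lemma plaqueLaplacian_congr {s : Σ i, T i} {u v : Model d → ℝ} {x : Model d}
    (h : u =ᶠ[𝓝 x] v) : g.plaqueLaplacian s u x = g.plaqueLaplacian s v x := by
  have hd := h.fderiv (𝕜 := ℝ)
  rw [plaqueLaplacian, plaqueLaplacian]
  congr 1
  refine Finset.sum_congr rfl fun a _ => ?_
  congr 1
  refine Filter.EventuallyEq.fderiv_eq ?_
  filter_upwards [hd] with x' hx'
  rw [hx']

section Regularity

variable {i : ι}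

lemma tangentiallyC1On_gram (hr : 2 ≤ r) (a b : Fin d) :
    TangentiallyC1On (fun z => g.gram i z a b) (𝒜.chart i).target := by
  have h := (g.smooth i).clm_comp (isOpen_slice (𝒜.chart i).open_target)
    ((ContinuousLinearMap.apply ℝ ℝ (stdVec b)).comp
      (ContinuousLinearMap.apply ℝ (Model d →L[ℝ] ℝ) (stdVec a)))
  refine h.tangentiallyC1On ?_ (isOpen_slice (𝒜.chart i).open_target)
  exact ENat.le_sub_of_add_le_right (by simp) (by norm_num; exact hr)

lemma tangentiallyC1On_gram_inv (hr : 2 ≤ r) (a b : Fin d) :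
    TangentiallyC1On (fun z => (g.gram i z)⁻¹ a b) (𝒜.chart i).target :=
  TangentiallyC1On.matrix_inv (g.tangentiallyC1On_gram hr) (fun _ hz => (g.gram_det_pos hz).ne') a b

lemma tangentiallyC1On_volDensity (hr : 2 ≤ r) :
    TangentiallyC1On (g.volDensity i) (𝒜.chart i).target :=
  (TangentiallyC1On.det (g.tangentiallyC1On_gram hr)).comp (φ := Real.sqrt) fun _ hz =>
    Real.contDiffAt_sqrt (g.gram_det_pos hz).ne'

variable {W : Set (Model d × T i)} {u : Model d × T i → ℝ}

lemma tangentiallyC1On_flux (hr : 2 ≤ r) (hW : W ⊆ (𝒜.chart i).target)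
    (hu : TangentiallyC2On u W) (a : Fin d) : TangentiallyC1On (g.flux i u a) W :=
  ((g.tangentiallyC1On_volDensity hr).mono hW).mul
    (TangentiallyC1On.sum fun b _ => ((g.tangentiallyC1On_gram_inv hr a b).mono hW).mul
      (hu.deriv_c1 (stdVec b)))

lemma continuousOn_plaqueLaplacian (hr : 2 ≤ r) (hW : W ⊆ (𝒜.chart i).target)
    (hu : TangentiallyC2On u W) :
    ContinuousOn (fun z => g.plaqueLaplacian ⟨i, z.2⟩ (fun x => u (x, z.2)) z.1) W :=
  (((g.continuousOn_volDensity i).mono hW).inv₀ fun _ hz => (g.volDensity_pos (hW hz)).ne').mul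
    (continuousOn_finsetSum _ fun a _ => (g.tangentiallyC1On_flux hr hW hu a).3 (stdVec a))

end Regularity

section Green

variable {i : ι} {y : T i} {Ω Q : Set (Model d)}

/-- The weak form of the Laplace operator. -/
lemma setIntegral_mul_plaqueLaplacian (hr : 2 ≤ r) (hΩ : IsOpen Ω) (hΩi : Ω ⊆ 𝒜.disc i)
    (hQ : IsCompact Q) (hQΩ : Q ⊆ Ω) {φ u : Model d → ℝ} (hφ : ContDiffOn ℝ 1 φ Ω)
    (hu : ContDiffOn ℝ 2 u Ω) (h0 : (∀ x ∈ Ω \ Q, φ x = 0) ∨ ∀ x ∈ Ω \ Q, u x = 0) :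
    ∫ x in Ω, g.volDensity i (x, y) * (φ x * g.plaqueLaplacian ⟨i, y⟩ u x) =
      -∫ x in Ω, g.volDensity i (x, y) * g.pairing i (x, y) (fderiv ℝ φ x) (fderiv ℝ u x) := by
  have hW : Ω ×ˢ {y} ⊆ (𝒜.chart i).target := fun z hz => 𝒜.mem_target.2 (hΩi hz.1)
  have hu2 := tangentiallyC2On_slice hΩ hu y
  have hF := g.tangentiallyC1On_flux hr hW hu2
  set F : Fin d → Model d → ℝ := fun a x => g.flux i (fun z => u z.1) a (x, y) with hFdef
  have hFd : ∀ a, ∀ x ∈ Ω, DifferentiableAt ℝ (F a) x := fun a x hx => (hF a).1 (x, y) ⟨hx, rfl⟩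
  have hFc : ∀ a, ContinuousOn (F a) Ω := fun a => continuousOn_slice (hF a).2
  have hFc' : ∀ a v, ContinuousOn (fun x => fderiv ℝ (F a) x v) Ω := fun a v =>
    continuousOn_slice ((hF a).3 v)
  have hφd : ∀ x ∈ Ω, DifferentiableAt ℝ φ x := fun x hx =>
    (hφ.contDiffAt (hΩ.mem_nhds hx)).differentiableAt one_ne_zero
  have hφc' : ∀ v, ContinuousOn (fun x => fderiv ℝ φ x v) Ω := fun v =>
    (hφ.continuousOn_fderiv_of_isOpen hΩ le_rfl).clm_apply continuousOn_const
  have hopen : IsOpen (Ω \ Q) := hΩ.sdiff hQ.isClosed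
  have hloc : ∀ {f : Model d → ℝ}, (∀ x ∈ Ω \ Q, f x = 0) → ∀ x ∈ Ω \ Q,
      f =ᶠ[𝓝 x] fun _ => 0 := fun hf x hx => by
    filter_upwards [hopen.mem_nhds hx] with x' hx'
    exact hf x' hx'
  have hloc' : ∀ {f : Model d → ℝ}, (∀ x ∈ Ω \ Q, f x = 0) → ∀ x ∈ Ω \ Q,
      fderiv ℝ f x = 0 := fun hf x hx => by
    rw [(hloc hf x hx).fderiv_eq]
    simp
  have hFu : (∀ x ∈ Ω \ Q, u x = 0) → ∀ a, ∀ x ∈ Ω \ Q, F a x = 0 := fun hu0 a x hx => by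
    have : ∀ b, tangentialDeriv (fun z : Model d × T i => u z.1) (stdVec b) (x, y) = 0 :=
      fun b => by
        change fderiv ℝ u x (stdVec b) = 0
        rw [hloc' hu0 x hx]
        rfl
    simp [hFdef, flux, this]
  -- the three products vanish off the compact set
  have z1 : ∀ a, ∀ x ∈ Ω \ Q, φ x * F a x = 0 := fun a x hx => by
    rcases h0 with h0 | h0
    · rw [h0 x hx, zero_mul]
    · rw [hFu h0 a x hx, mul_zero]
  have z2 : ∀ a v, ∀ x ∈ Ω \ Q, φ x * fderiv ℝ (F a) x v = 0 := fun a v x hx => by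
    rcases h0 with h0 | h0
    · rw [h0 x hx, zero_mul]
    · rw [hloc' (hFu h0 a) x hx, zero_apply, mul_zero]
  have z3 : ∀ a v, ∀ x ∈ Ω \ Q, F a x * fderiv ℝ φ x v = 0 := fun a v x hx => by
    rcases h0 with h0 | h0
    · rw [hloc' h0 x hx, zero_apply, mul_zero]
    · rw [hFu h0 a x hx, zero_mul]
  have i2 : ∀ a v, IntegrableOn (fun x => φ x * fderiv ℝ (F a) x v) Ω := fun a v =>
    integrableOn_of_eq_zero_off_compact hΩ hQ hQΩ (hφ.continuousOn.mul (hFc' a v)) (z2 a v)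
  have i3 : ∀ a v, IntegrableOn (fun x => F a x * fderiv ℝ φ x v) Ω := fun a v =>
    integrableOn_of_eq_zero_off_compact hΩ hQ hQΩ ((hFc a).mul (hφc' v)) (z3 a v)
  have hprod : ∀ a v, ∀ x ∈ Ω, fderiv ℝ (fun x => φ x * F a x) x v =
      φ x * fderiv ℝ (F a) x v + F a x * fderiv ℝ φ x v := fun a v x hx => by
    rw [fderiv_fun_mul (hφd x hx) (hFd a x hx)]
    rfl
  -- The product φ F vanishes off the compact set when either φ or u does, so its derivative has
  -- integral zero.
  have key : ∀ a v, ∫ x in Ω, φ x * fderiv ℝ (F a) x v = -∫ x in Ω, F a x * fderiv ℝ φ x v := by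
    intro a v
    have h := setIntegral_fderiv_eq_zero hΩ hQ hQΩ (X := fun x => φ x * F a x) (v := v)
      (fun x hx => (hφd x hx).mul (hFd a x hx))
      (((hφ.continuousOn.mul (hFc' a v)).add ((hFc a).mul (hφc' v))).congr (hprod a v)) (z1 a)
    rw [setIntegral_congr_fun hΩ.measurableSet (hprod a v), integral_add (i2 a v) (i3 a v)] at h
    linarith
  have e1 : ∫ x in Ω, g.volDensity i (x, y) * (φ x * g.plaqueLaplacian ⟨i, y⟩ u x) =
      ∑ a, ∫ x in Ω, φ x * fderiv ℝ (F a) x (stdVec a) := by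
    rw [← integral_finsetSum _ fun a _ => i2 a (stdVec a)]
    refine setIntegral_congr_fun hΩ.measurableSet fun x hx => ?_
    have hpos := g.volDensity_pos (hW (a := (x, y)) ⟨hx, rfl⟩)
    have := g.plaqueLaplacian_eq i (fun z => u z.1) (x, y)
    dsimp only at this ⊢
    rw [this, ← Finset.mul_sum, mul_left_comm, mul_inv_cancel_left₀ hpos.ne']
    rfl
  have e2 : ∫ x in Ω, g.volDensity i (x, y) * g.pairing i (x, y) (fderiv ℝ φ x) (fderiv ℝ u x) =
      ∑ a, ∫ x in Ω, F a x * fderiv ℝ φ x (stdVec a) := by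
    rw [← integral_finsetSum _ fun a _ => i3 a (stdVec a)]
    refine setIntegral_congr_fun hΩ.measurableSet fun x hx => ?_
    simp only [hFdef, flux, pairing, mul_assoc, ← Finset.mul_sum, Finset.sum_mul]
    congr 1
    refine Finset.sum_congr rfl fun a _ => Finset.sum_congr rfl fun b _ => ?_
    change _ = (g.gram i (x, y))⁻¹ a b * (fderiv ℝ u x (stdVec b) * fderiv ℝ φ x (stdVec a))
    ring
  rw [e1, e2, ← Finset.sum_neg_distrib]
  exact Finset.sum_congr rfl fun a _ => key a _

lemma pairing_comm {z : Model d × T i} (hz : z ∈ (𝒜.chart i).target) (α β : Model d →L[ℝ] ℝ) :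
    g.pairing i z α β = g.pairing i z β α := by
  have hs : ∀ a b, (g.gram i z)⁻¹ a b = (g.gram i z)⁻¹ b a := fun a b => by
    have := (g.gram_posDef hz).inv.1.apply a b
    simpa using this.symm
  rw [pairing, Finset.sum_comm]
  refine Finset.sum_congr rfl fun a _ => Finset.sum_congr rfl fun b _ => ?_
  rw [hs, mul_comm (α _)]

/-- Green's formula. -/
lemma setIntegral_plaqueLaplacian_comm (hr : 2 ≤ r) (hΩ : IsOpen Ω) (hΩi : Ω ⊆ 𝒜.disc i)
    (hQ : IsCompact Q) (hQΩ : Q ⊆ Ω) {u w : Model d → ℝ} (hu : ContDiffOn ℝ 2 u Ω)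
    (hw : ContDiffOn ℝ 2 w Ω) (h0 : ∀ x ∈ Ω \ Q, u x = 0) :
    ∫ x in Ω, g.volDensity i (x, y) * (w x * g.plaqueLaplacian ⟨i, y⟩ u x) =
      ∫ x in Ω, g.volDensity i (x, y) * (u x * g.plaqueLaplacian ⟨i, y⟩ w x) := by
  rw [g.setIntegral_mul_plaqueLaplacian hr hΩ hΩi hQ hQΩ (hw.of_le (by norm_num)) hu (Or.inr h0),
    g.setIntegral_mul_plaqueLaplacian hr hΩ hΩi hQ hQΩ (hu.of_le (by norm_num)) hw (Or.inl h0)]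
  congr 1
  refine setIntegral_congr_fun hΩ.measurableSet fun x hx => ?_
  rw [g.pairing_comm (𝒜.mem_target.2 (hΩi hx))]

end Green

end LeafwiseMetric

/-! ### Independence of the Laplace operator from the chart -/

namespace LeafwiseMetric

open FoliatedAtlas

variable {M : Type*} [TopologicalSpace M] {d : ℕ} {r : ℕ∞} {ι : Type*} {T : ι → Type*}
  [∀ i, TopologicalSpace (T i)] {𝒜 : FoliatedAtlas M d r T} (g : LeafwiseMetric 𝒜)

section Invariance

variable {i j : ι} {y : T i}

open Matrix in
lemma pairing_eq_dotProduct (z : Model d × T i) (α β : Model d →L[ℝ] ℝ) :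
    g.pairing i z α β =
      (fun a => α (stdVec a)) ⬝ᵥ ((g.gram i z)⁻¹ *ᵥ fun b => β (stdVec b)) := by
  simp only [pairing, dotProduct, mulVec, Finset.mul_sum]
  refine Finset.sum_congr rfl fun a _ => Finset.sum_congr rfl fun b _ => ?_
  ring

open Matrix in
lemma pairing_transition {x : Model d} (hx : x ∈ 𝒜.overlap i j y) (α β : Model d →L[ℝ] ℝ) :
    g.pairing i (x, y) (α.comp (fderiv ℝ (𝒜.transition i j y) x))
      (β.comp (fderiv ℝ (𝒜.transition i j y) x)) =
    g.pairing j (𝒜.transition i j y x, 𝒜.hol i j y) α β := by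
  set B := fderiv ℝ (𝒜.transition i j y) x with hB
  set A := modelMatrix B with hA
  have hG := g.gram_transition hx
  rw [← hB, ← hA] at hG
  have hdet : IsUnit A.det := by
    have h1 := g.gram_det_pos ((𝒜.mem_target (z := (x, y))).2 hx.1)
    rw [hG, det_mul, det_mul, det_transpose] at h1
    refine isUnit_iff_ne_zero.2 fun h0 => ?_
    rw [h0] at h1
    simp at h1
  have hdetT : IsUnit Aᵀ.det := by rwa [det_transpose]
  have hcov : ∀ γ : Model d →L[ℝ] ℝ,
      (fun a => γ.comp B (stdVec a)) = Aᵀ *ᵥ fun a => γ (stdVec a) := fun γ => by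
    funext a
    rw [ContinuousLinearMap.comp_apply, sum_smul_stdVec (B (stdVec a)), map_sum]
    simp only [map_smul, smul_eq_mul, mulVec, dotProduct, transpose_apply]
    rfl
  -- Invert G = Aᵀ G' A; the matrix A is invertible because det G is positive.
  have hinv : A * (g.gram i (x, y))⁻¹ * Aᵀ =
      (g.gram j (𝒜.transition i j y x, 𝒜.hol i j y))⁻¹ := by
    rw [hG, Matrix.mul_inv_rev, Matrix.mul_inv_rev, ← Matrix.mul_assoc, mul_nonsing_inv _ hdet,
      Matrix.one_mul, Matrix.mul_assoc, nonsing_inv_mul _ hdetT, Matrix.mul_one]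
  rw [pairing_eq_dotProduct, pairing_eq_dotProduct, hcov, hcov, ← hinv, ← mulVec_mulVec,
    ← mulVec_mulVec, dotProduct_mulVec (fun a => α (stdVec a)) A, ← mulVec_transpose]

lemma setIntegral_overlap (hr : 1 ≤ r) (hy : y ∈ (𝒜.hol i j).source) (F : Model d → ℝ) :
    ∫ x in 𝒜.overlap j i (𝒜.hol i j y), g.volDensity j (x, 𝒜.hol i j y) * F x =
      ∫ x in 𝒜.overlap i j y, g.volDensity i (x, y) * F (𝒜.transition i j y x) := by
  rw [← 𝒜.image_transition hy, integral_image_eq_integral_abs_det_fderiv_smul volume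
    (𝒜.isOpen_overlap i j y).measurableSet
    (fun x hx => (𝒜.differentiableAt_transition hr hx).hasFDerivAt.hasFDerivWithinAt)
    (𝒜.injOn_transition i j y)]
  refine setIntegral_congr_fun (𝒜.isOpen_overlap i j y).measurableSet fun x hx => ?_
  rw [g.volDensity_transition hx, smul_eq_mul, mul_assoc]

/-- The Laplace operator along the plaques does not depend on the chart. -/
lemma plaqueLaplacian_transition (hr : 2 ≤ r) (hy : y ∈ (𝒜.hol i j).source) {u : Model d → ℝ}
    (hu : ContDiffOn ℝ 2 u (𝒜.overlap j i (𝒜.hol i j y))) {x : Model d}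
    (hx : x ∈ 𝒜.overlap i j y) :
    g.plaqueLaplacian ⟨i, y⟩ (fun x => u (𝒜.transition i j y x)) x =
      g.plaqueLaplacian ⟨j, 𝒜.hol i j y⟩ u (𝒜.transition i j y x) := by
  set O := 𝒜.overlap i j y with hO
  set y' := 𝒜.hol i j y with hy'
  set O' := 𝒜.overlap j i y' with hO'
  set τ := 𝒜.transition i j y with hτ
  set σ := 𝒜.transition j i y' with hσ
  have hr1 : 1 ≤ r := le_trans (by norm_num) hr
  have hr2 : (2 : WithTop ℕ∞) ≤ (r : WithTop ℕ∞) := by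
    have : ((2 : ℕ∞) : WithTop ℕ∞) ≤ r := by exact_mod_cast hr
    exact this
  have hOo : IsOpen O := 𝒜.isOpen_overlap i j y
  have hOo' : IsOpen O' := 𝒜.isOpen_overlap j i y'
  have hOd : O ⊆ 𝒜.disc i := fun _ h => h.1
  have hOd' : O' ⊆ 𝒜.disc j := fun _ h => h.1
  have hτO : ∀ x ∈ O, τ x ∈ O' := fun x hx => 𝒜.transition_mem_overlap hx
  have hστ : ∀ x ∈ O, σ (τ x) = x := fun x hx => 𝒜.transition_transition hx
  have hyy : 𝒜.hol j i y' = y := 𝒜.hol_hol hy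
  have hσO : ∀ x ∈ O', σ x ∈ O := fun x hx => by
    have := 𝒜.transition_mem_overlap hx
    rwa [hyy] at this
  have hτσ : ∀ x ∈ O', τ (σ x) = x := fun x hx => by
    have := 𝒜.transition_transition hx
    rwa [hyy] at this
  have hτ2 : ContDiffOn ℝ 2 τ O := (𝒜.contDiffOn_transition i j y).of_le hr2
  have hσ2 : ContDiffOn ℝ 2 σ O' := (𝒜.contDiffOn_transition j i y').of_le hr2
  have hu' : ContDiffOn ℝ 2 (fun x => u (τ x)) O := hu.comp hτ2 hτO
  have hW : O ×ˢ {y} ⊆ (𝒜.chart i).target := fun z hz => 𝒜.mem_target.2 (hOd hz.1)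
  have hW' : O' ×ˢ {y'} ⊆ (𝒜.chart j).target := fun z hz => 𝒜.mem_target.2 (hOd' hz.1)
  have c1 : ContinuousOn (fun x => g.plaqueLaplacian ⟨i, y⟩ (fun x => u (τ x)) x) O :=
    continuousOn_slice (g.continuousOn_plaqueLaplacian hr hW (tangentiallyC2On_slice hOo hu' y))
  have c2 : ContinuousOn (fun x => g.plaqueLaplacian ⟨j, y'⟩ u (τ x)) O :=
    ContinuousOn.comp (g := fun x => g.plaqueLaplacian ⟨j, y'⟩ u x)
      (continuousOn_slice (g.continuousOn_plaqueLaplacian hr hW'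
        (tangentiallyC2On_slice hOo' hu y'))) (𝒜.continuousOn_transition i j y) hτO
  have c0 : ContinuousOn (fun x => g.volDensity i (x, y)) O :=
    continuousOn_slice ((g.continuousOn_volDensity i).mono hW)
  -- Both expressions satisfy the same weak identity, since the volume and the pairing of covectors
  -- are invariant. Thus `D` has integral zero against every test function, and it vanishes by
  -- continuity. No second derivative of the change of charts is computed.
  set D : Model d → ℝ := fun x => g.volDensity i (x, y) *
    (g.plaqueLaplacian ⟨i, y⟩ (fun x => u (τ x)) x - g.plaqueLaplacian ⟨j, y'⟩ u (τ x)) with hD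
  have hDc : ContinuousOn D O := c0.mul (c1.sub c2)
  have hweak : ∀ φ : Model d → ℝ, ContDiff ℝ (⊤ : ℕ∞) φ → HasCompactSupport φ → tsupport φ ⊆ O →
      ∫ x, φ x • D x = 0 := by
    intro φ hφ hφc hφO
    have hφ0 : ∀ x ∉ tsupport φ, φ x = 0 := fun x hx => image_eq_zero_of_notMem_tsupport hx
    have hφ1 : ContDiffOn ℝ 1 φ O := (hφ.of_le (by simp)).contDiffOn
    -- A smooth test function loses smoothness under a `C^r` change of charts; the weak formula asks
    -- only for class `C^1`.
    have hψ : ContDiffOn ℝ 1 (fun x => φ (σ x)) O' :=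
      hφ1.comp (hσ2.of_le (by norm_num)) hσO
    have w1 := g.setIntegral_mul_plaqueLaplacian (y := y) hr hOo hOd hφc hφO hφ1 hu'
      (Or.inl fun x hx => hφ0 x hx.2)
    have w2 := g.setIntegral_mul_plaqueLaplacian (y := y') (Q := τ '' tsupport φ) hr hOo' hOd'
      (hφc.isCompact.image_of_continuousOn ((𝒜.continuousOn_transition i j y).mono hφO))
      (by rintro _ ⟨x, hx, rfl⟩; exact hτO x (hφO hx)) hψ hu
      (Or.inl fun x hx => hφ0 _ fun h => hx.2 ⟨_, h, hτσ x hx.1⟩)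
    rw [g.setIntegral_overlap hr1 hy (fun x => φ (σ x) * g.plaqueLaplacian ⟨j, y'⟩ u x),
      g.setIntegral_overlap hr1 hy (fun x => g.pairing j (x, y')
        (fderiv ℝ (fun x => φ (σ x)) x) (fderiv ℝ u x))] at w2
    have e1 : ∫ x in O, g.volDensity i (x, y) *
        (φ (σ (τ x)) * g.plaqueLaplacian ⟨j, y'⟩ u (τ x)) =
        ∫ x in O, g.volDensity i (x, y) * (φ x * g.plaqueLaplacian ⟨j, y'⟩ u (τ x)) :=
      setIntegral_congr_fun hOo.measurableSet fun x hx => by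
        rw [hστ x hx]
    have e2 : ∫ x in O, g.volDensity i (x, y) * g.pairing j (τ x, y')
        (fderiv ℝ (fun x => φ (σ x)) (τ x)) (fderiv ℝ u (τ x)) =
        ∫ x in O, g.volDensity i (x, y) * g.pairing i (x, y) (fderiv ℝ φ x)
          (fderiv ℝ (fun x => u (τ x)) x) := by
      refine setIntegral_congr_fun hOo.measurableSet fun x hx => ?_
      have hτd := 𝒜.differentiableAt_transition hr1 hx
      have h1 : fderiv ℝ (fun x => u (τ x)) x = (fderiv ℝ u (τ x)).comp (fderiv ℝ τ x) :=
        fderiv_comp x ((hu.contDiffAt (hOo'.mem_nhds (hτO x hx))).differentiableAt two_ne_zero) hτd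
      have h2 : fderiv ℝ φ x =
          (fderiv ℝ (fun x => φ (σ x)) (τ x)).comp (fderiv ℝ τ x) := by
        rw [← fderiv_comp x ((hψ.contDiffAt (hOo'.mem_nhds (hτO x hx))).differentiableAt
          one_ne_zero) hτd]
        refine Filter.EventuallyEq.fderiv_eq ?_
        filter_upwards [hOo.mem_nhds hx] with x' hx'
        rw [Function.comp_apply, hστ x' hx']
      rw [h1, h2, g.pairing_transition hx]
    have w3 : ∫ x in O, g.volDensity i (x, y) * (φ x * g.plaqueLaplacian ⟨j, y'⟩ u (τ x)) =
        -∫ x in O, g.volDensity i (x, y) * g.pairing i (x, y) (fderiv ℝ φ x)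
          (fderiv ℝ (fun x => u (τ x)) x) := by
      rw [← e1, ← e2]
      exact w2
    have i1 : IntegrableOn (fun x => g.volDensity i (x, y) *
        (φ x * g.plaqueLaplacian ⟨i, y⟩ (fun x => u (τ x)) x)) O :=
      integrableOn_of_eq_zero_off_compact hOo hφc hφO (c0.mul (hφ1.continuousOn.mul c1))
        fun x hx => by rw [hφ0 x hx.2, zero_mul, mul_zero]
    have i2 : IntegrableOn (fun x => g.volDensity i (x, y) *
        (φ x * g.plaqueLaplacian ⟨j, y'⟩ u (τ x))) O :=
      integrableOn_of_eq_zero_off_compact hOo hφc hφO (c0.mul (hφ1.continuousOn.mul c2))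
        fun x hx => by rw [hφ0 x hx.2, zero_mul, mul_zero]
    have w4 := integral_sub i1 i2
    rw [w1, w3, sub_self] at w4
    rw [← setIntegral_eq_integral_of_forall_compl_eq_zero (s := O) fun x hx => by
      rw [hφ0 x fun h => hx (hφO h), zero_smul], ← w4]
    refine setIntegral_congr_fun hOo.measurableSet fun x _ => ?_
    simp only [hD, smul_eq_mul]
    ring
  have hae := hOo.ae_eq_zero_of_integral_contDiff_smul_eq_zero
    (hDc.locallyIntegrableOn hOo.measurableSet) hweak
  have hzero := Measure.eqOn_open_of_ae_eq (f := D) (g := fun _ => 0) (μ := volume)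
    ((ae_restrict_iff' hOo.measurableSet).2 hae) hOo hDc continuousOn_const hx
  have hpos := g.volDensity_pos ((𝒜.mem_target (z := (x, y))).2 (hOd hx))
  exact sub_eq_zero.1 ((mul_eq_zero.1 hzero).resolve_left hpos.ne')

end Invariance

/-- The Laplace operator may be computed in any chart. -/
lemma laplacian_eq (hr : 2 ≤ r) {f : M → ℝ} {p : M} {j : ι} (hp : p ∈ (𝒜.chart j).source)
    (hf : ContDiffOn ℝ 2 (fun x => f (𝒜.plaqueMap ⟨j, (𝒜.chart j p).2⟩ x)) (𝒜.disc j)) :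
    g.laplacian f p = g.plaqueLaplacian ⟨j, (𝒜.chart j p).2⟩
      (fun x => f (𝒜.plaqueMap ⟨j, (𝒜.chart j p).2⟩ x)) (𝒜.chart j p).1 := by
  rw [laplacian]
  set i := (𝒜.cover p).choose with hi
  have hpi : p ∈ (𝒜.chart i).source := (𝒜.cover p).choose_spec
  set y := (𝒜.chart i p).2 with hy
  set x := (𝒜.chart i p).1 with hx
  have hpx : 𝒜.plaqueMap ⟨i, y⟩ x = p := 𝒜.plaqueMap_chart hpi
  have hxO : x ∈ 𝒜.overlap i j y := ⟨𝒜.chart_fst_mem_disc hpi, by rwa [hpx]⟩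
  have hsrc := 𝒜.mem_hol_source_of_mem_overlap hxO
  have hhol : 𝒜.hol i j y = (𝒜.chart j p).2 := 𝒜.hol_apply i j p hpi hp
  have hτ : 𝒜.transition i j y x = (𝒜.chart j p).1 := by
    rw [transition, hpx]
  rw [← hhol] at hf ⊢
  rw [← hτ, ← g.plaqueLaplacian_transition hr hsrc (hf.mono fun _ h => h.1) hxO]
  refine g.plaqueLaplacian_congr ?_
  filter_upwards [(𝒜.isOpen_overlap i j y).mem_nhds hxO] with x' hx'
  rw [𝒜.plaqueMap_transition hx']

end LeafwiseMetric

/-! ### Harmonicity of the limits -/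

namespace LeafwiseMetric

open FoliatedAtlas

variable {M : Type*} [TopologicalSpace M] {d : ℕ} {r : ℕ∞} {ι : Type*} {T : ι → Type*}
  [∀ i, TopologicalSpace (T i)] {𝒜 : FoliatedAtlas M d r T} (g : LeafwiseMetric 𝒜)

lemma plaqueLaplacian_zero (s : Σ i, T i) (x : Model d) :
    g.plaqueLaplacian s (fun _ => 0) x = 0 := by
  simp [plaqueLaplacian]

lemma plaqueLaplacian_const_mul (s : Σ i, T i) (c : ℝ) (u : Model d → ℝ) (x : Model d) :
    g.plaqueLaplacian s (fun x => c * u x) x = c * g.plaqueLaplacian s u x := by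
  have h : ∀ (w : Model d → ℝ) (x v : Model d),
      fderiv ℝ (fun x => c * w x) x v = c * fderiv ℝ w x v := fun w x v => by
    have := fderiv_const_smul_field (𝕜 := ℝ) (f := w) c
    change fderiv ℝ (c • w) x v = _
    rw [this]
    rfl
  simp only [plaqueLaplacian, h]
  have : ∀ a, (fun x' => g.volDensity s.1 (x', s.2) *
      ∑ b, (g.gram s.1 (x', s.2))⁻¹ a b * (c * fderiv ℝ u x' (stdVec b))) =
      fun x' => c * (g.volDensity s.1 (x', s.2) *
        ∑ b, (g.gram s.1 (x', s.2))⁻¹ a b * fderiv ℝ u x' (stdVec b)) := fun a => by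
    funext x'
    rw [mul_left_comm c, Finset.mul_sum (a := c)]
    congr 1
    exact Finset.sum_congr rfl fun b _ => by ring
  simp only [this, h, ← Finset.mul_sum]
  ring

/-- The outer derivative acts on the flux, so additivity requires each flux to be differentiable;
class `C^2` ensures this. -/
lemma plaqueLaplacian_sum {κ : Type*} {S : Finset κ} (hr : 2 ≤ r) {i : ι} {y : T i}
    {u : κ → Model d → ℝ} (hu : ∀ k ∈ S, ContDiffOn ℝ 2 (u k) (𝒜.disc i)) {x : Model d}
    (hx : x ∈ 𝒜.disc i) :
    g.plaqueLaplacian ⟨i, y⟩ (fun x => ∑ k ∈ S, u k x) x =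
      ∑ k ∈ S, g.plaqueLaplacian ⟨i, y⟩ (u k) x := by
  have hO := 𝒜.isOpen_disc i
  have hW : 𝒜.disc i ×ˢ {y} ⊆ (𝒜.chart i).target := fun z hz => 𝒜.mem_target.2 hz.1
  have hF := fun k hk => g.tangentiallyC1On_flux hr hW (tangentiallyC2On_slice hO (hu k hk) y)
  have h1 : ∀ x ∈ 𝒜.disc i, ∀ v,
      fderiv ℝ (fun x => ∑ k ∈ S, u k x) x v = ∑ k ∈ S, fderiv ℝ (u k) x v := fun x hx v => by
    rw [fderiv_fun_sum fun k hk => ((hu k hk).contDiffAt (hO.mem_nhds hx)).differentiableAt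
      two_ne_zero, sum_apply]
  have h2 : ∀ a, (fun x' => g.volDensity i (x', y) * ∑ b, (g.gram i (x', y))⁻¹ a b *
      fderiv ℝ (fun x => ∑ k ∈ S, u k x) x' (stdVec b)) =ᶠ[𝓝 x]
      fun x' => ∑ k ∈ S, g.flux i (fun z => u k z.1) a (x', y) := fun a => by
    filter_upwards [hO.mem_nhds hx] with x' hx'
    simp only [flux, h1 x' hx', Finset.mul_sum]
    exact Finset.sum_comm
  have h3 : ∀ a, fderiv ℝ (fun x' => ∑ k ∈ S, g.flux i (fun z => u k z.1) a (x', y)) x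
      (stdVec a) = ∑ k ∈ S, tangentialDeriv (g.flux i (fun z => u k z.1) a) (stdVec a) (x, y) :=
    fun a => by
      rw [fderiv_fun_sum fun k hk => (hF k hk a).1 (x, y) ⟨hx, rfl⟩, sum_apply]
      rfl
  have e : ∀ k ∈ S, g.plaqueLaplacian ⟨i, y⟩ (u k) x = (g.volDensity i (x, y))⁻¹ *
      ∑ a, tangentialDeriv (g.flux i (fun z => u k z.1) a) (stdVec a) (x, y) := fun k _ =>
    g.plaqueLaplacian_eq i (fun z => u k z.1) (x, y)
  rw [Finset.sum_congr rfl e, ← Finset.mul_sum, Finset.sum_comm, plaqueLaplacian]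
  congr 1
  refine Finset.sum_congr rfl fun a _ => ?_
  rw [(h2 a).fderiv_eq, h3]

lemma contDiffOn_plaque {n : ℕ∞} {f : M → ℝ} (hf : 𝒜.TangentiallyContDiff n f) (s : Σ i, T i) :
    ContDiffOn ℝ n (fun x => f (𝒜.plaqueMap s x)) (𝒜.disc s.1) :=
  ((hf s.1).1 s.2).mono fun _ hx => 𝒜.mem_target.2 hx

lemma laplacian_eq_zero {f : M → ℝ} {p : M} (hf : f =ᶠ[𝓝 p] fun _ => 0) :
    g.laplacian f p = 0 := by
  rw [laplacian]
  set i := (𝒜.cover p).choose with hi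
  have hpi : p ∈ (𝒜.chart i).source := (𝒜.cover p).choose_spec
  have hx := 𝒜.chart_fst_mem_disc hpi
  have hc := (𝒜.continuousOn_plaqueMap ⟨i, (𝒜.chart i p).2⟩).continuousAt
    ((𝒜.isOpen_disc i).mem_nhds hx)
  have hev : (fun x => f (𝒜.plaqueMap ⟨i, (𝒜.chart i p).2⟩ x)) =ᶠ[𝓝 (𝒜.chart i p).1]
      fun _ => 0 := by
    rw [ContinuousAt, 𝒜.plaqueMap_chart hpi] at hc
    exact hc.eventually hf
  rw [g.plaqueLaplacian_congr hev, plaqueLaplacian_zero]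

variable [Fintype ι] {ρ : PartitionOfUnity ι M} {δ : (Σ i, T i) → (Σ i, T i) → ℝ}

/-- The chart chosen at `p` does not depend on the function, so this is additivity within a single
chart. It reduces `Δ f` to functions supported in the charts. -/
lemma laplacian_eq_sum (hr : 2 ≤ r) (hρr : ∀ i, 𝒜.TangentiallyContDiff r (ρ i)) {f : M → ℝ}
    (hf : 𝒜.TangentiallyContDiff 2 f) (p : M) :
    g.laplacian f p = ∑ j, g.laplacian (fun q => ρ j q * f q) p := by
  simp only [laplacian]
  set i := (𝒜.cover p).choose with hi
  have hpi : p ∈ (𝒜.chart i).source := (𝒜.cover p).choose_spec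
  have hr2 : ((2 : ℕ∞) : WithTop ℕ∞) ≤ (r : WithTop ℕ∞) := by exact_mod_cast hr
  rw [← g.plaqueLaplacian_sum hr (S := Finset.univ)
    (u := fun j x => ρ j (𝒜.plaqueMap ⟨i, (𝒜.chart i p).2⟩ x) *
      f (𝒜.plaqueMap ⟨i, (𝒜.chart i p).2⟩ x)) ?_ (𝒜.chart_fst_mem_disc hpi)]
  · congr 1
    funext x
    rw [← Finset.sum_mul]
    have := ρ.sum_eq_one (mem_univ (𝒜.plaqueMap ⟨i, (𝒜.chart i p).2⟩ x))
    rw [finsum_eq_sum_of_fintype] at this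
    rw [this, one_mul]
  · intro j _
    exact ((contDiffOn_plaque (hρr j) ⟨i, _⟩).of_le hr2).mul (contDiffOn_plaque hf ⟨i, _⟩)

lemma tangentiallyC2On_primitive (hr : 2 ≤ r) (hδ : 𝒜.IsContinuousCocycle δ)
    (hρ : ρ.IsSubordinate fun i => (𝒜.chart i).source)
    (hρr : ∀ i, 𝒜.TangentiallyContDiff r (ρ i)) (i : ι) :
    TangentiallyC2On (𝒜.primitive ρ δ i) (𝒜.chart i).target :=
  ((tangentiallyContDiffOn_logPrimitive hδ hρ hρr i).tangentiallyC2On hr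
    (isOpen_slice (𝒜.chart i).open_target)).exp fun z hz =>
      (isOpen_slice (𝒜.chart i).open_target z.2).mem_nhds hz

/-- The explicit density is harmonic on the plaques of the leaves with a harmonic density. -/
lemma plaqueLaplacian_primitive_eq_zero (hr : 2 ≤ r)
    (hρ : ρ.IsSubordinate fun i => (𝒜.chart i).source)
    (hρr : ∀ i, 𝒜.TangentiallyContDiff r (ρ i)) {k : M → ℝ} {t : Σ i, T i}
    (hk : 𝒜.IsPrimitiveOn (𝒜.modularForm ρ δ) k (𝒜.leaf t)) {p : M} (hp : p ∈ 𝒜.leaf t)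
    (h0 : g.laplacian k p = 0) {i : ι} (hpi : p ∈ (𝒜.chart i).source) :
    g.plaqueLaplacian ⟨i, (𝒜.chart i p).2⟩ (fun x => 𝒜.primitive ρ δ i (x, (𝒜.chart i p).2))
      (𝒜.chart i p).1 = 0 := by
  have hr1 : 1 ≤ r := le_trans (by norm_num) hr
  have hr2 : ((2 : ℕ∞) : WithTop ℕ∞) ≤ (r : WithTop ℕ∞) := by exact_mod_cast hr
  set s : Σ i, T i := ⟨i, (𝒜.chart i p).2⟩ with hs
  have hrel : 𝒜.Rel t s := rel_of_mem_leaf hp hpi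
  set c := k (𝒜.base s) / 𝒜.primitive ρ δ i (0, (𝒜.chart i p).2) with hc
  have hcpos : 0 < c := div_pos (hk.1 _ (𝒜.plaqueMap_mem_leaf hrel (𝒜.zero_mem_disc i)))
    (primitive_pos _ _)
  have hkc : ∀ x ∈ 𝒜.disc i, k (𝒜.plaqueMap s x) = c * 𝒜.primitive ρ δ i (x, (𝒜.chart i p).2) :=
    fun x hx => hk.eq_mul_primitive hr1 hρ hρr hrel hx
  have hC2 : ContDiffOn ℝ 2 (fun x => 𝒜.primitive ρ δ i (x, (𝒜.chart i p).2)) (𝒜.disc i) :=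
    (contDiffOn_primitive hρr i _).of_le hr2
  rw [g.laplacian_eq hr hpi ((contDiffOn_const.mul hC2).congr hkc),
    g.plaqueLaplacian_congr (v := fun x => c * 𝒜.primitive ρ δ i (x, (𝒜.chart i p).2)) ?_,
    plaqueLaplacian_const_mul] at h0
  · exact (mul_eq_zero.1 h0).resolve_left hcpos.ne'
  · filter_upwards [(𝒜.isOpen_disc i).mem_nhds (𝒜.chart_fst_mem_disc hpi)] with x hx
    exact hkc x hx

lemma plaqueIntegral_eq_setIntegral (i : ι) (f : M → ℝ) (y : T i) :
    g.plaqueIntegral ρ δ i f y =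
      ∫ x in 𝒜.disc i, g.totalDensity ρ δ i (x, y) * f (𝒜.plaqueMap ⟨i, y⟩ x) := by
  rw [plaqueIntegral, ← setIntegral_eq_integral_of_forall_compl_eq_zero (s := 𝒜.disc i)
    fun x hx => g.chartDensity_of_notMem hx]
  exact setIntegral_congr_fun (𝒜.isOpen_disc i).measurableSet fun x hx =>
    g.chartDensity_of_mem hx

lemma chartDensity_sub (i : ι) (f f' : M → ℝ) (z : Model d × T i) :
    g.chartDensity ρ δ i f z - g.chartDensity ρ δ i f' z =
      g.chartDensity ρ δ i (fun p => f p - f' p) z := by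
  simp only [chartDensity]
  split_ifs
  · ring
  · ring

section Limit

variable [MeasurableSpace M] [BorelSpace M] [CompactSpace M] [T2Space M]
  [∀ i, TopologicalSpace.SeparableSpace (T i)] [∀ i, TopologicalSpace.MetrizableSpace (T i)]
  [∀ i, LocallyCompactSpace (T i)] {h : M → ℝ} {y : ℕ → Σ i, T i} {V : ℕ → Set M}

/-- Functions with the same integrals over the plaques of a chart have the same integral with
respect to a limit of averaging measures. -/
lemma IsAveragingLimit.integral_eq_of_plaqueIntegral_eq (hd : 1 ≤ d) (hr : 1 ≤ r)
    (hδ : 𝒜.IsContinuousCocycle δ) (hρ : ρ.IsSubordinate fun i => (𝒜.chart i).source)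
    (hρr : ∀ i, 𝒜.TangentiallyContDiff r (ρ i))
    (hV : g.IsAveragingSequence ρ (𝒜.modularForm ρ δ) h y V) {μ : Measure M}
    (hμ : g.IsAveragingLimit ρ h y V μ) {i : ι} {A : Set M} (hA : IsCompact A)
    (hAi : A ⊆ (𝒜.chart i).source) {f f' : M → ℝ} (hf : Continuous f) (hf' : Continuous f')
    (hfA : ∀ p ∉ A, f p = 0) (hfA' : ∀ p ∉ A, f' p = 0)
    (heq : ∀ y, g.plaqueIntegral ρ δ i f y = g.plaqueIntegral ρ δ i f' y) :
    ∫ p, f p ∂μ = ∫ p, f' p ∂μ := by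
  have := hμ.1
  obtain ⟨R, hR0, hR, K, hK, hRK⟩ := exists_compact_prod (R₀ := 𝒜.radius i / 2) hA hAi
    (by linarith [𝒜.radius_pos i])
  have hQd : Metric.closedBall (0 : Model d) R ⊆ 𝒜.disc i := Metric.closedBall_subset_ball hR
  have hsupp : ∀ {w : M → ℝ}, (∀ p ∉ A, w p = 0) → ∀ p ∈ (𝒜.chart i).source, w p ≠ 0 →
      (𝒜.chart i p).1 ∈ Metric.closedBall 0 R ∧ (𝒜.chart i p).2 ∈ K := fun hw p _ hp =>
    hRK p (by_contra fun h => hp (hw p h))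
  -- The spread identity is available for nonnegative functions. The sums f⁺ + f'⁻ and f'⁺ + f⁻ are
  -- nonnegative, with difference f - f', so their plaque integrals also agree.
  set u : M → ℝ := fun p => max (f p) 0 + max (-f' p) 0 with hu
  set u' : M → ℝ := fun p => max (f' p) 0 + max (-f p) 0 with hu'
  have huc : Continuous u := by fun_prop
  have huc' : Continuous u' := by fun_prop
  have hu0 : ∀ p, 0 ≤ u p := fun p => add_nonneg (le_max_right _ _) (le_max_right _ _)
  have hu0' : ∀ p, 0 ≤ u' p := fun p => add_nonneg (le_max_right _ _) (le_max_right _ _)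
  have huA : ∀ p ∉ A, u p = 0 := fun p hp => by simp [hu, hfA p hp, hfA' p hp]
  have huA' : ∀ p ∉ A, u' p = 0 := fun p hp => by simp [hu', hfA p hp, hfA' p hp]
  have hsub : ∀ p, u p - u' p = f p - f' p := fun p => by
    have h1 := max_zero_sub_max_neg_zero_eq_self (f p)
    have h2 := max_zero_sub_max_neg_zero_eq_self (f' p)
    simp only [hu, hu']
    linarith
  have hint : ∀ {w : M → ℝ}, Continuous w → (∀ p ∉ A, w p = 0) → ∀ y,
      Integrable fun x => g.chartDensity ρ δ i w (x, y) := fun hw hwA y =>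
    g.integrable_chartDensity hδ hρ hρr hw (isCompact_closedBall _ _) hQd hK (hsupp hwA) y
  have hpl : ∀ y, g.plaqueIntegral ρ δ i u y = g.plaqueIntegral ρ δ i u' y := fun y => by
    have h1 := integral_sub (hint huc huA y) (hint huc' huA' y)
    have h2 := integral_sub (hint hf hfA y) (hint hf' hfA' y)
    simp only [chartDensity_sub, hsub] at h1 h2
    have h3 := heq y
    simp only [plaqueIntegral] at h3 ⊢
    linarith
  -- The spread depends on a function only through its plaque integrals.
  have hspread : g.spread ρ δ i u = g.spread ρ δ i u' := by
    funext p
    simp only [spread, hpl]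
  have k1 := IsAveragingLimit.lintegral_spread g hd hr hδ hρ hρr hV hμ huc hu0
    (fun p hp => huA p fun h => hp (hAi h)) hR0 hR hK (hsupp huA)
  have k2 := IsAveragingLimit.lintegral_spread g hd hr hδ hρ hρr hV hμ huc' hu0'
    (fun p hp => huA' p fun h => hp (hAi h)) hR0 hR hK (hsupp huA')
  rw [hspread, k2] at k1
  have k3 := (ENNReal.mul_right_inj (lintegral_kernel_ne_zero i) (lintegral_kernel_ne_top i)).1 k1
  have hi : ∀ {w : M → ℝ}, Continuous w → Integrable w μ := fun hw =>
    hw.integrable_of_hasCompactSupport (HasCompactSupport.of_compactSpace _)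
  have k4 : ∫ p, u p ∂μ = ∫ p, u' p ∂μ := by
    rw [integral_eq_lintegral_of_nonneg_ae (Eventually.of_forall hu0)
      huc.aestronglyMeasurable, integral_eq_lintegral_of_nonneg_ae (Eventually.of_forall hu0')
      huc'.aestronglyMeasurable, k3]
  have k5 := integral_sub (hi huc) (hi huc')
  have k6 := integral_sub (hi hf) (hi hf')
  simp only [hsub] at k5
  linarith

open Classical in
/-- The contribution of one chart to the integral of `Δ f` vanishes. -/
lemma IsAveragingLimit.integral_laplacian_mul (hd : 1 ≤ d) (hr : 2 ≤ r)
    (hδ : 𝒜.IsContinuousCocycle δ) (hρ : ρ.IsSubordinate fun i => (𝒜.chart i).source)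
    (hρr : ∀ i, 𝒜.TangentiallyContDiff r (ρ i))
    (hV : g.IsAveragingSequence ρ (𝒜.modularForm ρ δ) h y V) {μ : Measure M}
    (hμ : g.IsAveragingLimit ρ h y V μ) {k : M → ℝ}
    (hk : ∀ n, 𝒜.IsPrimitiveOn (𝒜.modularForm ρ δ) k (𝒜.leaf (y n)) ∧
      ∀ p ∈ 𝒜.leaf (y n), g.laplacian k p = 0) {f : M → ℝ}
    (hf : 𝒜.TangentiallyContDiff 2 f) (i : ι) :
    Continuous (g.laplacian fun p => ρ i p * f p) ∧
      ∫ p, g.laplacian (fun p => ρ i p * f p) p ∂μ = 0 := by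
  have := hμ.1
  have := 𝒜.secondCountableTopology
  have hr1 : 1 ≤ r := le_trans (by norm_num) hr
  have hr2 : ((2 : ℕ∞) : WithTop ℕ∞) ≤ (r : WithTop ℕ∞) := by exact_mod_cast hr
  have hslice := isOpen_slice (𝒜.chart i).open_target
  set A := tsupport (ρ i) with hA
  have hAc : IsCompact A := (isClosed_tsupport _).isCompact
  have hAi : A ⊆ (𝒜.chart i).source := hρ i
  have hA0 : ∀ p ∉ A, ρ i p = 0 := fun p hp => image_eq_zero_of_notMem_tsupport hp
  -- the function and the density in the chart
  set U : Model d × T i → ℝ := fun z =>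
    ρ i ((𝒜.chart i).symm z) * f ((𝒜.chart i).symm z) with hU
  have hU2 : TangentiallyC2On U (𝒜.chart i).target :=
    ((hρr i i).tangentiallyC2On hr hslice).mul ((hf i).tangentiallyC2On le_rfl hslice)
      fun z hz => (hslice z.2).mem_nhds hz
  have hUs : ∀ y, ContDiffOn ℝ 2 (fun x => U (x, y)) (𝒜.disc i) := fun y =>
    ((contDiffOn_plaque (hρr i) ⟨i, y⟩).of_le hr2).mul (contDiffOn_plaque hf ⟨i, y⟩)
  have hHs : ∀ y, ContDiffOn ℝ 2 (fun x => 𝒜.primitive ρ δ i (x, y)) (𝒜.disc i) := fun y =>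
    (contDiffOn_primitive hρr i y).of_le hr2
  set L : Model d × T i → ℝ := fun z =>
    g.plaqueLaplacian ⟨i, z.2⟩ (fun x => U (x, z.2)) z.1 with hL
  set LH : Model d × T i → ℝ := fun z =>
    g.plaqueLaplacian ⟨i, z.2⟩ (fun x => 𝒜.primitive ρ δ i (x, z.2)) z.1 with hLH
  have hLc : ContinuousOn L (𝒜.chart i).target :=
    g.continuousOn_plaqueLaplacian hr Subset.rfl hU2
  have hLHc : ContinuousOn LH (𝒜.chart i).target :=
    g.continuousOn_plaqueLaplacian hr Subset.rfl (tangentiallyC2On_primitive hr hδ hρ hρr i)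
  have hchart : ContinuousOn (𝒜.chart i) (𝒜.chart i).source := (𝒜.chart i).continuousOn
  have hmaps : MapsTo (𝒜.chart i) (𝒜.chart i).source (𝒜.chart i).target :=
    fun p hp => (𝒜.chart i).map_source hp
  -- the first function
  set F : M → ℝ := g.laplacian fun p => ρ i p * f p with hF
  -- At each point the Laplace operator is defined by an arbitrarily chosen chart; computing it in
  -- the chart `i` throughout yields continuity.
  have hFs : ∀ p ∈ (𝒜.chart i).source, F p = L (𝒜.chart i p) := fun p hp =>
    g.laplacian_eq hr hp (hUs _)
  have hF0 : ∀ p ∉ A, F p = 0 := fun p hp => by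
    refine g.laplacian_eq_zero ?_
    filter_upwards [(isClosed_tsupport (ρ i)).isOpen_compl.mem_nhds hp] with q hq
    rw [hA0 q hq, zero_mul]
  have hFc : Continuous F := continuous_of_eq_zero_off_compact (𝒜.chart i).open_source hAc hAi
    ((hLc.comp hchart hmaps).congr hFs) hF0
  -- the second function
  set G : M → ℝ := fun p => if p ∈ (𝒜.chart i).source then
    U (𝒜.chart i p) * LH (𝒜.chart i p) / 𝒜.primitive ρ δ i (𝒜.chart i p) else 0 with hG
  have hGs : ∀ p ∈ (𝒜.chart i).source, G p =
      U (𝒜.chart i p) * LH (𝒜.chart i p) / 𝒜.primitive ρ δ i (𝒜.chart i p) := fun p hp =>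
    if_pos hp
  have hG0 : ∀ p ∉ A, G p = 0 := fun p hp => by
    by_cases hps : p ∈ (𝒜.chart i).source
    · rw [hGs p hps]
      simp only [hU, (𝒜.chart i).left_inv hps, hA0 p hp, zero_mul, zero_div]
    · exact if_neg hps
  have hGc : Continuous G := by
    refine continuous_of_eq_zero_off_compact (𝒜.chart i).open_source hAc hAi
      (ContinuousOn.congr ?_ hGs) hG0
    exact ((hU2.c1.continuousOn.mul hLHc).div (continuousOn_primitive hδ hρ hρr i)
      fun z _ => (primitive_pos i z).ne').comp hchart hmaps
  refine ⟨hFc, ?_⟩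
  -- Green's formula on the plaque moves the Laplace operator from U = ρᵢ f to the density H;
  -- division by H in `G` compensates for the H in the total density.
  have heq : ∀ y, g.plaqueIntegral ρ δ i F y = g.plaqueIntegral ρ δ i G y := by
    intro y
    obtain ⟨R, -, hR, K, -, hRK⟩ := exists_compact_prod (R₀ := 0) hAc hAi (𝒜.radius_pos i)
    have hgreen := g.setIntegral_plaqueLaplacian_comm (y := y)
      (Q := Metric.closedBall (0 : Model d) R) hr (𝒜.isOpen_disc i) Subset.rfl
      (isCompact_closedBall _ _) (Metric.closedBall_subset_ball hR) (hUs y) (hHs y) fun x hx => by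
        have hxt : (x, y) ∈ (𝒜.chart i).target := 𝒜.mem_target.2 hx.1
        have : (𝒜.chart i).symm (x, y) ∉ A := fun h' => hx.2 (by
          have := (hRK _ h').1
          rwa [(𝒜.chart i).right_inv hxt] at this)
        simp only [hU, hA0 _ this, zero_mul]
    rw [plaqueIntegral_eq_setIntegral, plaqueIntegral_eq_setIntegral]
    refine Eq.trans ?_ (hgreen.trans ?_)
    · refine setIntegral_congr_fun (𝒜.isOpen_disc i).measurableSet fun x hx => ?_
      have hps := 𝒜.plaqueMap_mem_source (s := ⟨i, y⟩) hx
      have hch := 𝒜.chart_plaqueMap (s := ⟨i, y⟩) hx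
      simp only [hFs _ hps, hch, totalDensity, hL]
      ring
    · refine setIntegral_congr_fun (𝒜.isOpen_disc i).measurableSet fun x hx => ?_
      have hps := 𝒜.plaqueMap_mem_source (s := ⟨i, y⟩) hx
      have hch := 𝒜.chart_plaqueMap (s := ⟨i, y⟩) hx
      have hpos := primitive_pos (𝒜 := 𝒜) (ρ := ρ) (δ := δ) i (x, y)
      simp only [hGs _ hps, hch, totalDensity, hLH]
      field_simp
  rw [IsAveragingLimit.integral_eq_of_plaqueIntegral_eq g hd hr1 hδ hρ hρr hV hμ hAc hAi hFc hGc
    hF0 hG0 heq]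
  -- ΔH vanishes at points of the domains `V n` in the chart, since H is there a multiple of the
  -- harmonic density. It is continuous across plaques, so it also vanishes at limits of such
  -- points, possibly on other leaves.
  have hLim : ∀ p ∈ limitSet V, G p = 0 := by
    rintro p ⟨φ, q, -, hq, hqp⟩
    by_cases hps : p ∈ (𝒜.chart i).source
    · have hev : ∀ᶠ m in atTop, LH (𝒜.chart i (q m)) = 0 := by
        filter_upwards [hqp.eventually ((𝒜.chart i).open_source.mem_nhds hps)] with m hm
        have hl := (hV.domain (φ m)).1 (hq m)
        exact g.plaqueLaplacian_primitive_eq_zero hr hρ hρr (hk (φ m)).1 hl ((hk (φ m)).2 _ hl) hm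
      have hc : ContinuousAt (fun p => LH (𝒜.chart i p)) p :=
        (hLHc.comp hchart hmaps).continuousAt ((𝒜.chart i).open_source.mem_nhds hps)
      have hlim := (hc.tendsto.comp hqp).congr' hev
      rw [hGs p hps, tendsto_nhds_unique hlim tendsto_const_nhds, mul_zero, zero_div]
    · exact if_neg hps
  refine integral_eq_zero_of_ae ?_
  filter_upwards [Measure.support_mem_ae (μ := μ)] with p hp
  exact hLim p (IsAveragingLimit.support_subset g hV hμ hp)

lemma IsAveragingLimit.isHarmonicMeasure (hd : 1 ≤ d) (hr : 3 ≤ r)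
    (hδ : 𝒜.IsContinuousCocycle δ) (hρ : ρ.IsSubordinate fun i => (𝒜.chart i).source)
    (hρr : ∀ i, 𝒜.TangentiallyContDiff r (ρ i))
    (hV : g.IsAveragingSequence ρ (𝒜.modularForm ρ δ) h y V) {μ : Measure M}
    (hμ : g.IsAveragingLimit ρ h y V μ) {k : M → ℝ}
    (hk : ∀ n, 𝒜.IsPrimitiveOn (𝒜.modularForm ρ δ) k (𝒜.leaf (y n)) ∧
      ∀ p ∈ 𝒜.leaf (y n), g.laplacian k p = 0) : g.IsHarmonicMeasure μ := by
  intro f hf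
  have := hμ.1
  have hr2 : 2 ≤ r := le_trans (by norm_num) hr
  -- The condition `3 ≤ r` makes test functions of class `C^{r-1}` twice differentiable along the
  -- leaves.
  have hr' : 2 ≤ r - 1 := ENat.le_sub_of_add_le_right (by simp) (by norm_num; exact hr)
  have hf2 : 𝒜.TangentiallyContDiff 2 f := fun i =>
    ⟨fun y => ((hf i).1 y).of_le (by exact_mod_cast hr'), fun m hm => (hf i).2 m (hm.trans hr')⟩
  have key := IsAveragingLimit.integral_laplacian_mul g hd hr2 hδ hρ hρr hV hμ hk hf2
  simp only [g.laplacian_eq_sum hr2 hρr hf2]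
  rw [integral_finsetSum]
  · exact Finset.sum_eq_zero fun j _ => (key j).2
  · exact fun j _ => (key j).1.integrable_of_hasCompactSupport
      (HasCompactSupport.of_compactSpace _)

end Limit

end LeafwiseMetric

end Lamination

end

theorem theorem4p1
    {M : Type*} [TopologicalSpace M] [CompactSpace M] [T2Space M]
    [MeasurableSpace M] [BorelSpace M]
    {d : ℕ} (hd : 1 ≤ d) {r : ℕ∞} (hr : 1 ≤ r)
    -- the lamination, given by a finite foliated atlas with total transversal `Σ i, T i`
    {ι : Type*} [Fintype ι] {T : ι → Type*} [∀ i, TopologicalSpace (T i)]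
    [∀ i, LocallyCompactSpace (T i)] [∀ i, TopologicalSpace.SeparableSpace (T i)]
    [∀ i, TopologicalSpace.MetrizableSpace (T i)]
    [∀ i, MeasurableSpace (T i)] [∀ i, BorelSpace (T i)]
    (𝒜 : Lamination.FoliatedAtlas M d r T)
    (g : Lamination.LeafwiseMetric 𝒜)
    -- the continuous cocycle, and the partition of unity used to construct its modular form
    (δ : (Σ i, T i) → (Σ i, T i) → ℝ) (hδ : 𝒜.IsContinuousCocycle δ)
    (ρ : PartitionOfUnity ι M) (hρ : ρ.IsSubordinate fun i => (𝒜.chart i).source)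
    (hρr : ∀ i, 𝒜.TangentiallyContDiff r (ρ i))
    -- a foliated atlas of the same lamination, with plaques of bounded modified volume
    {ι' : Type*} {T' : ι' → Type*} [∀ i, TopologicalSpace (T' i)]
    [∀ i, LocallyCompactSpace (T' i)] [∀ i, TopologicalSpace.SeparableSpace (T' i)]
    [∀ i, TopologicalSpace.MetrizableSpace (T' i)]
    (ℬ : Lamination.FoliatedAtlas M d r T') (hℬ : 𝒜.Compatible ℬ)
    (hbdd : g.HasBoundedPlaques ρ (𝒜.modularForm ρ δ) ℬ)
    -- an averaging sequence
    (h : M → ℝ) (y : ℕ → Σ i, T i) (V : ℕ → Set M)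
    (hV : g.IsAveragingSequence ρ (𝒜.modularForm ρ δ) h y V) :
    (∃ μ : MeasureTheory.Measure M, g.IsAveragingLimit ρ h y V μ) ∧
    ∀ μ : MeasureTheory.Measure M, g.IsAveragingLimit ρ h y V μ →
      g.IsTangentiallySmooth μ ∧
      μ.support ⊆ Lamination.LeafwiseMetric.limitSet V ∧
      g.HasModularForm μ (𝒜.modularForm ρ δ) ∧
      -- the Laplace operator along the leaves requires `3 ≤ r`
      (3 ≤ r →
        (∃ k : M → ℝ, ∀ n, 𝒜.IsPrimitiveOn (𝒜.modularForm ρ δ) k (𝒜.leaf (y n)) ∧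
          ∀ p ∈ 𝒜.leaf (y n), g.laplacian k p = 0) →
        g.IsHarmonicMeasure μ) := by
  have hsc := fun i => Lamination.FoliatedAtlas.secondCountableTopology_transversal (X := T i)
  refine ⟨g.exists_isAveragingLimit hr hδ hρ hρr hV, fun μ hμ => ?_⟩
  have hmod := Lamination.LeafwiseMetric.IsAveragingLimit.hasModularForm g hd hr hδ hρ hρr hV hμ
  exact ⟨Lamination.LeafwiseMetric.HasModularForm.isTangentiallySmooth g hmod,
    Lamination.LeafwiseMetric.IsAveragingLimit.support_subset g hV hμ, hmod, fun hr3 ⟨_, hk⟩ =>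
      Lamination.LeafwiseMetric.IsAveragingLimit.isHarmonicMeasure g hd hr3 hδ hρ hρr hV hμ hk⟩
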